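/- **Setting.** Let $T=\{1,\dots,L\}^2$ be the discrete $L\times L$ torus with distance $d(s,t)=|x(s)-x(t)|_L+|y(s)-y(t)|_L$, where $|a|_L=\min(|a|,L-|a|)$. At every site there is a finite-dimensional Hilbert space made of spins and finitely many fermionic orbitals; $\mathcal H$ is the resulting finite-dimensional Hilbert space, and $\mathcal A_Z$ is the algebra of operators of even fermionic parity supported on $Z\subset T$. For each $s\in T$ let $q_s=q_s^\dagger\in\mathcal A_{\{s\}}$ have its eigenvalues in $\{0,1,\dots,q_{\max}\}$, and put $Q=\sum_s q_s$, $Q_X=\sum_{1\le x(s)\le L/2}q_s$, $Q_Y=\sum_{1\le y(s)\le L/2}q_s$. Let $H_0=\sum_{Z\subset T}\Phi(Z)$ with $\Phi(Z)=\Phi(Z)^\dagger\in\mathcal A_Z$, $\sup_s\sum_{Z\ni s}\|\Phi(Z)\|\le J$, and $\Phi(Z)=0$ if $\operatorname{diam}Z>R$ or $|Z|>k_{\max}$, where $J>0$, $R,k_{\max}\ge 1$, $L>2R$. Assume $[Q,H_0]=0$, and that $H_0$ has a unique (up to phase) normalized ground state $\Psi_0$ with spectral gap at least $\gamma>0$.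 Put $Q_{\max}=R\,k_{\max}\,q_{\max}$. *Twists.* Let $\Phi'(Z)=\frac1{2\pi}\int_0^{2\pi}e^{i\theta Q}\Phi(Z)e^{-i\theta Q}\,d\theta$ (so $\sum_Z\Phi'(Z)=H_0$). Let $H(\theta_x,\theta_y)=\sum_Z\Phi(Z;\theta_x,\theta_y)$, where $\Phi(Z;\theta_x,\theta_y)$ is obtained from $\Phi'(Z)$ by conjugation with $e^{i\theta_yQ_Y}$ if some $s\in Z$ has $|y(s)-1|_L<R$ and by conjugation with $e^{i\theta_xQ_X}$ if some $s\in Z$ has $|x(s)-1|_L<R$. *Hall conductance.* With the electron charge $e\neq 0$ and Planck's constant $h>0$, $$\sigma_{xy}=2\,\mathrm{Im}\,\big\langle\partial_{\theta_y}\Psi_0(0,\theta_y)|_{\theta_y=0}\,\big|\,\partial_{\theta_x}\Psi_0(\theta_x,0)|_{\theta_x=0}\big\rangle\cdot\Big(2\pi\frac{e^2}{h}\Big),$$ where $\theta_x\mapsto\Psi_0(\theta_x,0)$ and $\theta_y\mapsto\Psi_0(0,\theta_y)$ are families, differentiable at $0$ and equal to $\Psi_0$ there, of normalized ground states of $H(\theta_x,0)$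 and $H(0,\theta_y)$ near $0$. *Quasi-adiabatic evolution.* A filter function for $\Delta>0$ is a real function $W\in L^1(\mathbb R)$ with $W(-t)=-W(t)$ for $t\ne0$ and $\int W(t)e^{i\omega t}dt=i/\omega$ for $|\omega|\ge\Delta$. The standard one is $W_\Delta(t)=\int_t^\infty w$ for $t\ge0$, $W_\Delta(t)=-\int_{-\infty}^tw$ for $t<0$, with $w(t)=c\prod_{n\ge1}\big(\tfrac{\sin a_nt}{a_nt}\big)^2$, $a_n=a_1/(n\ln^2n)$ for $n\ge2$, $\sum_na_n=\Delta/2$, $\int w=1$. Fix a filter function $W$ for $\Delta=\gamma/2$, and set $\mathcal D_{X}(\theta_x,\theta_y)=\int W(t)\,e^{itH}(\partial_{\theta_x}H)e^{-itH}dt$ at $H=H(\theta_x,\theta_y)$, and $\mathcal D_Y$ likewise with $\partial_{\theta_y}H$. Let $U_X,U_Y$ solve $\partial_rU_X(\theta_x,\theta_y,r)=i\mathcal D_X(\theta_x+r,\theta_y)U_X(\theta_x,\theta_y,r)$, $\partial_rU_Y(\theta_x,\theta_y,r)=i\mathcal D_Y(\theta_x,\theta_y+r)U_Y(\theta_x,\theta_y,r)$,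 with value $\mathbb 1$ at $r=0$, and let $$\Psi_{\circlearrowleft}(r)=U_Y^\dagger(0,0,r)\,U_X^\dagger(0,r,r)\,U_Y(r,0,r)\,U_X(0,0,r)\,\Psi_0 .$$ **Statement.** The standard $W_\Delta$ is a filter function for every $\Delta>0$. There is a numerical constant $C>0$, independent of all the data above, such that in the above setting $\sigma_{xy}$ exists and does not depend on the choice of the families of ground states, and for every filter function $W$ for $\gamma/2$ and every $r>0$ with $16\,Q_{\max}\frac J\gamma L\,r\le1$, $$\left|\langle\Psi_0|\Psi_{\circlearrowleft}(r)\rangle^{(2\pi/r)^2}-e^{2\pi i\,\sigma_{xy}\,(e^2/h)^{-1}}\right|\le C\Big(Q_{\max}\frac J\gamma L\Big)^3 r ,$$ where the power is taken with the principal branch of the logarithm. -/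

import Mathlib

open scoped InnerProductSpace Topology

noncomputable section

namespace QuantumHall

/-! ### The torus -/

/-- The sites of the `L × L` discrete torus. -/
abbrev Site (L : ℕ) : Type := Fin L × Fin L

/-- The coordinate `x(s) ∈ {1, …, L}`. -/
def xCoord {L : ℕ} (s : Site L) : ℝ := (s.1 : ℕ) + 1

/-- The coordinate `y(s) ∈ {1, …, L}`. -/
def yCoord {L : ℕ} (s : Site L) : ℝ := (s.2 : ℕ) + 1

/-- Distance of two points `a, b` with `|a - b| ≤ L` on the circle of circumference `L`. -/
def circDist (L : ℕ) (a b : ℝ) : ℝ := min |a - b| (L - |a - b|)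

/-- The distance of two sites of the torus. -/
def torusDist {L : ℕ} (s t : Site L) : ℝ :=
  circDist L (xCoord s) (xCoord t) + circDist L (yCoord s) (yCoord t)

/-! ### Hilbert space and local observables -/

/-- The degrees of freedom of a lattice system on the torus: at every site `s` a spin (boson) space
of dimension `spinDim s`, and `numModes` fermionic modes (orbitals) in total, the `j`-th of
which sits at the site `modeSite j`; so the number of orbitals at `s` is the number of `j` with
`modeSite j = s`. -/
structure Lattice (L : ℕ) where
  spinDim : Site L → ℕ
  numModes : ℕ
  modeSite : Fin numModes → Site L

namespace Lattice

variable {L : ℕ} (Λ : Lattice L)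

/-- Configurations of all the spins. -/
abbrev SpinConf : Type := (s : Site L) → Fin (Λ.spinDim s)

/-- Labels of the standard orthonormal basis of `(⨂ₛ ℂ^(spinDim s)) ⊗ Fock`: a spin configuration
together with the set of occupied fermionic modes. -/
abbrev Basis : Type := Λ.SpinConf × Finset (Fin Λ.numModes)

/-- The Hilbert space of the system. -/
abbrev Hilb : Type := EuclideanSpace ℂ Λ.Basis

/-- The operators on the Hilbert space, with the operator norm. -/
abbrev Op : Type := Λ.Hilb →L[ℂ] Λ.Hilb

/-- The operator with a given matrix in the standard basis. -/
def ofMatrix (M : Matrix Λ.Basis Λ.Basis ℂ) : Λ.Op := Matrix.toEuclideanCLM (𝕜 := ℂ) M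

/-- The operator on the spins that acts by the matrix `M` on the spins in `Z` and as the identity on
all other spins and on the fermions. -/
def spinOp (Z : Finset (Site L))
    (M : Matrix ((s : Z) → Fin (Λ.spinDim s)) ((s : Z) → Fin (Λ.spinDim s)) ℂ) : Λ.Op :=
  open Classical in
  Λ.ofMatrix (Matrix.of fun a b =>
    if a.2 = b.2 ∧ ∀ s, s ∉ Z → a.1 s = b.1 s then M (fun s => a.1 s) (fun s => b.1 s) else 0)

/-- The annihilation operator of the mode `j` (tensored with the identity on the spins):
`a_j |σ, S⟩ = (-1)^{#{k ∈ S : k < j}} |σ, S \ {j}⟩` if `j ∈ S`, and `a_j |σ, S⟩ = 0` otherwise.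
The creation operator is its adjoint. -/
def annihilate (j : Fin Λ.numModes) : Λ.Op :=
  open Classical in
  Λ.ofMatrix (Matrix.of fun a b =>
    if a.1 = b.1 ∧ j ∈ b.2 ∧ a.2 = b.2.erase j then
      (-1 : ℂ) ^ (b.2.filter (fun k => k < j)).card else 0)

/-- The creation and annihilation operators of the modes at the sites in `Z`. -/
def fermionOps (Z : Finset (Site L)) : Set Λ.Op :=
  {c | ∃ j, Λ.modeSite j ∈ Z ∧ (c = Λ.annihilate j ∨ c = star (Λ.annihilate j))}

/-- The algebra `𝒜_Z` of the observables supported on `Z` of even fermionic parity: it is spanned by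
products of an operator on the spins in `Z` with an even number of creation and annihilation
operators of modes in `Z`. -/
def evenAlg (Z : Finset (Site L)) : Subalgebra ℂ Λ.Op :=
  Algebra.adjoin ℂ
    (Set.range (Λ.spinOp Z) ∪ {A | ∃ c ∈ Λ.fermionOps Z, ∃ c' ∈ Λ.fermionOps Z, A = c * c'})

end Lattice

variable {L : ℕ}

/-- `q s` is a charge operator at the site `s` with eigenvalues among `0, 1, …, qmax`. -/
structure IsCharge (Λ : Lattice L) (qmax : ℕ) (q : Site L → Λ.Op) : Prop where
  mem : ∀ s, q s ∈ Λ.evenAlg {s}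
  selfAdjoint : ∀ s, IsSelfAdjoint (q s)
  spec : ∀ s, spectrum ℂ (q s) ⊆ {z | ∃ k : ℕ, k ≤ qmax ∧ z = k}

/-- `Φ` is an even `kmax`-body interaction of strength `J` and range `R`. -/
structure IsInteraction (Λ : Lattice L) (J R : ℝ) (kmax : ℕ)
    (Φ : Finset (Site L) → Λ.Op) : Prop where
  mem : ∀ Z, Φ Z ∈ Λ.evenAlg Z
  selfAdjoint : ∀ Z, IsSelfAdjoint (Φ Z)
  strength : ∀ s, ∑ Z with s ∈ Z, ‖Φ Z‖ ≤ J
  range : ∀ Z, (∃ s ∈ Z, ∃ t ∈ Z, R < torusDist s t) → Φ Z = 0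
  body : ∀ Z, kmax < Z.card → Φ Z = 0

/-- The total charge `Q`. -/
def totalCharge {Λ : Lattice L} (q : Site L → Λ.Op) : Λ.Op := ∑ s, q s

/-- The charge `Q_X` of the half `1 ≤ x ≤ L/2` of the torus. -/
def chargeX {Λ : Lattice L} (q : Site L → Λ.Op) : Λ.Op :=
  open Classical in ∑ s with xCoord s ≤ (L : ℝ) / 2, q s

/-- The charge `Q_Y` of the half `1 ≤ y ≤ L/2` of the torus. -/
def chargeY {Λ : Lattice L} (q : Site L → Λ.Op) : Λ.Op :=
  open Classical in ∑ s with yCoord s ≤ (L : ℝ) / 2, q s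

/-- The untwisted Hamiltonian `H₀ = ∑_Z Φ(Z)`. -/
def hamiltonian₀ {Λ : Lattice L} (Φ : Finset (Site L) → Λ.Op) : Λ.Op := ∑ Z, Φ Z

/-- `e^{itK} A e^{-itK}`. -/
def conjExp {Λ : Lattice L} (K : Λ.Op) (t : ℝ) (A : Λ.Op) : Λ.Op :=
  NormedSpace.exp ((Complex.I * t) • K) * A * NormedSpace.exp (-(Complex.I * t) • K)

/-! ### Twisted Hamiltonians -/

/-- The charge average `Φ'(Z) = (2π)⁻¹ ∫₀^{2π} e^{iθQ} Φ(Z) e^{-iθQ} dθ` of an interaction term.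
(If `Q` commutes with `H₀` then `∑_Z Φ'(Z) = H₀`, and if `Q` commutes with `Φ(Z)` then
`Φ'(Z) = Φ(Z)`.) -/
def symmetrized {Λ : Lattice L} (q : Site L → Λ.Op) (Φ : Finset (Site L) → Λ.Op)
    (Z : Finset (Site L)) : Λ.Op :=
  ((2 * Real.pi)⁻¹ : ℂ) • ∫ θ in (0 : ℝ)..(2 * Real.pi), conjExp (totalCharge q) θ (Φ Z)

/-- The term `Φ(Z; 0, 0, θy, φy)` with flux twists in the `y` direction. -/
def twistedY {Λ : Lattice L} (R : ℝ) (q : Site L → Λ.Op) (Φ : Finset (Site L) → Λ.Op)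
    (θy φy : ℝ) (Z : Finset (Site L)) : Λ.Op :=
  open Classical in
  if ∃ s ∈ Z, circDist L (yCoord s) 1 < R then
    conjExp (chargeY q) θy (symmetrized q Φ Z)
  else if ∃ s ∈ Z, circDist L (yCoord s) ((L : ℝ) / 2 + 1) < R then
    conjExp (chargeY q) (-φy) (symmetrized q Φ Z)
  else symmetrized q Φ Z

/-- The term `Φ(Z; θx, φx, θy, φy)`. -/
def twisted {Λ : Lattice L} (R : ℝ) (q : Site L → Λ.Op) (Φ : Finset (Site L) → Λ.Op)
    (θx φx θy φy : ℝ) (Z : Finset (Site L)) : Λ.Op :=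
  open Classical in
  if ∃ s ∈ Z, circDist L (xCoord s) 1 < R then
    conjExp (chargeX q) θx (twistedY R q Φ θy φy Z)
  else if ∃ s ∈ Z, circDist L (xCoord s) ((L : ℝ) / 2 + 1) < R then
    conjExp (chargeX q) (-φx) (twistedY R q Φ θy φy Z)
  else twistedY R q Φ θy φy Z

/-- The twisted Hamiltonian `H(θx, φx, θy, φy)`. -/
def twistedHamiltonian {Λ : Lattice L} (R : ℝ) (q : Site L → Λ.Op) (Φ : Finset (Site L) → Λ.Op)
    (θx φx θy φy : ℝ) : Λ.Op :=
  ∑ Z, twisted R q Φ θx φx θy φy Z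

/-- The two-parameter family `H(θx, θy) = H(θx, 0, θy, 0)`. -/
def fluxHamiltonian {Λ : Lattice L} (R : ℝ) (q : Site L → Λ.Op) (Φ : Finset (Site L) → Λ.Op)
    (θx θy : ℝ) : Λ.Op :=
  twistedHamiltonian R q Φ θx 0 θy 0

/-! ### Ground states and Hall conductance -/

/-- `ψ` is a normalized eigenvector of `A` for its smallest eigenvalue. -/
def IsGroundState {Λ : Lattice L} (A : Λ.Op) (ψ : Λ.Hilb) : Prop :=
  ‖ψ‖ = 1 ∧ ∃ E : ℝ, A ψ = (E : ℂ) • ψ ∧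
    ∀ μ : ℝ, Module.End.HasEigenvalue (A : Λ.Hilb →ₗ[ℂ] Λ.Hilb) (μ : ℂ) → E ≤ μ

/-- `ψ` is normalized and, up to phase, the unique ground state of `A`, and the rest of the spectrum
of `A` lies at least `γ` above the ground state energy. -/
def IsGappedGroundState {Λ : Lattice L} (A : Λ.Op) (γ : ℝ) (ψ : Λ.Hilb) : Prop :=
  ‖ψ‖ = 1 ∧ ∃ E : ℝ,
    Module.End.eigenspace (A : Λ.Hilb →ₗ[ℂ] Λ.Hilb) (E : ℂ) = Submodule.span ℂ {ψ} ∧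
    ∀ μ : ℝ, Module.End.HasEigenvalue (A : Λ.Hilb →ₗ[ℂ] Λ.Hilb) (μ : ℂ) → μ ≠ E → E + γ ≤ μ

/-- `σ` is the Hall conductance
`2 Im⟨∂_{θy} Ψ₀(0,θy)|_{θy=0}, ∂_{θx} Ψ₀(θx,0)|_{θx=0}⟩ · (2π e²/h)` of the family `H` at the
origin of flux space, where `θx ↦ Ψ₀(θx,0)` and `θy ↦ Ψ₀(0,θy)` are families of ground states near
the origin, equal to `Ψ₀` and differentiable there. -/
def IsHallConductance {Λ : Lattice L} (e h : ℝ) (H : ℝ → ℝ → Λ.Op) (Ψ₀ : Λ.Hilb) (σ : ℝ) : Prop :=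
  ∃ (ψX ψY : ℝ → Λ.Hilb) (vX vY : Λ.Hilb),
    (∀ᶠ θ in 𝓝 0, IsGroundState (H θ 0) (ψX θ)) ∧
    (∀ᶠ θ in 𝓝 0, IsGroundState (H 0 θ) (ψY θ)) ∧
    ψX 0 = Ψ₀ ∧ ψY 0 = Ψ₀ ∧
    HasDerivAt ψX vX 0 ∧ HasDerivAt ψY vY 0 ∧
    σ = 2 * (⟪vY, vX⟫_ℂ).im * (2 * Real.pi * (e ^ 2 / h))

/-! ### Quasi-adiabatic evolution -/

/-- `W` is a filter function for the energy threshold `Δ`: integrable, odd off `0`, and with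
`∫ W(t) e^{iωt} dt = i/ω` whenever `|ω| ≥ Δ`. -/
structure IsFilter (Δ : ℝ) (W : ℝ → ℝ) : Prop where
  integrable : MeasureTheory.Integrable W
  odd : ∀ t, t ≠ 0 → W (-t) = -W t
  fourier : ∀ ω : ℝ, Δ ≤ |ω| →
    ∫ t : ℝ, (W t : ℂ) * Complex.exp (Complex.I * ω * t) = Complex.I / ω

/-- The weights `1` and `1 / (n ln² n)`, `n ≥ 2` (here `n = k + 1`). -/
def filterWeight (k : ℕ) : ℝ := if k = 0 then 1 else 1 / ((k + 1) * Real.log (k + 1) ^ 2)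

/-- The sequence `a_n`, proportional to the weights and with sum `Δ/2`. -/
def filterFreq (Δ : ℝ) (k : ℕ) : ℝ := Δ / 2 * filterWeight k / ∑' i, filterWeight i

/-- The product `∏_n (sin(a_n t) / (a_n t))²`. -/
def filterProduct (Δ t : ℝ) : ℝ := ∏' k, Real.sinc (filterFreq Δ k * t) ^ 2

/-- The product normalized to have integral `1`. -/
def filterDensity (Δ t : ℝ) : ℝ := filterProduct Δ t / ∫ s, filterProduct Δ s

/-- The standard filter function of quasi-adiabatic evolution: with `w` the normalized product,
`W(t) = ∫_t^∞ w` for `t ≥ 0` and `W(t) = -∫_{-∞}^t w` for `t < 0`. -/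
def standardFilter (Δ t : ℝ) : ℝ :=
  if 0 ≤ t then ∫ s in Set.Ioi t, filterDensity Δ s else -∫ s in Set.Iio t, filterDensity Δ s

/-- The super-operator `𝒮(K, A) = ∫ W(t) e^{itK} A e^{-itK} dt`. -/
def quasiGen {Λ : Lattice L} (W : ℝ → ℝ) (K A : Λ.Op) : Λ.Op :=
  ∫ t : ℝ, (W t : ℂ) • conjExp K t A

/-- The generator `𝒟_X(θx, θy)` for a family `H` of Hamiltonians. -/
def genX {Λ : Lattice L} (W : ℝ → ℝ) (H : ℝ → ℝ → Λ.Op) (θx θy : ℝ) : Λ.Op :=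
  quasiGen W (H θx θy) (deriv (fun θ => H θ θy) θx)

/-- The generator `𝒟_Y(θx, θy)` for a family `H` of Hamiltonians. -/
def genY {Λ : Lattice L} (W : ℝ → ℝ) (H : ℝ → ℝ → Λ.Op) (θx θy : ℝ) : Λ.Op :=
  quasiGen W (H θx θy) (deriv (fun θ => H θx θ) θy)

/-- `U` solves `∂_r U(r) = i D(r) U(r)`, `U(0) = 1`. -/
def IsPropagator {Λ : Lattice L} (D U : ℝ → Λ.Op) : Prop :=
  U 0 = 1 ∧ ∀ r, HasDerivAt U (Complex.I • (D r * U r)) r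

/-- The solution of `∂_r U(r) = i D(r) U(r)`, `U(0) = 1` (which exists and is unique whenever `D` is
continuous). -/
def propagator {Λ : Lattice L} (D : ℝ → Λ.Op) : ℝ → Λ.Op :=
  Classical.epsilon (IsPropagator D)

/-- `U_X(θx, θy, r)`. -/
def evolX {Λ : Lattice L} (W : ℝ → ℝ) (H : ℝ → ℝ → Λ.Op) (θx θy r : ℝ) : Λ.Op :=
  propagator (fun s => genX W H (θx + s) θy) r

/-- `U_Y(θx, θy, r)`. -/
def evolY {Λ : Lattice L} (W : ℝ → ℝ) (H : ℝ → ℝ → Λ.Op) (θx θy r : ℝ) : Λ.Op :=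
  propagator (fun s => genY W H θx (θy + s)) r

/-- The evolution along `(θx, θy) → (θx, φy) → (φx, φy)`. -/
def evolV {Λ : Lattice L} (W : ℝ → ℝ) (H : ℝ → ℝ → Λ.Op) (θx θy φx φy : ℝ) : Λ.Op :=
  evolX W H θx φy (φx - θx) * evolY W H θx θy (φy - θy)

/-- The evolution along `(θx, θy) → (φx, θy) → (φx, φy)`. -/
def evolW {Λ : Lattice L} (W : ℝ → ℝ) (H : ℝ → ℝ → Λ.Op) (θx θy φx φy : ℝ) : Λ.Op :=
  evolY W H φx θy (φy - θy) * evolX W H θx θy (φx - θx)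

/-- The evolution counter-clockwise around the square of side `r` with lower left corner
`(θx, θy)`. -/
def evolLoop {Λ : Lattice L} (W : ℝ → ℝ) (H : ℝ → ℝ → Λ.Op) (θx θy r : ℝ) : Λ.Op :=
  star (evolV W H θx θy (θx + r) (θy + r)) * evolW W H θx θy (θx + r) (θy + r)

/-- The state `Ψ_↺(r)`: the quasi-adiabatic evolution of `Ψ₀` around the square of side `r` at the
origin. -/
def loopState {Λ : Lattice L} (W : ℝ → ℝ) (H : ℝ → ℝ → Λ.Op) (Ψ₀ : Λ.Hilb) (r : ℝ) : Λ.Hilb :=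
  evolLoop W H 0 0 r Ψ₀

end QuantumHall

end

namespace QuantumHall

open MeasureTheory

/-! ### Fourier transforms of products of `sinc` functions -/

/-! Filter function. The function sinc²(at) is the Fourier transform of a triangle and has
frequencies only in |ω| ≤ 2a; multiplication by sinc(at) widens a Fourier support by a. So the
Fourier transform ŵ of the density w vanishes for |ω| ≥ Δ, since 2 ∑ aₙ = Δ. Writing W as the
integral of w against a signed indicator of the interval between 0 and s, Fubini gives ∫ W(t)
e^{iωt} dt = (ŵ(ω) - ŵ(0))/(iω) = i/ω (`isFilter_standardFilter`).

Hall conductance. Let p, q be the velocities of Ψ₀ in the directions θx, θy, that is, the vectors of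
first order perturbation theory orthogonal to Ψ₀. Every differentiable family of normalized ground
states has derivative p + icΨ₀ (or q + idΨ₀) with a real coefficient, and these extra components add
only the real number cd to the inner product. So σ = 2 Im⟨q, p⟩ · 2πe²/h is well defined
(`isHallConductance_iff`).

Loop. The Fourier property of W makes i𝒟φ exactly the velocity of a ground state φ as long as the
gap is at least γ/2 (`isVelocity_filterConj`). Quasi-adiabatic evolution is therefore parallel
transport of ground states (`isGround_of_transport`). Both routes from the origin to the corner (r,
r) end in the same nondegenerate ground state, up to a phase z = ⟨Ψ₀, Ψ_↺(r)⟩. Each edge of the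
square is close to a straight path with velocity p or q, and expanding the overlap along the edges
gives Im z = 2r² Im⟨q, p⟩ + O(r³). The power (2π/r)² turns the error into O(r)
(`norm_inner_cpow_sub_exp_le`).

Constants. Put M = Q_max (J/γ) L. Only terms whose support crosses the boundary of a half torus feel
a twist, so the derivatives of H are at most 2Mγ and vary at a rate of at most kmax·qmax·2Mγ
(`exists_isFluxFamily`). An error cubic in M needs this rate to be at most 4M²γ, that is kmax·qmax ≤
2M, and this follows from γ ≤ 2J. The latter holds because removing all terms that touch one site
moves H by at most J but leaves a full matrix algebra commuting with it, hence a degenerate ground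
state (`gap_le_of_interaction`). The exception is a Hilbert space of dimension one, where the
derivatives vanish. -/

theorem sinc_sq_le_inv_sq {x : ℝ} (hx : x ≠ 0) : Real.sinc x ^ 2 ≤ (x ^ 2)⁻¹ := by
  rw [Real.sinc_of_ne_zero hx, div_pow, div_eq_mul_inv]
  have h : Real.sin x ^ 2 ≤ 1 := Real.sin_sq_le_one x
  have : 0 ≤ (x ^ 2)⁻¹ := by positivity
  nlinarith

theorem sinc_sq_le_one (x : ℝ) : Real.sinc x ^ 2 ≤ 1 := by
  rw [sq_le_one_iff_abs_le_one]
  exact Real.abs_sinc_le_one x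

theorem integrable_sinc_sq {a : ℝ} (ha : 0 < a) : Integrable fun t : ℝ => Real.sinc (a * t) ^ 2 := by
  -- The majorant comes from min(1, x⁻²) ≤ 2/(1 + x²).
  have h1 : Integrable fun t : ℝ => 2 * (1 + (a * t) ^ 2)⁻¹ :=
    (integrable_inv_one_add_sq.comp_mul_left' ha.ne').const_mul 2
  refine h1.mono' (by fun_prop) (Filter.Eventually.of_forall fun t => ?_)
  rw [Real.norm_of_nonneg (sq_nonneg _)]
  have h2 := sinc_sq_le_one (a * t)
  by_cases h : a * t = 0
  · simp [h]
  · have h3 := sinc_sq_le_inv_sq h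
    have h4 : 0 < (a * t) ^ 2 := by positivity
    rw [← div_eq_mul_inv, le_div_iff₀ (by positivity)]
    rw [← one_div, le_div_iff₀ h4] at h3
    nlinarith

theorem integral_one_sub_mul_exp {c : ℂ} (hc : c ≠ 0) :
    ∫ v in (0 : ℝ)..1, (1 - (v : ℂ)) * Complex.exp (c * v) =
      (Complex.exp c - 1 - c) / c ^ 2 := by
  have h : ∀ v ∈ Set.uIcc (0 : ℝ) 1, HasDerivAt
      (fun v : ℝ => (1 - (v : ℂ)) * Complex.exp (c * v) / c + Complex.exp (c * v) / c ^ 2)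
      ((1 - (v : ℂ)) * Complex.exp (c * v)) v := by
    intro v _
    have h1 : HasDerivAt (fun v : ℝ => (v : ℂ)) 1 v := Complex.ofRealCLM.hasDerivAt
    have h2 := (h1.const_mul c).cexp
    refine ((((h1.const_sub 1).mul h2).div_const c).add (h2.div_const (c ^ 2))).congr_deriv ?_
    field_simp
    ring
  rw [intervalIntegral.integral_eq_sub_of_hasDerivAt h
    (Continuous.intervalIntegrable (by fun_prop) _ _)]
  simp
  field_simp
  ring

/-- The triangle function. -/
def triangle (v : ℝ) : ℂ := ((max 0 (1 - |v|) : ℝ) : ℂ)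

theorem continuous_triangle : Continuous triangle := by
  unfold triangle; fun_prop

theorem triangle_eq_zero {v : ℝ} (hv : 1 ≤ |v|) : triangle v = 0 := by
  simp [triangle, hv]

theorem integrable_triangle : Integrable triangle := by
  refine continuous_triangle.integrable_of_hasCompactSupport
    (HasCompactSupport.intro (isCompact_Icc (a := -1) (b := 1)) fun v hv => triangle_eq_zero ?_)
  by_contra! h
  exact hv ⟨(abs_lt.1 h).1.le, (abs_lt.1 h).2.le⟩

/-- Folding the negative half line onto [0, 1] leaves two elementary integrals with parameters ±ic,
whose sum is 2(1 - cos c)/c²; the half-angle formula turns this into sinc². -/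
theorem integral_exp_mul_triangle (c : ℝ) :
    ∫ v : ℝ, Complex.exp (c * Complex.I * v) * triangle v = (Real.sinc (c / 2) ^ 2 : ℝ) := by
  have h0 : ∀ c : ℝ, ∫ v in (0 : ℝ)..1, Complex.exp (c * Complex.I * v) * triangle v =
      ∫ v in (0 : ℝ)..1, (1 - (v : ℂ)) * Complex.exp (c * Complex.I * v) := by
    intro c
    refine intervalIntegral.integral_congr fun v hv => ?_
    rw [Set.uIcc_of_le zero_le_one] at hv
    have : max 0 (1 - |v|) = 1 - v := by
      rw [abs_of_nonneg hv.1, max_eq_right (by linarith [hv.2])]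
    simp [triangle, this, mul_comm]
  have hsplit : ∫ v : ℝ, Complex.exp (c * Complex.I * v) * triangle v =
      (∫ v in (0 : ℝ)..1, (1 - (v : ℂ)) * Complex.exp ((-c : ℝ) * Complex.I * v)) +
      ∫ v in (0 : ℝ)..1, (1 - (v : ℂ)) * Complex.exp (c * Complex.I * v) := by
    have hc : Continuous fun v : ℝ => Complex.exp (c * Complex.I * v) * triangle v :=
      Continuous.mul (by fun_prop) continuous_triangle
    rw [← intervalIntegral.integral_eq_integral_of_support_subset (a := -1) (b := 1),
      ← intervalIntegral.integral_add_adjacent_intervals (b := 0)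
        (hc.intervalIntegrable _ _) (hc.intervalIntegrable _ _), ← h0, ← h0]
    · congr 1
      have h := intervalIntegral.integral_comp_neg (a := 0) (b := 1)
        (fun v : ℝ => Complex.exp (c * Complex.I * v) * triangle v)
      rw [neg_zero] at h
      rw [← h]
      refine intervalIntegral.integral_congr fun v _ => ?_
      simp [triangle]
    · intro v hv
      have : ¬ 1 ≤ |v| := fun h => hv (by simp [triangle_eq_zero h])
      rw [not_le, abs_lt] at this
      exact ⟨this.1, this.2.le⟩
  rw [hsplit]
  rcases eq_or_ne c 0 with rfl | hc
  · have : ∫ v in (0 : ℝ)..1, (1 - (v : ℂ)) = ((1 / 2 : ℝ) : ℂ) := by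
      have h1 : ∫ v in (0 : ℝ)..1, (1 - v) = 1 / 2 := by
        rw [intervalIntegral.integral_sub (by simp) (by simp)]
        simp; norm_num
      rw [← h1, ← intervalIntegral.integral_ofReal]
      simp
    simp [this]
    norm_num
  · have hc' : (c : ℂ) * Complex.I ≠ 0 := by simp [hc]
    have hc'' : ((-c : ℝ) : ℂ) * Complex.I ≠ 0 := by simp [hc]
    rw [integral_one_sub_mul_exp hc', integral_one_sub_mul_exp hc'',
      Real.sinc_of_ne_zero (by positivity)]
    have h1 : Real.sin (c / 2) ^ 2 = (1 - Real.cos c) / 2 := by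
      rw [Real.sin_sq_eq_half_sub]; ring_nf
    rw [div_pow, h1]
    have h2 : Complex.exp (c * Complex.I) + Complex.exp ((-c : ℝ) * Complex.I) =
        2 * Complex.cos c := by
      rw [Complex.cos]; push_cast; ring
    have h3 : Complex.exp ((-c : ℝ) * Complex.I) = 2 * Complex.cos c - Complex.exp (c * Complex.I) :=
      eq_sub_of_add_eq' h2
    rw [h3]
    push_cast
    have : (c : ℂ) ≠ 0 := by exact_mod_cast hc
    have hI : Complex.I ^ 2 = -1 := Complex.I_sq
    field_simp
    rw [hI]
    ring

/-- Fourier inversion for the triangle: after rescaling, the integral is a multiple of the value of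
the triangle at ω/(2a), which is outside its support. -/
theorem integral_sinc_sq_mul_exp {a : ℝ} (ha : 0 < a) {ω : ℝ} (hω : 2 * a ≤ |ω|) :
    ∫ t : ℝ, ((Real.sinc (a * t) ^ 2 : ℝ) : ℂ) * Complex.exp (Complex.I * ω * t) = 0 := by
  have hF : ∀ w : ℝ, FourierTransform.fourier triangle w = (Real.sinc (Real.pi * w) ^ 2 : ℝ) := by
    intro w
    rw [Real.fourier_real_eq_integral_exp_smul, show Real.pi * w = (2 * Real.pi * w) / 2 by ring,
      ← Real.sinc_neg, ← neg_div, ← integral_exp_mul_triangle]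
    refine integral_congr_ae (Filter.Eventually.of_forall fun v => ?_)
    simp only [smul_eq_mul]
    congr 2
    push_cast
    ring
  have hF' : FourierTransform.fourier triangle =
      fun w : ℝ => ((Real.sinc (Real.pi * w) ^ 2 : ℝ) : ℂ) := funext hF
  have hinv := congrFun (Continuous.fourierInv_fourier_eq continuous_triangle integrable_triangle
    (by rw [hF']; exact (integrable_sinc_sq Real.pi_pos).ofReal)) (ω / (2 * a))
  rw [triangle_eq_zero, Real.fourierInv_eq', hF'] at hinv
  · have h := Measure.integral_comp_mul_left (fun v : ℝ =>
      Complex.exp (((2 * Real.pi * inner ℝ v (ω / (2 * a)) : ℝ) : ℂ) * Complex.I) •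
        ((Real.sinc (Real.pi * v) ^ 2 : ℝ) : ℂ)) (a / Real.pi)
    rw [hinv, smul_zero] at h
    rw [← h]
    refine integral_congr_ae (Filter.Eventually.of_forall fun t => ?_)
    have h1 : Real.pi * (a / Real.pi * t) = a * t := by field_simp
    have h2 : 2 * Real.pi * (ω / (2 * a) * (a / Real.pi * t)) = ω * t := by
      field_simp
    simp only [smul_eq_mul, h1, RCLike.inner_apply, conj_trivial, h2]
    push_cast
    rw [mul_comm]
    congr 2
    ring
  · rw [abs_div, abs_of_pos (by positivity : 0 < 2 * a), le_div_iff₀ (by positivity), one_mul]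
    exact hω

theorem sinc_eq_integral (x : ℝ) :
    ∫ u in (-1 : ℝ)..1, Complex.exp (Complex.I * x * u) = ((2 * Real.sinc x : ℝ) : ℂ) := by
  rcases eq_or_ne x 0 with rfl | hx
  · simp; norm_num
  · have hx' : (x : ℂ) ≠ 0 := by exact_mod_cast hx
    rw [integral_exp_mul_complex (by simp [hx]), Real.sinc_of_ne_zero hx]
    push_cast
    rw [Complex.sin]
    field_simp
    have : Complex.I ^ 2 = -1 := Complex.I_sq
    rw [this]
    ring_nf

/-- Multiplication with `sinc (a t)` widens the support of a Fourier transform by `a`. -/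
theorem integral_mul_sinc_mul_exp {f : ℝ → ℂ} (hf : Integrable f) {D a : ℝ} (ha : 0 ≤ a)
    (h : ∀ ω : ℝ, D ≤ |ω| → ∫ t : ℝ, f t * Complex.exp (Complex.I * ω * t) = 0)
    {ω : ℝ} (hω : D + a ≤ |ω|) :
    ∫ t : ℝ, f t * (Real.sinc (a * t) : ℂ) * Complex.exp (Complex.I * ω * t) = 0 := by
  -- `sinc (a t)` is the mean of e^{iatu} over -1 ≤ u ≤ 1, so the integral is an average of Fourier
  -- integrals of `f` at frequencies within `a` of `ω`.
  have h1 : ∀ t : ℝ, f t * (Real.sinc (a * t) : ℂ) * Complex.exp (Complex.I * ω * t) =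
      (1 / 2 : ℂ) * ∫ u in (-1 : ℝ)..1, f t * Complex.exp (Complex.I * (ω + a * u : ℝ) * t) := by
    intro t
    have h2 : ∀ u : ℝ, f t * Complex.exp (Complex.I * (ω + a * u : ℝ) * t) =
        (f t * Complex.exp (Complex.I * ω * t)) * Complex.exp (Complex.I * (a * t : ℝ) * u) := by
      intro u
      rw [mul_assoc (f t), ← Complex.exp_add]
      push_cast
      ring_nf
    simp_rw [h2]
    rw [intervalIntegral.integral_const_mul, sinc_eq_integral]
    push_cast
    ring
  simp_rw [h1]
  rw [integral_const_mul]
  simp_rw [intervalIntegral.integral_of_le (show (-1 : ℝ) ≤ 1 by norm_num)]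
  rw [integral_integral_swap]
  · rw [setIntegral_eq_zero_of_forall_eq_zero, mul_zero]
    intro u hu
    refine h _ ?_
    have h3 : |a * u| ≤ a := by
      rw [abs_mul, abs_of_nonneg ha]
      exact mul_le_of_le_one_right ha (abs_le.2 ⟨hu.1.le, hu.2⟩)
    have h4 : |ω| ≤ |ω + a * u| + |a * u| := by
      calc |ω| = |(ω + a * u) - a * u| := by ring_nf
        _ ≤ _ := abs_sub _ _
    linarith
  · have h5 : Integrable (fun p : ℝ × ℝ => f p.1 * (1 : ℂ))
        (volume.prod (volume.restrict (Set.Ioc (-1 : ℝ) 1))) :=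
      hf.mul_prod (integrable_const _)
    refine h5.mono ?_ (Filter.Eventually.of_forall fun p => ?_)
    · simp only [mul_one] at h5
      exact h5.aestronglyMeasurable.mul (Continuous.aestronglyMeasurable (by fun_prop))
    · have : Complex.I * ((ω + a * p.2 : ℝ) : ℂ) * p.1 = ((ω + a * p.2) * p.1 : ℝ) * Complex.I := by
        push_cast; ring
      simp only [Function.uncurry, norm_mul, this, Complex.norm_exp_ofReal_mul_I, norm_one, le_refl]

end QuantumHall

namespace QuantumHall

open MeasureTheory

/-! ### The standard filter function -/

theorem filterWeight_pos (k : ℕ) : 0 < filterWeight k := by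
  unfold filterWeight
  split_ifs with h
  · norm_num
  · have : 0 < Real.log ((k : ℝ) + 1) := Real.log_pos (by
      have : (1 : ℝ) ≤ k := by exact_mod_cast Nat.one_le_iff_ne_zero.2 h
      linarith)
    positivity

/-- Cauchy condensation: 2^k times the term at n = 2^k is 1/(k² ln² 2). -/
theorem summable_filterWeight : Summable filterWeight := by
  -- Condensation needs a monotone sequence, so the values at `n ≤ 1` are replaced by the one at `n
  -- = 2`. The shift by two at the end discards them.
  let g : ℕ → ℝ := fun n => if n ≤ 1 then 1 / (2 * Real.log 2 ^ 2) else 1 / (n * Real.log n ^ 2)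
  have hlog2 : 0 < Real.log 2 := Real.log_pos (by norm_num)
  have hg : Summable g := by
    rw [← summable_condensed_iff_of_nonneg]
    · have h1 : Summable fun k : ℕ => 1 / Real.log 2 ^ 2 * (1 / (k : ℝ) ^ 2) :=
        (Real.summable_one_div_nat_pow.2 (by norm_num)).mul_left _
      rw [← summable_nat_add_iff 1] at h1 ⊢
      refine h1.congr fun k => ?_
      have h2 : ¬ 2 ^ (k + 1) ≤ 1 := by
        have := Nat.one_lt_two_pow (n := k + 1) (by omega)
        omega
      simp only [g, if_neg h2]
      push_cast
      rw [Real.log_pow]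
      push_cast
      field_simp
    · intro n
      simp only [g]
      split_ifs <;> positivity
    · intro m n hm hmn
      have key : ∀ m n : ℕ, 2 ≤ m → m ≤ n →
          1 / (n * Real.log n ^ 2) ≤ 1 / (m * Real.log m ^ 2) := by
        intro m n hm hmn
        have h1 : (2 : ℝ) ≤ m := by exact_mod_cast hm
        have h2 : (m : ℝ) ≤ n := by exact_mod_cast hmn
        have h3 : 0 < Real.log m := Real.log_pos (by linarith)
        have h4 : Real.log m ≤ Real.log n := Real.log_le_log (by linarith) h2
        gcongr
      simp only [g]
      split_ifs with h1 h2
      · exact le_rfl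
      · omega
      · simpa using key 2 n le_rfl (by omega)
      · exact key m n (by omega) hmn
  rw [← summable_nat_add_iff 1] at hg ⊢
  rw [← summable_nat_add_iff 1] at hg
  refine hg.congr fun k => ?_
  simp [g, filterWeight]

theorem tsum_filterWeight_pos : 0 < ∑' i, filterWeight i :=
  summable_filterWeight.tsum_pos (fun i => (filterWeight_pos i).le) 0 (filterWeight_pos 0)

theorem prod_sinc_sq_le_of_subset {b : ℕ → ℝ} {s s' : Finset ℕ} (h : s ⊆ s') :
    ∏ k ∈ s', Real.sinc (b k) ^ 2 ≤ ∏ k ∈ s, Real.sinc (b k) ^ 2 := by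
  rw [← Finset.prod_sdiff h]
  exact mul_le_of_le_one_left (Finset.prod_nonneg fun _ _ => sq_nonneg _)
    (Finset.prod_le_one (fun _ _ => sq_nonneg _) fun _ _ => sinc_sq_le_one _)

theorem filterFreq_pos {Δ : ℝ} (hΔ : 0 < Δ) (k : ℕ) : 0 < filterFreq Δ k := by
  unfold filterFreq
  have := filterWeight_pos k
  have := tsum_filterWeight_pos
  positivity

theorem sum_filterFreq_le {Δ : ℝ} (hΔ : 0 < Δ) (s : Finset ℕ) : ∑ k ∈ s, filterFreq Δ k ≤ Δ / 2 := by
  unfold filterFreq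
  rw [← Finset.sum_div, ← Finset.mul_sum, div_le_iff₀ tsum_filterWeight_pos]
  gcongr
  exact summable_filterWeight.sum_le_tsum s fun i _ => (filterWeight_pos i).le

/-- All factors lie in [0, 1], so the finite products decrease and converge, along all finite sets.
This multipliability excludes the default value of `∏'`. -/
theorem tendsto_filterProduct {Δ : ℝ} (t : ℝ) :
    Filter.Tendsto (fun n => ∏ k ∈ Finset.range n, Real.sinc (filterFreq Δ k * t) ^ 2)
      Filter.atTop (𝓝 (filterProduct Δ t)) := by
  have hanti : Antitone fun s : Finset ℕ => ∏ k ∈ s, Real.sinc (filterFreq Δ k * t) ^ 2 :=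
    fun s s' h => prod_sinc_sq_le_of_subset h
  have hm : Multipliable fun k => Real.sinc (filterFreq Δ k * t) ^ 2 :=
    ⟨_, tendsto_atTop_ciInf hanti ⟨0, by
      rintro _ ⟨s, rfl⟩
      exact Finset.prod_nonneg fun _ _ => sq_nonneg _⟩⟩
  exact hm.hasProd.tendsto_prod_nat

theorem partialProduct_le {Δ : ℝ} {n m : ℕ} (h : m ≤ n) (t : ℝ) :
    ∏ k ∈ Finset.range n, Real.sinc (filterFreq Δ k * t) ^ 2 ≤
      ∏ k ∈ Finset.range m, Real.sinc (filterFreq Δ k * t) ^ 2 :=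
  prod_sinc_sq_le_of_subset (Finset.range_mono h)

theorem filterProduct_nonneg {Δ : ℝ} (t : ℝ) : 0 ≤ filterProduct Δ t :=
  ge_of_tendsto' (tendsto_filterProduct t) fun _ => Finset.prod_nonneg fun _ _ => sq_nonneg _

theorem filterProduct_le {Δ : ℝ} (m : ℕ) (t : ℝ) :
    filterProduct Δ t ≤ ∏ k ∈ Finset.range m, Real.sinc (filterFreq Δ k * t) ^ 2 :=
  le_of_tendsto (tendsto_filterProduct t)
    (Filter.eventually_atTop.2 ⟨m, fun _ h => partialProduct_le h t⟩)

theorem filterProduct_neg {Δ : ℝ} (t : ℝ) : filterProduct Δ (-t) = filterProduct Δ t := by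
  unfold filterProduct
  simp [Real.sinc_neg]

theorem measurable_filterProduct {Δ : ℝ} : Measurable (filterProduct Δ) := by
  refine measurable_of_tendsto_metrizable (f := fun n t =>
    ∏ k ∈ Finset.range n, Real.sinc (filterFreq Δ k * t) ^ 2) (fun n => ?_)
    (tendsto_pi_nhds.2 tendsto_filterProduct)
  fun_prop

theorem integrable_filterProduct {Δ : ℝ} (hΔ : 0 < Δ) : Integrable (filterProduct Δ) := by
  refine (integrable_sinc_sq (filterFreq_pos hΔ 0)).mono'
    measurable_filterProduct.aestronglyMeasurable (Filter.Eventually.of_forall fun t => ?_)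
  rw [Real.norm_of_nonneg (filterProduct_nonneg t)]
  simpa using filterProduct_le (Δ := Δ) 1 t

/-- Two factors are kept: the decay of one absorbs `t`, the other is integrable. The finite first
moment of the density is what makes the standard filter integrable. -/
theorem integrable_mul_filterProduct {Δ : ℝ} (hΔ : 0 < Δ) : Integrable fun t => t * filterProduct Δ t := by
  have ha := filterFreq_pos hΔ 1
  refine ((integrable_sinc_sq (filterFreq_pos hΔ 0)).const_mul (filterFreq Δ 1)⁻¹).mono'
    (measurable_id.mul measurable_filterProduct).aestronglyMeasurable
    (Filter.Eventually.of_forall fun t => ?_)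
  rw [norm_mul, Real.norm_of_nonneg (filterProduct_nonneg t), Real.norm_eq_abs]
  have h1 : filterProduct Δ t ≤ Real.sinc (filterFreq Δ 0 * t) ^ 2 *
      Real.sinc (filterFreq Δ 1 * t) ^ 2 := by
    simpa [Finset.prod_range_succ] using filterProduct_le (Δ := Δ) 2 t
  have h2 : |t| * Real.sinc (filterFreq Δ 1 * t) ^ 2 ≤ (filterFreq Δ 1)⁻¹ := by
    rcases eq_or_ne t 0 with rfl | ht
    · simpa using ha.le
    · have h3 : |Real.sinc (filterFreq Δ 1 * t)| ≤ |filterFreq Δ 1 * t|⁻¹ := by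
        refine abs_le_of_sq_le_sq ?_ (by positivity)
        rw [inv_pow, sq_abs]
        exact sinc_sq_le_inv_sq (by positivity)
      have h4 := Real.abs_sinc_le_one (filterFreq Δ 1 * t)
      calc |t| * Real.sinc (filterFreq Δ 1 * t) ^ 2
          = |t| * (|Real.sinc (filterFreq Δ 1 * t)| * |Real.sinc (filterFreq Δ 1 * t)|) := by
            rw [← sq, sq_abs]
        _ ≤ |t| * (|filterFreq Δ 1 * t|⁻¹ * 1) := by gcongr
        _ = (filterFreq Δ 1)⁻¹ := by
            rw [abs_mul, abs_of_pos ha]; field_simp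
  calc |t| * filterProduct Δ t ≤ |t| * (Real.sinc (filterFreq Δ 0 * t) ^ 2 *
      Real.sinc (filterFreq Δ 1 * t) ^ 2) := by gcongr
    _ = (|t| * Real.sinc (filterFreq Δ 1 * t) ^ 2) * Real.sinc (filterFreq Δ 0 * t) ^ 2 := by ring
    _ ≤ _ := by gcongr

/-- From sinc² x ≥ 1 - |x| for |x| ≤ 1, a product of such factors is at least 1 minus the sum of the
|aₖt|, and this sum is at most (Δ/2)|t|. The bound keeps the normalizing integral away from zero. -/
theorem one_half_le_filterProduct {Δ : ℝ} (hΔ : 0 < Δ) {t : ℝ} (ht : |t| ≤ Δ⁻¹) : 1 / 2 ≤ filterProduct Δ t := by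
  have hb : ∀ s : Finset ℕ, ∑ k ∈ s, |filterFreq Δ k * t| ≤ 1 / 2 := by
    intro s
    simp_rw [abs_mul, abs_of_pos (filterFreq_pos hΔ _)]
    rw [← Finset.sum_mul]
    calc (∑ k ∈ s, filterFreq Δ k) * |t| ≤ Δ / 2 * Δ⁻¹ := by
          gcongr; exact sum_filterFreq_le hΔ s
      _ = 1 / 2 := by field_simp
  have h1 : ∀ x : ℝ, |x| ≤ 1 → 1 - |x| ≤ Real.sinc x ^ 2 := by
    intro x hx
    rcases eq_or_ne x 0 with rfl | h0
    · simp
    · have hs : Real.sinc x = Real.sinc |x| := by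
        rcases abs_choice x with h | h <;> rw [h]
        rw [Real.sinc_neg]
      have hp : 0 < |x| := abs_pos.2 h0
      have h2 := Real.sin_gt_sub_cube hp
      rw [hs, Real.sinc_of_ne_zero hp.ne']
      have h3 : 1 - |x| / 6 ≤ Real.sin |x| / |x| := by
        rw [le_div_iff₀ hp]
        nlinarith [mul_pos hp hp]
      nlinarith
  refine ge_of_tendsto' (tendsto_filterProduct t) fun n => ?_
  have h2 : ∀ s : Finset ℕ, 1 - ∑ k ∈ s, |filterFreq Δ k * t| ≤
      ∏ k ∈ s, Real.sinc (filterFreq Δ k * t) ^ 2 := by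
    intro s
    induction s using Finset.induction_on with
    | empty => simp
    | insert k s hk ih =>
      have h3 := hb s
      have h4 := hb (insert k s)
      rw [Finset.sum_insert hk] at h4 ⊢
      rw [Finset.prod_insert hk]
      have h5 : 0 ≤ ∑ k ∈ s, |filterFreq Δ k * t| := Finset.sum_nonneg fun _ _ => abs_nonneg _
      have h6 := h1 (filterFreq Δ k * t) (by linarith)
      have h7 := abs_nonneg (filterFreq Δ k * t)
      calc _ ≤ (1 - |filterFreq Δ k * t|) * (1 - ∑ k ∈ s, |filterFreq Δ k * t|) := by
            nlinarith
        _ ≤ _ := by gcongr; linarith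
  linarith [h2 (Finset.range n), hb (Finset.range n)]

theorem integral_filterProduct_pos {Δ : ℝ} (hΔ : 0 < Δ) : 0 < ∫ t, filterProduct Δ t := by
  rw [integral_pos_iff_support_of_nonneg filterProduct_nonneg (integrable_filterProduct hΔ)]
  have h1 : Set.Icc (-Δ⁻¹) Δ⁻¹ ⊆ Function.support (filterProduct Δ) := fun t ht => by
    have := one_half_le_filterProduct hΔ (abs_le.2 ht)
    simp only [Function.mem_support]
    linarith
  refine lt_of_lt_of_le ?_ (measure_mono h1)
  rw [Real.volume_Icc, ENNReal.ofReal_pos]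
  have : 0 < Δ⁻¹ := inv_pos.2 hΔ
  linarith

/-- Induction on the number of factors: each new sinc² is two factors sinc, and each of these widens
the Fourier support by its frequency. -/
theorem integral_partialProduct_mul_exp {Δ : ℝ} (hΔ : 0 < Δ) (n : ℕ) {ω : ℝ}
    (hω : 2 * ∑ k ∈ Finset.range (n + 1), filterFreq Δ k ≤ |ω|) :
    ∫ t : ℝ, ((∏ k ∈ Finset.range (n + 1), Real.sinc (filterFreq Δ k * t) ^ 2 : ℝ) : ℂ) *
      Complex.exp (Complex.I * ω * t) = 0 := by
  induction n generalizing ω with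
  | zero => simpa using integral_sinc_sq_mul_exp (filterFreq_pos hΔ 0) (by simpa using hω)
  | succ n ih =>
    have ha := (filterFreq_pos hΔ (n + 1)).le
    have hint : Integrable fun t : ℝ =>
        ((∏ k ∈ Finset.range (n + 1), Real.sinc (filterFreq Δ k * t) ^ 2 : ℝ) : ℂ) := by
      have hm : Measurable fun t : ℝ =>
          ∏ k ∈ Finset.range (n + 1), Real.sinc (filterFreq Δ k * t) ^ 2 := by fun_prop
      have hr : Integrable fun t : ℝ =>
          ∏ k ∈ Finset.range (n + 1), Real.sinc (filterFreq Δ k * t) ^ 2 := by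
        refine (integrable_sinc_sq (filterFreq_pos hΔ 0)).mono'
          hm.aestronglyMeasurable (Filter.Eventually.of_forall fun t => ?_)
        rw [Real.norm_of_nonneg (Finset.prod_nonneg fun _ _ => sq_nonneg _)]
        simpa using partialProduct_le (Δ := Δ) (show 1 ≤ n + 1 by omega) t
      exact hr.ofReal
    have hint2 : Integrable fun t : ℝ =>
        ((∏ k ∈ Finset.range (n + 1), Real.sinc (filterFreq Δ k * t) ^ 2 : ℝ) : ℂ) *
          (Real.sinc (filterFreq Δ (n + 1) * t) : ℂ) := by
      refine hint.mul_bdd (c := 1) (Measurable.aestronglyMeasurable (by fun_prop))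
        (Filter.Eventually.of_forall fun t => ?_)
      simpa using Real.abs_sinc_le_one _
    rw [Finset.sum_range_succ] at hω
    have h := integral_mul_sinc_mul_exp hint2 ha
      (D := 2 * ∑ k ∈ Finset.range (n + 1), filterFreq Δ k + filterFreq Δ (n + 1))
      (fun ω hω => integral_mul_sinc_mul_exp hint ha (fun ω hω => ih hω) hω) (ω := ω) (by linarith)
    rw [← h]
    refine integral_congr_ae (Filter.Eventually.of_forall fun t => ?_)
    simp only
    rw [Finset.prod_range_succ]
    push_cast
    ring

theorem integral_filterProduct_mul_exp {Δ : ℝ} (hΔ : 0 < Δ) {ω : ℝ} (hω : Δ ≤ |ω|) :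
    ∫ t : ℝ, (filterProduct Δ t : ℂ) * Complex.exp (Complex.I * ω * t) = 0 := by
  have h := tendsto_integral_of_dominated_convergence (μ := volume)
    (F := fun (n : ℕ) (t : ℝ) =>
      ((∏ k ∈ Finset.range (n + 1), Real.sinc (filterFreq Δ k * t) ^ 2 : ℝ) : ℂ) *
        Complex.exp (Complex.I * ω * t))
    (f := fun t : ℝ => (filterProduct Δ t : ℂ) * Complex.exp (Complex.I * ω * t))
    (fun t => Real.sinc (filterFreq Δ 0 * t) ^ 2)
    (fun n => Measurable.aestronglyMeasurable (by fun_prop))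
    (integrable_sinc_sq (filterFreq_pos hΔ 0))
    (fun n => Filter.Eventually.of_forall fun t => ?_)
    (Filter.Eventually.of_forall fun t => ?_)
  · refine tendsto_nhds_unique h ?_
    refine tendsto_const_nhds.congr fun n => (integral_partialProduct_mul_exp hΔ n ?_).symm
    linarith [sum_filterFreq_le hΔ (Finset.range (n + 1))]
  · have h2 : Complex.I * ω * t = (ω * t : ℝ) * Complex.I := by push_cast; ring
    rw [h2, norm_mul, Complex.norm_exp_ofReal_mul_I, mul_one, Complex.norm_real,
      Real.norm_of_nonneg (Finset.prod_nonneg fun _ _ => sq_nonneg _)]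
    simpa using partialProduct_le (Δ := Δ) (show 1 ≤ n + 1 by omega) t
  · refine Filter.Tendsto.mul_const _ ?_
    exact (Complex.continuous_ofReal.tendsto _).comp
      ((tendsto_filterProduct t).comp (Filter.tendsto_add_atTop_nat 1))

end QuantumHall

namespace QuantumHall

open MeasureTheory

noncomputable section

/-- The kernel with `W(t) = ∫ w(s) k(t, s) ds` for the standard filter function `W` of density `w`. -/
def filterKernel (t s : ℝ) : ℝ :=
  if 0 ≤ t then (if t < s then 1 else 0) else (if s < t then -1 else 0)

theorem measurable_filterKernel : Measurable fun p : ℝ × ℝ => filterKernel p.1 p.2 := by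
  unfold filterKernel
  refine Measurable.ite (measurableSet_le measurable_const measurable_fst)
    (Measurable.ite (measurableSet_lt measurable_fst measurable_snd) measurable_const
      measurable_const)
    (Measurable.ite (measurableSet_lt measurable_snd measurable_fst) measurable_const
      measurable_const)

theorem standardFilter_eq_integral (Δ t : ℝ) :
    standardFilter Δ t = ∫ s, filterDensity Δ s * filterKernel t s := by
  unfold standardFilter filterKernel
  split_ifs with h
  · rw [← integral_indicator measurableSet_Ioi]
    refine integral_congr_ae (Filter.Eventually.of_forall fun s => ?_)
    by_cases hs : t < s <;> simp [hs, Set.indicator, Set.mem_Ioi]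
  · rw [← integral_indicator measurableSet_Iio, ← integral_neg]
    refine integral_congr_ae (Filter.Eventually.of_forall fun s => ?_)
    by_cases hs : s < t <;> simp [hs, Set.indicator, Set.mem_Iio]

/-- For fixed `s` the kernel is, up to endpoints, the indicator of the interval between 0 and `s`,
with the sign of `s`; this is the sign convention of the interval integral. -/
theorem integral_mul_filterKernel {f : ℝ → ℂ} (s : ℝ) :
    ∫ t, f t * (filterKernel t s : ℂ) = ∫ t in (0 : ℝ)..s, f t := by
  rcases le_total 0 s with hs | hs
  · rw [intervalIntegral.integral_of_le hs, integral_Ioc_eq_integral_Ioo,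
      ← integral_Ico_eq_integral_Ioo, ← integral_indicator measurableSet_Ico]
    refine integral_congr_ae (Filter.Eventually.of_forall fun t => ?_)
    simp only [filterKernel, Set.indicator, Set.mem_Ico]
    split_ifs <;> first | (simp; done) | (exfalso; grind)
  · rw [intervalIntegral.integral_of_ge hs, integral_Ioc_eq_integral_Ioo,
      ← integral_neg, ← integral_indicator measurableSet_Ioo]
    refine integral_congr_ae (Filter.Eventually.of_forall fun t => ?_)
    simp only [filterKernel, Set.indicator, Set.mem_Ioo]
    split_ifs <;> first | (simp; done) | (exfalso; grind)

theorem integrable_filterKernel (s : ℝ) : Integrable fun t => filterKernel t s := by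
  have h : Integrable ((Set.uIcc 0 s).indicator fun _ => (1 : ℝ)) :=
    (integrable_indicator_iff measurableSet_uIcc).2 (integrableOn_const (by simp))
  refine h.mono' (measurable_filterKernel.comp
    (measurable_id.prodMk measurable_const)).aestronglyMeasurable
    (Filter.Eventually.of_forall fun t => ?_)
  simp only [filterKernel, Set.indicator, Set.mem_uIcc]
  split_ifs <;> first | (simp; done) | (exfalso; grind)

theorem integral_norm_filterKernel (s : ℝ) : ∫ t, ‖filterKernel t s‖ = |s| := by
  have h : ∀ t, ‖filterKernel t s‖ =
      (if 0 ≤ s then (Set.Ico 0 s).indicator (fun _ => (1 : ℝ)) t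
        else (Set.Ioo s 0).indicator (fun _ => (1 : ℝ)) t) := by
    intro t
    simp only [filterKernel, Set.indicator, Set.mem_Ico, Set.mem_Ioo]
    split_ifs <;> first | (simp; done) | (exfalso; grind)
  simp_rw [h]
  split_ifs with hs
  · rw [integral_indicator measurableSet_Ico]
    simp [abs_of_nonneg hs, hs]
  · rw [integral_indicator measurableSet_Ioo]
    simp [abs_of_neg (not_le.1 hs), (not_le.1 hs).le]

/-- Exchanging integrals yields ∫ w(s) ∫₀ˢ e^{iωt} dt ds = (ŵ(ω) - ŵ(0))/(iω), with ŵ(ω) = 0 for |ω|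
≥ Δ and ŵ(0) = 1. Oddness comes from the evenness of w. -/
theorem isFilter_standardFilter {Δ : ℝ} (hΔ : 0 < Δ) : IsFilter Δ (standardFilter Δ) := by
  have hZ := integral_filterProduct_pos hΔ
  have hwm : Measurable (filterDensity Δ) := measurable_filterProduct.div_const _
  have hw : Integrable (filterDensity Δ) := (integrable_filterProduct hΔ).div_const _
  have hsw : Integrable fun s => s * filterDensity Δ s := by
    refine ((integrable_mul_filterProduct hΔ).div_const (∫ s, filterProduct Δ s)).congr
      (Filter.Eventually.of_forall fun s => ?_)
    simp only [filterDensity, mul_div_assoc]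
  -- The kernel has L¹ norm |s| in `t`, so integrability on the plane is exactly the finite first
  -- moment of the density.
  have hprod : Integrable (fun p : ℝ × ℝ => filterDensity Δ p.2 * filterKernel p.1 p.2)
      (volume.prod volume) := by
    have hm : Measurable fun p : ℝ × ℝ => filterDensity Δ p.2 * filterKernel p.1 p.2 :=
      (hwm.comp measurable_snd).mul measurable_filterKernel
    rw [integrable_prod_iff' hm.aestronglyMeasurable]
    refine ⟨Filter.Eventually.of_forall fun s => (integrable_filterKernel s).const_mul (filterDensity Δ s), ?_⟩
    simp_rw [norm_mul, integral_const_mul, integral_norm_filterKernel]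
    refine hsw.norm.congr (Filter.Eventually.of_forall fun s => ?_)
    simp only [norm_mul, Real.norm_eq_abs, mul_comm]
  have hW : standardFilter Δ = fun t => ∫ s, filterDensity Δ s * filterKernel t s :=
    funext (standardFilter_eq_integral Δ)
  refine ⟨?_, ?_, ?_⟩
  · rw [hW]
    exact hprod.integral_prod_left
  · have hneg : ∀ s, filterDensity Δ (-s) = filterDensity Δ s := fun s => by
      simp [filterDensity, filterProduct_neg]
    have key : ∀ t, 0 < t → standardFilter Δ (-t) = -standardFilter Δ t := by
      intro t ht
      unfold standardFilter
      rw [if_pos ht.le, if_neg (by linarith), ← integral_Iic_eq_integral_Iio,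
        ← integral_comp_neg_Ioi]
      simp_rw [hneg]
    intro t ht
    rcases lt_or_gt_of_ne ht with h | h
    · have := key (-t) (by linarith)
      rw [neg_neg] at this
      rw [this, neg_neg]
    · exact key t h
  · intro ω hω
    have hω0 : (ω : ℂ) ≠ 0 := by
      have : ω ≠ 0 := abs_pos.1 (by linarith)
      exact_mod_cast this
    have hI : Complex.I * (ω : ℂ) ≠ 0 := mul_ne_zero Complex.I_ne_zero hω0
    have h1 : ∀ t : ℝ, (standardFilter Δ t : ℂ) * Complex.exp (Complex.I * ω * t) =
        ∫ s, (filterDensity Δ s : ℂ) * (Complex.exp (Complex.I * ω * t) * filterKernel t s) := by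
      intro t
      rw [standardFilter_eq_integral, ← integral_complex_ofReal, ← integral_mul_const]
      refine integral_congr_ae (Filter.Eventually.of_forall fun s => ?_)
      simp only
      push_cast
      ring
    simp_rw [h1]
    rw [integral_integral_swap]
    · simp_rw [integral_const_mul, integral_mul_filterKernel, integral_exp_mul_complex hI]
      have h0 := integral_filterProduct_mul_exp hΔ hω
      have h2 : ∫ s, (filterDensity Δ s : ℂ) * Complex.exp (Complex.I * ω * s) = 0 := by
        simp_rw [filterDensity, Complex.ofReal_div, div_mul_eq_mul_div]
        rw [integral_div, h0, zero_div]
      have h3 : ∫ s, (filterDensity Δ s : ℂ) = 1 := by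
        rw [integral_complex_ofReal]
        simp_rw [filterDensity]
        rw [integral_div, div_self hZ.ne', Complex.ofReal_one]
      have h4 : ∀ s : ℝ, (filterDensity Δ s : ℂ) * ((Complex.exp (Complex.I * ω * s) -
          Complex.exp (Complex.I * ω * (0 : ℝ))) / (Complex.I * ω)) =
          ((filterDensity Δ s : ℂ) * Complex.exp (Complex.I * ω * s) - (filterDensity Δ s : ℂ)) /
            (Complex.I * ω) := by
        intro s
        simp
        ring
      simp_rw [h4]
      rw [integral_div, integral_sub _ hw.ofReal, h2, h3]
      · rw [div_eq_div_iff hI hω0]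
        linear_combination (-ω : ℂ) * Complex.I_mul_I
      · refine hw.ofReal.mul_bdd (c := 1) (Continuous.aestronglyMeasurable (by fun_prop))
          (Filter.Eventually.of_forall fun t => ?_)
        have : Complex.I * ω * t = (ω * t : ℝ) * Complex.I := by push_cast; ring
        rw [this, Complex.norm_exp_ofReal_mul_I]
    · refine hprod.mono ?_ (Filter.Eventually.of_forall fun p => ?_)
      · refine Measurable.aestronglyMeasurable ?_
        refine (Complex.measurable_ofReal.comp (hwm.comp measurable_snd)).mul
          (Measurable.mul (by fun_prop) (Complex.measurable_ofReal.comp measurable_filterKernel))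
      · have : Complex.I * ω * p.1 = (ω * p.1 : ℝ) * Complex.I := by push_cast; ring
        simp only [Function.uncurry, norm_mul, this, Complex.norm_exp_ofReal_mul_I, one_mul,
          Complex.norm_real]
        rfl

end

/-! ### Gapped ground states -/

section Gap

variable {E : Type*} [NormedAddCommGroup E] [InnerProductSpace ℂ E]

/-- `φ` is a normalized eigenvector of `H` whose eigenvalue `e` bounds the quadratic form of `H` from
below. -/
structure IsGround (H : E →L[ℂ] E) (e : ℝ) (φ : E) : Prop where
  norm_eq : ‖φ‖ = 1
  eigen : H φ = (e : ℂ) • φ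
  low : ∀ v, e * ‖v‖ ^ 2 ≤ (⟪v, H v⟫_ℂ).re

/-- `φ` is a normalized eigenvector of `H` with eigenvalue `e`, and on the orthogonal complement of
`φ` the quadratic form of `H` is at least `e + g`. -/
structure IsGapped (H : E →L[ℂ] E) (g e : ℝ) (φ : E) : Prop where
  norm_eq : ‖φ‖ = 1
  eigen : H φ = (e : ℂ) • φ
  gap : ∀ v, ⟪φ, v⟫_ℂ = 0 → (e + g) * ‖v‖ ^ 2 ≤ (⟪v, H v⟫_ℂ).re

theorem inner_sub_inner_smul {φ : E} (hφ : ‖φ‖ = 1) (v : E) : ⟪φ, v - ⟪φ, v⟫_ℂ • φ⟫_ℂ = 0 := by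
  rw [inner_sub_right, inner_smul_right, inner_self_eq_norm_sq_to_K, hφ]
  simp

theorem norm_sq_eq_add_norm_sq_sub {φ : E} (hφ : ‖φ‖ = 1) (v : E) :
    ‖v‖ ^ 2 = ‖⟪φ, v⟫_ℂ‖ ^ 2 + ‖v - ⟪φ, v⟫_ℂ • φ‖ ^ 2 := by
  have h1 := inner_sub_inner_smul hφ v
  have h2 : ⟪⟪φ, v⟫_ℂ • φ, v - ⟪φ, v⟫_ℂ • φ⟫_ℂ = 0 := by rw [inner_smul_left, h1, mul_zero]
  have h3 := norm_add_sq_eq_norm_sq_add_norm_sq_of_inner_eq_zero _ _ h2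
  rw [add_sub_cancel, norm_smul, hφ, mul_one] at h3
  nlinarith [h3]

theorem norm_sub_inner_smul_le {φ : E} (hφ : ‖φ‖ = 1) (v : E) : ‖v - ⟪φ, v⟫_ℂ • φ‖ ≤ ‖v‖ := by
  have := norm_sq_eq_add_norm_sq_sub hφ v
  exact le_of_abs_le (abs_le_of_sq_le_sq (by nlinarith [sq_nonneg ‖⟪φ, v⟫_ℂ‖]) (norm_nonneg _))

theorem re_inner_apply_le (H : E →L[ℂ] E) (v : E) : |(⟪v, H v⟫_ℂ).re| ≤ ‖H‖ * ‖v‖ ^ 2 := by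
  calc |(⟪v, H v⟫_ℂ).re| ≤ ‖⟪v, H v⟫_ℂ‖ := Complex.abs_re_le_norm _
    _ ≤ ‖v‖ * (‖H‖ * ‖v‖) := (norm_inner_le_norm _ _).trans (by gcongr; exact H.le_opNorm v)
    _ = _ := by ring

theorem re_inner_apply_sub_le (H H' : E →L[ℂ] E) (v : E) :
    |(⟪v, H' v⟫_ℂ).re - (⟪v, H v⟫_ℂ).re| ≤ ‖H' - H‖ * ‖v‖ ^ 2 := by
  have := re_inner_apply_le (H' - H) v
  rwa [sub_apply, inner_sub_right, Complex.sub_re] at this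

namespace IsGround

variable {H : E →L[ℂ] E} {e : ℝ} {φ : E}

theorem re_inner (h : IsGround H e φ) : (⟪φ, H φ⟫_ℂ).re = e := by
  rw [h.eigen, inner_smul_right, inner_self_eq_norm_sq_to_K, h.norm_eq]
  simp

theorem energy_le (h : IsGround H e φ) {H' : E →L[ℂ] E} {e' : ℝ} {φ' : E}
    (h' : IsGround H' e' φ') : e' ≤ e + ‖H' - H‖ := by
  have h1 := h'.low φ
  have h2 := abs_le.1 (re_inner_apply_sub_le H H' φ)
  rw [h.re_inner, h.norm_eq] at h2
  rw [h.norm_eq] at h1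
  linarith [h2.2]

theorem abs_energy_sub_le (h : IsGround H e φ) {H' : E →L[ℂ] E} {e' : ℝ} {φ' : E}
    (h' : IsGround H' e' φ') : |e' - e| ≤ ‖H' - H‖ := by
  have h1 := h.energy_le h'
  have h2 := h'.energy_le h
  rw [norm_sub_rev] at h2
  rw [abs_le]
  constructor <;> linarith

theorem smul (h : IsGround H e φ) {c : ℂ} (hc : ‖c‖ = 1) : IsGround H e (c • φ) :=
  ⟨by rw [norm_smul, hc, h.norm_eq, one_mul], by rw [map_smul, h.eigen, smul_comm], h.low⟩

theorem norm_sub_apply_le (h : IsGround H e φ) {H' : E →L[ℂ] E} {e' : ℝ} {φ' : E}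
    (h' : IsGround H' e' φ') : ‖H φ' - (e : ℂ) • φ'‖ ≤ 2 * ‖H' - H‖ := by
  have h1 : H φ' - (e : ℂ) • φ' = ((e' - e : ℝ) : ℂ) • φ' - (H' - H) φ' := by
    rw [sub_apply, h'.eigen]
    push_cast
    module
  have h2 : ‖((e' - e : ℝ) : ℂ) • φ'‖ ≤ ‖H' - H‖ := by
    rw [norm_smul, h'.norm_eq, mul_one, Complex.norm_real]
    exact h.abs_energy_sub_le h'
  have h3 := (H' - H).le_opNorm φ'
  rw [h'.norm_eq, mul_one] at h3
  rw [h1]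
  linarith [norm_sub_le (((e' - e : ℝ) : ℂ) • φ') ((H' - H) φ')]

end IsGround

namespace IsGapped

variable {H : E →L[ℂ] E} {g e : ℝ} {φ : E}

/-- Cauchy–Schwarz turns the gap of the quadratic form into a lower bound for H - e, hence into a
bound on its inverse, on the orthogonal complement of the ground state. -/
theorem mul_norm_le (h : IsGapped H g e φ) {v : E} (hv : ⟪φ, v⟫_ℂ = 0) :
    g * ‖v‖ ≤ ‖H v - (e : ℂ) • v‖ := by
  rcases eq_or_ne v 0 with rfl | h0
  · simp
  have h1 := h.gap v hv
  have h2 : (⟪v, H v - (e : ℂ) • v⟫_ℂ).re = (⟪v, H v⟫_ℂ).re - e * ‖v‖ ^ 2 := by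
    rw [inner_sub_right, inner_smul_right, inner_self_eq_norm_sq_to_K, Complex.sub_re,
      RCLike.ofReal_eq_complex_ofReal, ← Complex.ofReal_pow, ← Complex.ofReal_mul, Complex.ofReal_re]
  have h3 : (⟪v, H v - (e : ℂ) • v⟫_ℂ).re ≤ ‖v‖ * ‖H v - (e : ℂ) • v‖ :=
    (Complex.re_le_norm _).trans (norm_inner_le_norm _ _)
  have h4 : 0 < ‖v‖ := norm_pos_iff.2 h0
  nlinarith

theorem apply_sub_inner (h : IsGapped H g e φ) (v : E) (c : ℂ) :
    H (v - c • φ) - (e : ℂ) • (v - c • φ) = H v - (e : ℂ) • v := by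
  rw [map_sub, map_smul, h.eigen]
  module

theorem mul_norm_sub_le (h : IsGapped H g e φ) (v : E) :
    g * ‖v - ⟪φ, v⟫_ℂ • φ‖ ≤ ‖H v - (e : ℂ) • v‖ := by
  have := h.mul_norm_le (inner_sub_inner_smul h.norm_eq v)
  rwa [h.apply_sub_inner] at this

theorem eq_smul (h : IsGapped H g e φ) (hg : 0 < g) {v : E} (hv : H v = (e : ℂ) • v) :
    v = ⟪φ, v⟫_ℂ • φ := by
  have h1 := h.mul_norm_sub_le v
  rw [hv, sub_self, norm_zero] at h1
  have h2 : ‖v - ⟪φ, v⟫_ℂ • φ‖ = 0 := by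
    nlinarith [norm_nonneg (v - ⟪φ, v⟫_ℂ • φ)]
  exact sub_eq_zero.1 (norm_eq_zero.1 h2)

variable [CompleteSpace E]

theorem inner_apply_sub (h : IsGapped H g e φ) (hH : IsSelfAdjoint H) (v : E) :
    ⟪φ, H v - (e : ℂ) • v⟫_ℂ = 0 := by
  rw [inner_sub_right, ← hH.isSymmetric.apply_clm, h.eigen, inner_smul_left, inner_smul_right]
  simp

theorem isGround (h : IsGapped H g e φ) (hg : 0 ≤ g) (hH : IsSelfAdjoint H) :
    IsGround H e φ := by
  refine ⟨h.norm_eq, h.eigen, fun v => ?_⟩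
  have h1 := h.gap _ (inner_sub_inner_smul h.norm_eq v)
  set w := v - ⟪φ, v⟫_ℂ • φ with hw
  have h2 : ⟪v, H v - (e : ℂ) • v⟫_ℂ = ⟪w, H w - (e : ℂ) • w⟫_ℂ := by
    rw [hw, h.apply_sub_inner, inner_sub_left, inner_smul_left, h.inner_apply_sub hH,
      mul_zero, sub_zero]
  have h3 : ∀ v : E, (⟪v, H v - (e : ℂ) • v⟫_ℂ).re = (⟪v, H v⟫_ℂ).re - e * ‖v‖ ^ 2 := by
    intro v
    rw [inner_sub_right, inner_smul_right, inner_self_eq_norm_sq_to_K, Complex.sub_re,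
      RCLike.ofReal_eq_complex_ofReal, ← Complex.ofReal_pow, ← Complex.ofReal_mul, Complex.ofReal_re]
  have h4 := h3 v
  rw [h2, h3] at h4
  nlinarith [sq_nonneg ‖w‖]

/-- The gap of a perturbed operator. -/
theorem perturb (h : IsGapped H g e φ) (hg : 0 < g) (hH : IsSelfAdjoint H) {H' : E →L[ℂ] E}
    (hH' : IsSelfAdjoint H') {e' : ℝ} {φ' : E} (h' : IsGround H' e' φ')
    {κ : ℝ} (hκ : ‖H' - H‖ ≤ κ) (hκg : 2 * κ < g) : IsGapped H' (g - 2 * κ) e' φ' := by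
  refine ⟨h'.norm_eq, h'.eigen, fun v hv => ?_⟩
  have he := (h.isGround hg.le hH).energy_le h'
  by_contra! hlt
  -- Min–max argument. On the complement of `φ` the form of `H'` is at least e + g - κ, while a
  -- counterexample `v` lies strictly below this value, and so does `φ'` because e' ≤ e + κ.
  have hlow : ∀ w, ⟪φ, w⟫_ℂ = 0 → (e + g - κ) * ‖w‖ ^ 2 ≤ (⟪w, H' w⟫_ℂ).re := by
    intro w hw
    have h1 := h.gap w hw
    have h2 := abs_le.1 (re_inner_apply_sub_le H H' w)
    nlinarith [sq_nonneg ‖w‖]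
  set α := ⟪φ, φ'⟫_ℂ
  set β := ⟪φ, v⟫_ℂ
  have hcross : ⟪v, φ'⟫_ℂ = 0 := by rw [← inner_conj_symm, hv, map_zero]
  -- The plane of `φ'` and `v` meets the complement of `φ` in this vector, and `H'` has no cross
  -- terms between `φ'` and `v`. The two bounds force α = β = 0; then `v` itself is orthogonal to
  -- `φ`, a contradiction.
  have hw0 : ⟪φ, β • φ' - α • v⟫_ℂ = 0 := by
    rw [inner_sub_right, inner_smul_right, inner_smul_right]; ring
  have hHv : ⟪φ', H' v⟫_ℂ = 0 := by
    rw [← hH'.isSymmetric.apply_clm, h'.eigen, inner_smul_left, hv, mul_zero]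
  have hn : ‖β • φ' - α • v‖ ^ 2 = ‖β‖ ^ 2 + ‖α‖ ^ 2 * ‖v‖ ^ 2 := by
    have h1 : ⟪β • φ', -(α • v)⟫_ℂ = 0 := by
      rw [inner_neg_right, inner_smul_left, inner_smul_right, hv]; simp
    have h2 := norm_add_sq_eq_norm_sq_add_norm_sq_of_inner_eq_zero _ _ h1
    rw [norm_neg, norm_smul, norm_smul, h'.norm_eq, ← sub_eq_add_neg] at h2
    nlinarith [h2]
  have hq : (⟪β • φ' - α • v, H' (β • φ' - α • v)⟫_ℂ).re =
      ‖β‖ ^ 2 * e' + ‖α‖ ^ 2 * (⟪v, H' v⟫_ℂ).re := by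
    have h3 : ⟪β • φ' - α • v, H' (β • φ' - α • v)⟫_ℂ =
        ((‖β‖ ^ 2 * e' : ℝ) : ℂ) + ((‖α‖ ^ 2 : ℝ) : ℂ) * ⟪v, H' v⟫_ℂ := by
      rw [map_sub, map_smul, map_smul, h'.eigen]
      simp only [inner_sub_left, inner_sub_right, inner_smul_left, inner_smul_right, hHv, hcross,
        inner_self_eq_norm_sq_to_K, h'.norm_eq]
      have hb := Complex.conj_mul' β
      have ha := Complex.conj_mul' α
      push_cast
      linear_combination (e' : ℂ) * hb + ⟪v, H' v⟫_ℂ * ha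
    rw [h3, Complex.add_re, Complex.ofReal_re, Complex.re_ofReal_mul]
  have h5 := hlow _ hw0
  rw [hn, hq] at h5
  have hlt' : (⟪v, H' v⟫_ℂ).re < (e + g - κ) * ‖v‖ ^ 2 := by
    nlinarith [sq_nonneg ‖v‖]
  have hα : ‖α‖ ^ 2 = 0 := by
    nlinarith [sq_nonneg ‖β‖, sq_nonneg ‖α‖]
  have hβ : ‖β‖ ^ 2 = 0 := by
    rw [hα] at h5
    nlinarith [sq_nonneg ‖β‖]
  have h6 := hlow v (by simpa using hβ)
  linarith

/-- The ground state of an operator with a gap is unique up to a phase. -/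
theorem unique (h : IsGapped H g e φ) (hg : 0 < g) (hH : IsSelfAdjoint H) {e' : ℝ} {φ' : E}
    (h' : IsGround H e' φ') : e' = e ∧ ‖⟪φ, φ'⟫_ℂ‖ = 1 ∧ φ' = ⟪φ, φ'⟫_ℂ • φ := by
  have h1 := (h.isGround hg.le hH).abs_energy_sub_le h'
  rw [sub_self, norm_zero] at h1
  have h2 : e' = e := by
    have := abs_nonpos_iff.1 h1
    linarith
  subst h2
  have h3 := h.eq_smul hg h'.eigen
  refine ⟨rfl, ?_, h3⟩
  have h4 := congrArg norm h3
  rw [norm_smul, h'.norm_eq, h.norm_eq, mul_one] at h4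
  exact h4.symm

end IsGapped

theorem exists_isGround [FiniteDimensional ℂ E] [CompleteSpace E] [Nontrivial E] {H : E →L[ℂ] E}
    (hH : IsSelfAdjoint H) : ∃ e φ, IsGround H e φ := by
  have hsym : (H : E →ₗ[ℂ] E).IsSymmetric := hH.isSymmetric
  obtain ⟨φ, hφ⟩ := hsym.hasEigenvalue_iInf_of_finiteDimensional.exists_hasEigenvector
  set e : ℝ := ⨅ x : { x : E // x ≠ 0 }, RCLike.re ⟪(H : E →ₗ[ℂ] E) x, x⟫_ℂ / ‖(x : E)‖ ^ 2 with he
  -- A real infimum is a lower bound only for sets bounded below; here -‖H‖ bounds the Rayleigh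
  -- quotients.
  have hb : BddBelow (Set.range fun x : { x : E // x ≠ 0 } =>
      RCLike.re ⟪(H : E →ₗ[ℂ] E) x, x⟫_ℂ / ‖(x : E)‖ ^ 2) := by
    refine ⟨-‖H‖, ?_⟩
    rintro _ ⟨x, rfl⟩
    have hx : 0 < ‖(x : E)‖ ^ 2 := by have := norm_pos_iff.2 x.2; positivity
    simp only
    rw [le_div_iff₀ hx, ← inner_conj_symm, RCLike.conj_re]
    have := abs_le.1 (re_inner_apply_le H x)
    simpa using this.1
  refine ⟨e, ((‖φ‖⁻¹ : ℝ) : ℂ) • φ, ?_, ?_, ?_⟩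
  · rw [norm_smul, Complex.norm_real, norm_inv, norm_norm,
      inv_mul_cancel₀ (norm_ne_zero_iff.2 hφ.2)]
  · have := hφ.apply_eq_smul
    rw [map_smul, smul_comm]
    congr 1
  · intro v
    rcases eq_or_ne v 0 with rfl | hv
    · simp
    have hx : 0 < ‖v‖ ^ 2 := by have := norm_pos_iff.2 hv; positivity
    have := ciInf_le hb ⟨v, hv⟩
    rw [← he, le_div_iff₀ hx, ← inner_conj_symm, RCLike.conj_re] at this
    exact this

theorem isGapped_of_eigenspace [FiniteDimensional ℂ E] [CompleteSpace E] {H : E →L[ℂ] E}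
    (hH : IsSelfAdjoint H) {g e : ℝ} {φ : E} (hφ : ‖φ‖ = 1)
    (hspan : Module.End.eigenspace (H : E →ₗ[ℂ] E) (e : ℂ) = Submodule.span ℂ {φ})
    (hgap : ∀ μ : ℝ, Module.End.HasEigenvalue (H : E →ₗ[ℂ] E) (μ : ℂ) → μ ≠ e → e + g ≤ μ) :
    IsGapped H g e φ := by
  have hsym : (H : E →ₗ[ℂ] E).IsSymmetric := hH.isSymmetric
  refine ⟨hφ, ?_, fun v hv => ?_⟩
  · have : φ ∈ Module.End.eigenspace (H : E →ₗ[ℂ] E) (e : ℂ) := by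
      rw [hspan]; exact Submodule.mem_span_singleton_self φ
    exact Module.End.mem_eigenspace_iff.1 this
  · set b := hsym.eigenvectorBasis rfl
    set l := hsym.eigenvalues rfl
    have h1 : (⟪v, H v⟫_ℂ).re = ∑ i, l i * ‖⟪b i, v⟫_ℂ‖ ^ 2 := by
      rw [← b.sum_inner_mul_inner, Complex.re_sum]
      refine Finset.sum_congr rfl fun i _ => ?_
      have h2 : ⟪b i, H v⟫_ℂ = (l i : ℂ) * ⟪b i, v⟫_ℂ := by
        have h3 : H (b i) = (l i : ℂ) • b i := hsym.apply_eigenvectorBasis rfl i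
        rw [← hH.isSymmetric.apply_clm, h3, inner_smul_left]
        simp
      rw [h2, ← inner_conj_symm v]
      have h4 := Complex.conj_mul' ⟪b i, v⟫_ℂ
      rw [show (starRingEnd ℂ) ⟪b i, v⟫_ℂ * (↑(l i) * ⟪b i, v⟫_ℂ) =
        ((l i * ‖⟪b i, v⟫_ℂ‖ ^ 2 : ℝ) : ℂ) by push_cast; rw [← h4]; ring, Complex.ofReal_re]
    rw [h1, ← b.sum_sq_norm_inner_right v, Finset.mul_sum]
    refine Finset.sum_le_sum fun i _ => ?_
    by_cases hi : l i = e
    · have h5 : b i ∈ Submodule.span ℂ {φ} := by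
        rw [← hspan, Module.End.mem_eigenspace_iff, ← hi]
        exact hsym.apply_eigenvectorBasis rfl i
      obtain ⟨c, hc⟩ := Submodule.mem_span_singleton.1 h5
      rw [← hc, inner_smul_left, hv]
      simp
    · gcongr
      exact hgap _ (hsym.hasEigenvalue_eigenvalues rfl i) hi

end Gap

/-- In finite dimension the minimum of the quadratic form is attained at an eigenvector, so a
smallest eigenvalue and a lower bound of the form are the same thing. Everything below works with
the form. -/
theorem isGroundState_iff {L : ℕ} {Λ : Lattice L} {A : Λ.Op} (hA : IsSelfAdjoint A) {ψ : Λ.Hilb} :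
    IsGroundState A ψ ↔ ∃ e, IsGround A e ψ := by
  have key : ∀ {e φ}, IsGround A e φ → ∀ μ : ℝ,
      Module.End.HasEigenvalue (A : Λ.Hilb →ₗ[ℂ] Λ.Hilb) (μ : ℂ) → e ≤ μ := by
    intro e φ h μ hμ
    obtain ⟨v, hv⟩ := hμ.exists_hasEigenvector
    have h1 := h.low v
    have h2 : A v = (μ : ℂ) • v := hv.apply_eq_smul
    rw [h2, inner_smul_right, inner_self_eq_norm_sq_to_K, RCLike.ofReal_eq_complex_ofReal,
      ← Complex.ofReal_pow, ← Complex.ofReal_mul, Complex.ofReal_re] at h1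
    have h3 : 0 < ‖v‖ ^ 2 := by have := norm_pos_iff.2 hv.2; positivity
    exact le_of_mul_le_mul_right h1 h3
  constructor
  · rintro ⟨hn, e, he, hmin⟩
    have : Nontrivial Λ.Hilb := ⟨ψ, 0, by rintro rfl; simp at hn⟩
    obtain ⟨e', φ, h⟩ := exists_isGround hA
    have h1 : e ≤ e' := hmin e' (Module.End.hasEigenvalue_of_hasEigenvector
      (x := φ) ⟨Module.End.mem_eigenspace_iff.2 h.eigen, by
        rintro rfl; simpa using h.norm_eq⟩)
    refine ⟨e, hn, he, fun v => (h.low v).trans' (by gcongr)⟩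
  · rintro ⟨e, h⟩
    exact ⟨h.norm_eq, e, h.eigen, key h⟩

end QuantumHall

namespace QuantumHall

open Filter

/-! ### Differentiability of ground states -/

section Velocity

variable {E : Type*} [NormedAddCommGroup E] [InnerProductSpace ℂ E]

/-- `u` is the derivative, orthogonal to `φ`, of a normalized eigenvector `φ` of `H` with
eigenvalue `e` in the direction `A`. -/
structure IsVelocity (H : E →L[ℂ] E) (e : ℝ) (φ : E) (A : E →L[ℂ] E) (u : E) : Prop where
  orth : ⟪φ, u⟫_ℂ = 0
  eqn : H u - (e : ℂ) • u = -(A φ - ⟪φ, A φ⟫_ℂ • φ)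

namespace IsVelocity

variable {H A : E →L[ℂ] E} {e g : ℝ} {φ u : E}

theorem norm_le (h : IsVelocity H e φ A u) (hφ : IsGapped H g e φ) : g * ‖u‖ ≤ ‖A‖ := by
  have h1 := hφ.mul_norm_le h.orth
  rw [h.eqn, norm_neg] at h1
  refine h1.trans ((norm_sub_inner_smul_le hφ.norm_eq _).trans ?_)
  simpa [hφ.norm_eq] using A.le_opNorm φ

theorem eq_add_smul (h : IsVelocity H e φ A u) (hφ : IsGapped H g e φ) (hg : 0 < g) {v : E}
    (hv : H v - (e : ℂ) • v = -(A φ - ⟪φ, A φ⟫_ℂ • φ)) : v = u + ⟪φ, v⟫_ℂ • φ := by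
  have h1 : H (v - u) = (e : ℂ) • (v - u) := by
    rw [← sub_eq_zero, map_sub, smul_sub, sub_sub_sub_comm, hv, h.eqn, sub_self]
  have h2 := hφ.eq_smul hg h1
  rw [inner_sub_right, h.orth, sub_zero] at h2
  rw [← h2, add_sub_cancel]

/-- Comparison of the velocities of the ground states of two operators. -/
theorem norm_velocity_sub_le {H' A' : E →L[ℂ] E} {e' : ℝ} {φ' u' : E} (h : IsVelocity H e φ A u)
    (hφ : IsGapped H g e φ) (hg : 0 < g) (h' : IsVelocity H' e' φ' A' u') (hφ' : ‖φ'‖ = 1)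
    (he : |e' - e| ≤ ‖H' - H‖) :
    ‖u' - u‖ ≤ ‖φ' - φ‖ * ‖u'‖ +
      (‖A' - A‖ * 2 + 4 * ‖A‖ * ‖φ' - φ‖ + 2 * ‖H' - H‖ * ‖u'‖) / g := by
  have hA : ∀ (B : E →L[ℂ] E) {φ : E}, ‖φ‖ = 1 → ‖B φ‖ ≤ ‖B‖ := fun B φ hn => by
    simpa [hn] using B.le_opNorm φ
  -- The difference of the two velocity equations, sorted by what changes: first the direction `A`,
  -- then the state, then the operator together with its energy. The gap of `H` then bounds the part
  -- of u' - u orthogonal to `φ`.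
  have h1 : H (u' - u) - (e : ℂ) • (u' - u) =
      -((A' - A) φ' - ⟪φ', (A' - A) φ'⟫_ℂ • φ') -
      (A (φ' - φ) - ⟪φ', A φ'⟫_ℂ • (φ' - φ) - (⟪φ' - φ, A φ'⟫_ℂ + ⟪φ, A (φ' - φ)⟫_ℂ) • φ) -
      ((H' - H) u' - ((e' - e : ℝ) : ℂ) • u') := by
    have h2 : H (u' - u) - (e : ℂ) • (u' - u) = (H' u' - (e' : ℂ) • u') - (H u - (e : ℂ) • u) -
        ((H' - H) u' - ((e' - e : ℝ) : ℂ) • u') := by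
      rw [map_sub, sub_apply]
      push_cast
      module
    rw [h2, h'.eqn, h.eqn]
    simp only [sub_apply, map_sub, inner_sub_left, inner_sub_right]
    module
  have n1 : ‖(A' - A) φ' - ⟪φ', (A' - A) φ'⟫_ℂ • φ'‖ ≤ ‖A' - A‖ :=
    (norm_sub_inner_smul_le hφ' _).trans (hA _ hφ')
  have n2 : ‖A (φ' - φ)‖ ≤ ‖A‖ * ‖φ' - φ‖ := A.le_opNorm _
  have n3 : ‖⟪φ', A φ'⟫_ℂ • (φ' - φ)‖ ≤ ‖A‖ * ‖φ' - φ‖ := by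
    rw [norm_smul]
    gcongr
    refine (norm_inner_le_norm _ _).trans ?_
    rw [hφ', one_mul]
    exact hA A hφ'
  have n4 : ‖(⟪φ' - φ, A φ'⟫_ℂ + ⟪φ, A (φ' - φ)⟫_ℂ) • φ‖ ≤ 2 * (‖A‖ * ‖φ' - φ‖) := by
    rw [norm_smul, hφ.norm_eq, mul_one, two_mul]
    refine (norm_add_le _ _).trans (add_le_add ?_ ?_)
    · refine (norm_inner_le_norm _ _).trans ?_
      rw [mul_comm]
      gcongr
      exact hA A hφ'
    · refine (norm_inner_le_norm _ _).trans ?_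
      rw [hφ.norm_eq, one_mul]
      exact n2
  have n5 : ‖(H' - H) u'‖ ≤ ‖H' - H‖ * ‖u'‖ := (H' - H).le_opNorm _
  have n6 : ‖((e' - e : ℝ) : ℂ) • u'‖ ≤ ‖H' - H‖ * ‖u'‖ := by
    rw [norm_smul, Complex.norm_real]
    gcongr
    exact he
  have h3 : ‖H (u' - u) - (e : ℂ) • (u' - u)‖ ≤
      ‖A' - A‖ * 2 + 4 * ‖A‖ * ‖φ' - φ‖ + 2 * ‖H' - H‖ * ‖u'‖ := by
    rw [h1]
    refine (norm_sub_le _ _).trans ?_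
    refine (add_le_add ((norm_sub_le _ _).trans (add_le_add (norm_neg _).le
      ((norm_sub_le _ _).trans (add_le_add (norm_sub_le _ _) le_rfl)))) (norm_sub_le _ _)).trans ?_
    linarith [norm_nonneg (A' - A)]
  have h4 := hφ.mul_norm_sub_le (u' - u)
  -- The component along `φ` is not seen by H - e, but it is small because `u'` is orthogonal to
  -- `φ'` instead of `φ`.
  have h5 : ‖⟪φ, u' - u⟫_ℂ‖ ≤ ‖φ' - φ‖ * ‖u'‖ := by
    have : ⟪φ, u' - u⟫_ℂ = -⟪φ' - φ, u'⟫_ℂ := by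
      rw [inner_sub_right, inner_sub_left, h.orth, h'.orth]; ring
    rw [this, norm_neg]
    exact norm_inner_le_norm _ _
  have h6 : ‖u' - u‖ ≤ ‖⟪φ, u' - u⟫_ℂ‖ + ‖(u' - u) - ⟪φ, u' - u⟫_ℂ • φ‖ := by
    calc ‖u' - u‖ = ‖⟪φ, u' - u⟫_ℂ • φ + ((u' - u) - ⟪φ, u' - u⟫_ℂ • φ)‖ := by
          rw [add_sub_cancel]
      _ ≤ _ := by
          refine (norm_add_le _ _).trans ?_
          rw [norm_smul, hφ.norm_eq, mul_one]
  have h7 : ‖(u' - u) - ⟪φ, u' - u⟫_ℂ • φ‖ ≤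
      (‖A' - A‖ * 2 + 4 * ‖A‖ * ‖φ' - φ‖ + 2 * ‖H' - H‖ * ‖u'‖) / g := by
    rw [le_div_iff₀ hg, mul_comm]
    exact h4.trans h3
  linarith

end IsVelocity

variable [CompleteSpace E] {H : ℝ → E →L[ℂ] E} {A : E →L[ℂ] E} {ψ : ℝ → E} {e : ℝ → ℝ} {θ₀ g e₀ : ℝ}
  {φ u v : E}

/-- The eigenvalue equation can be differentiated knowing only that ψ is continuous at θ₀.
Projecting away `φ` eliminates the unknown energy slope to leading order: what is left is a bounded
energy quotient times a vector that tends to zero. -/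
theorem hasDerivAt_apply_sub (hsa : IsSelfAdjoint (H θ₀)) (hH : HasDerivAt H A θ₀)
    (hφ : IsGapped (H θ₀) g e₀ φ) (hg : 0 < g) (hψ : ∀ᶠ θ in 𝓝 θ₀, IsGround (H θ) (e θ) (ψ θ))
    (hlim : Tendsto ψ (𝓝 θ₀) (𝓝 φ)) (h0 : ψ θ₀ = φ) :
    HasDerivAt (fun θ => H θ₀ (ψ θ) - (e₀ : ℂ) • ψ θ) (-(A φ - ⟪φ, A φ⟫_ℂ • φ)) θ₀ := by
  rw [hasDerivAt_iff_tendsto_slope]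
  have hs := hasDerivAt_iff_tendsto_slope.1 hH
  have hlim' : Tendsto ψ (𝓝[≠] θ₀) (𝓝 φ) := hlim.mono_left nhdsWithin_le_nhds
  have happ : Tendsto (fun θ => slope H θ₀ θ (ψ θ)) (𝓝[≠] θ₀) (𝓝 (A φ)) :=
    (isBoundedBilinearMap_apply (𝕜 := ℂ) (E := E) (F := E)).continuous.tendsto (A, φ) |>.comp
      (hs.prodMk_nhds hlim')
  have h1 : Tendsto (fun θ => -(slope H θ₀ θ (ψ θ) - ⟪φ, slope H θ₀ θ (ψ θ)⟫_ℂ • φ)) (𝓝[≠] θ₀)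
      (𝓝 (-(A φ - ⟪φ, A φ⟫_ℂ • φ))) :=
    (happ.sub ((tendsto_const_nhds.inner happ).smul_const φ)).neg
  have hq : Tendsto (fun θ => ψ θ - ⟪φ, ψ θ⟫_ℂ • φ) (𝓝[≠] θ₀) (𝓝 0) := by
    have hi : Tendsto (fun θ => ⟪φ, ψ θ⟫_ℂ) (𝓝[≠] θ₀) (𝓝 ⟪φ, φ⟫_ℂ) :=
      tendsto_const_nhds.inner hlim'
    have := hlim'.sub (hi.smul_const φ)
    rwa [inner_self_eq_norm_sq_to_K, hφ.norm_eq, RCLike.ofReal_one, one_pow, one_smul,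
      sub_self] at this
  have h2 : Tendsto (fun θ => (((e θ - e₀) / (θ - θ₀) : ℝ) : ℂ) • (ψ θ - ⟪φ, ψ θ⟫_ℂ • φ))
      (𝓝[≠] θ₀) (𝓝 0) := by
    refine squeeze_zero_norm' (a := fun θ => ‖slope H θ₀ θ‖ * ‖ψ θ - ⟪φ, ψ θ⟫_ℂ • φ‖) ?_
      (by simpa using hs.norm.mul hq.norm)
    filter_upwards [nhdsWithin_le_nhds hψ] with θ hθ
    rw [norm_smul, Complex.norm_real, slope_def_module, norm_smul, norm_inv, norm_div,
      div_eq_inv_mul]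
    gcongr
    exact (hφ.isGround hg.le hsa).abs_energy_sub_le hθ
  have h3 := h1.add h2
  rw [add_zero] at h3
  refine h3.congr' ?_
  filter_upwards [nhdsWithin_le_nhds hψ, self_mem_nhdsWithin] with θ hθ hne
  have hne' : ((θ - θ₀ : ℝ) : ℂ) ≠ 0 := by exact_mod_cast sub_ne_zero.2 hne
  have h4 : H θ₀ (ψ θ) - (e₀ : ℂ) • ψ θ =
      -((H θ - H θ₀) (ψ θ) - ⟪φ, (H θ - H θ₀) (ψ θ)⟫_ℂ • φ) +
        ((e θ - e₀ : ℝ) : ℂ) • (ψ θ - ⟪φ, ψ θ⟫_ℂ • φ) := by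
    have h5 := hφ.inner_apply_sub hsa (ψ θ)
    have h6 : H θ₀ (ψ θ) - (e₀ : ℂ) • ψ θ =
        -(H θ - H θ₀) (ψ θ) + ((e θ - e₀ : ℝ) : ℂ) • ψ θ := by
      rw [sub_apply, hθ.eigen]
      push_cast
      module
    have h7 : ⟪φ, -(H θ - H θ₀) (ψ θ) + ((e θ - e₀ : ℝ) : ℂ) • ψ θ⟫_ℂ = 0 := by rw [← h6, h5]
    rw [inner_add_right, inner_neg_right, inner_smul_right] at h7
    rw [h6, smul_sub, smul_smul, ← sub_eq_zero]
    have h8 : ⟪φ, (H θ - H θ₀) (ψ θ)⟫_ℂ = ((e θ - e₀ : ℝ) : ℂ) * ⟪φ, ψ θ⟫_ℂ := by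
      linear_combination -h7
    rw [h8]
    module
  have h9 : H θ₀ (ψ θ₀) - (e₀ : ℂ) • ψ θ₀ = 0 := by rw [h0, hφ.eigen, sub_self]
  rw [slope_def_module, slope_def_module, h9, sub_zero, h4, ← Complex.coe_smul (θ - θ₀)⁻¹,
    ← Complex.coe_smul (θ - θ₀)⁻¹, smul_apply, inner_smul_right, Complex.ofReal_div,
    Complex.ofReal_inv]
  module

/-- The derivative solves the velocity equation, so it differs from `u` by a multiple of `φ`;
constancy of the norm makes the coefficient imaginary. This is the gauge freedom of the families of
ground states. -/
theorem eq_add_smul_of_hasDerivAt (hsa : IsSelfAdjoint (H θ₀)) (hH : HasDerivAt H A θ₀)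
    (hφ : IsGapped (H θ₀) g e₀ φ) (hg : 0 < g) (hψ : ∀ᶠ θ in 𝓝 θ₀, IsGround (H θ) (e θ) (ψ θ))
    (h0 : ψ θ₀ = φ) (hv : HasDerivAt ψ v θ₀) (hu : IsVelocity (H θ₀) e₀ φ A u) :
    ∃ c : ℝ, v = u + (c * Complex.I) • φ := by
  have hlim : Tendsto ψ (𝓝 θ₀) (𝓝 φ) := h0 ▸ hv.continuousAt
  have h1 := hasDerivAt_apply_sub hsa hH hφ hg hψ hlim h0
  have h2 : HasDerivAt (fun θ => H θ₀ (ψ θ) - (e₀ : ℂ) • ψ θ) (H θ₀ v - (e₀ : ℂ) • v) θ₀ :=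
    (((H θ₀).restrictScalars ℝ).hasFDerivAt.comp_hasDerivAt θ₀ hv).sub (hv.const_smul _)
  have h3 := hu.eq_add_smul hφ hg (h2.unique h1)
  refine ⟨(⟪φ, v⟫_ℂ).im, ?_⟩
  have h4 : HasDerivAt (fun θ => ⟪ψ θ, ψ θ⟫_ℂ) (⟪φ, v⟫_ℂ + ⟪v, φ⟫_ℂ) θ₀ := by
    simpa [h0] using hv.inner ℂ hv
  have h5 : HasDerivAt (fun θ => ⟪ψ θ, ψ θ⟫_ℂ) 0 θ₀ := by
    refine (hasDerivAt_const θ₀ (1 : ℂ)).congr_of_eventuallyEq ?_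
    filter_upwards [hψ] with θ hθ
    rw [inner_self_eq_norm_sq_to_K, hθ.norm_eq]
    simp
  have h6 := h4.unique h5
  rw [← inner_conj_symm v, Complex.add_conj] at h6
  have h7 : (⟪φ, v⟫_ℂ).re = 0 := by
    have : 2 * (⟪φ, v⟫_ℂ).re = 0 := by exact_mod_cast h6
    linarith
  have h8 : ⟪φ, v⟫_ℂ = ((⟪φ, v⟫_ℂ).im : ℂ) * Complex.I := by
    rw [← Complex.re_add_im ⟪φ, v⟫_ℂ, h7]; simp
  rw [← h8]
  exact h3

/-- With the phase fixed by a nonnegative overlap with `φ`, the component along `φ` deviates from 1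
only to second order. The orthogonal component is recovered from `hasDerivAt_apply_sub` by inverting
H - e with the gap. -/
theorem hasDerivAt_of_gauge (hsa : IsSelfAdjoint (H θ₀)) (hH : HasDerivAt H A θ₀)
    (hφ : IsGapped (H θ₀) g e₀ φ) (hg : 0 < g) (hψ : ∀ᶠ θ in 𝓝 θ₀, IsGround (H θ) (e θ) (ψ θ))
    (h0 : ψ θ₀ = φ) (hgauge : ∀ θ, ⟪φ, ψ θ⟫_ℂ = ‖⟪φ, ψ θ⟫_ℂ‖) (hu : IsVelocity (H θ₀) e₀ φ A u) :
    HasDerivAt ψ u θ₀ := by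
  have hgr := hφ.isGround hg.le hsa
  -- By Pythagoras and 1 - c ≤ 1 - c² for 0 ≤ c ≤ 1, where c is the overlap.
  have hone : ∀ᶠ θ in 𝓝 θ₀, ‖⟪φ, ψ θ⟫_ℂ - 1‖ ≤ ‖ψ θ - ⟪φ, ψ θ⟫_ℂ • φ‖ ^ 2 := by
    filter_upwards [hψ] with θ hθ
    have h1 := norm_sq_eq_add_norm_sq_sub hφ.norm_eq (ψ θ)
    rw [hθ.norm_eq] at h1
    have h2 : ‖⟪φ, ψ θ⟫_ℂ - 1‖ = 1 - ‖⟪φ, ψ θ⟫_ℂ‖ := by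
      rw [hgauge θ, ← Complex.ofReal_one, ← Complex.ofReal_sub, Complex.norm_real, Real.norm_eq_abs,
        Complex.norm_real, norm_norm, abs_sub_comm, abs_of_nonneg]
      have := norm_inner_le_norm (𝕜 := ℂ) φ (ψ θ)
      rw [hφ.norm_eq, hθ.norm_eq] at this
      linarith
    nlinarith [norm_nonneg ⟪φ, ψ θ⟫_ℂ]
  have hq : ∀ᶠ θ in 𝓝 θ₀, ‖ψ θ - ⟪φ, ψ θ⟫_ℂ • φ‖ ≤ 2 / g * ‖H θ - H θ₀‖ := by
    filter_upwards [hψ] with θ hθ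
    rw [div_mul_eq_mul_div, le_div_iff₀ hg, mul_comm]
    exact (hφ.mul_norm_sub_le _).trans (hgr.norm_sub_apply_le hθ)
  have hqO : (fun θ => ψ θ - ⟪φ, ψ θ⟫_ℂ • φ) =O[𝓝 θ₀] fun θ => θ - θ₀ :=
    (Asymptotics.IsBigO.of_bound _ hq).trans hH.isBigO_sub
  have hid : Tendsto (fun θ : ℝ => θ - θ₀) (𝓝 θ₀) (𝓝 0) := by
    have : Tendsto (fun θ : ℝ => θ - θ₀) (𝓝 θ₀) (𝓝 (θ₀ - θ₀)) := tendsto_id.sub_const θ₀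
    rwa [sub_self] at this
  have hcO : (fun θ => ⟪φ, ψ θ⟫_ℂ - 1) =o[𝓝 θ₀] fun θ => θ - θ₀ := by
    have h1 : (fun θ => ⟪φ, ψ θ⟫_ℂ - 1) =O[𝓝 θ₀] fun θ => (θ - θ₀) ^ 2 := by
      refine (Asymptotics.IsBigO.of_bound 1 ?_).trans (hqO.norm_left.pow 2)
      filter_upwards [hone] with θ hθ
      simpa using hθ
    refine h1.trans_isLittleO ?_
    have := (Asymptotics.isLittleO_one_iff ℝ).2 hid |>.mul_isBigO
      (Asymptotics.isBigO_refl (fun θ : ℝ => θ - θ₀) (𝓝 θ₀))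
    simpa [sq] using this
  have hc : HasDerivAt (fun θ => ⟪φ, ψ θ⟫_ℂ) 0 θ₀ := by
    rw [hasDerivAt_iff_isLittleO, h0, inner_self_eq_norm_sq_to_K, hφ.norm_eq]
    simpa using hcO
  have hlim : Tendsto ψ (𝓝 θ₀) (𝓝 φ) := by
    have h1 : Tendsto (fun θ => ψ θ - ⟪φ, ψ θ⟫_ℂ • φ) (𝓝 θ₀) (𝓝 0) := hqO.trans_tendsto hid
    have h2 := h1.add (hc.continuousAt.tendsto.smul_const φ)
    rw [h0, inner_self_eq_norm_sq_to_K, hφ.norm_eq, RCLike.ofReal_one, one_pow, one_smul,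
      zero_add] at h2
    simpa using h2
  have hd := hasDerivAt_apply_sub hsa hH hφ hg hψ hlim h0
  have hQ : HasDerivAt (fun θ => ψ θ - ⟪φ, ψ θ⟫_ℂ • φ) u θ₀ := by
    rw [hasDerivAt_iff_isLittleO] at hd ⊢
    refine (Asymptotics.IsBigO.of_bound g⁻¹ (Eventually.of_forall fun θ => ?_)).trans_isLittleO hd
    rw [h0, hφ.eigen, inner_self_eq_norm_sq_to_K, hφ.norm_eq, ← hu.eqn]
    have h3 : ⟪φ, (ψ θ - ⟪φ, ψ θ⟫_ℂ • φ) - (θ - θ₀) • u⟫_ℂ = 0 := by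
      rw [inner_sub_right, inner_sub_inner_smul hφ.norm_eq, inner_smul_right_eq_smul, hu.orth]
      simp
    have h4 := hφ.mul_norm_le h3
    have h5 : H θ₀ ((ψ θ - ⟪φ, ψ θ⟫_ℂ • φ) - (θ - θ₀) • u) -
        (e₀ : ℂ) • ((ψ θ - ⟪φ, ψ θ⟫_ℂ • φ) - (θ - θ₀) • u) =
        (H θ₀ (ψ θ) - (e₀ : ℂ) • ψ θ) - (θ - θ₀) • (H θ₀ u - (e₀ : ℂ) • u) := by
      rw [← hφ.apply_sub_inner (ψ θ) ⟪φ, ψ θ⟫_ℂ, map_sub (H θ₀) _ ((θ - θ₀) • u),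
        ← Complex.coe_smul, ← Complex.coe_smul, map_smul]
      module
    rw [h5] at h4
    rw [inv_mul_eq_div, le_div_iff₀ hg, mul_comm]
    simpa using h4
  have hfin := hQ.add (hc.smul_const φ)
  rw [zero_smul, add_zero] at hfin
  exact hfin.congr_of_eventuallyEq (Eventually.of_forall fun θ => (sub_add_cancel _ _).symm)

/-- Ground states are chosen at each parameter separately and rotated to nonnegative overlap with
`φ`; no continuity of the choice is needed by `hasDerivAt_of_gauge`. Where the overlap is zero the
phase is arbitrary and set to 1. -/
theorem exists_gauge [FiniteDimensional ℂ E] (hsa : ∀ θ, IsSelfAdjoint (H θ))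
    (hφ : IsGapped (H θ₀) g e₀ φ) (hg : 0 < g) :
    ∃ (ψ : ℝ → E) (e : ℝ → ℝ), (∀ θ, IsGround (H θ) (e θ) (ψ θ)) ∧ ψ θ₀ = φ ∧
      ∀ θ, ⟪φ, ψ θ⟫_ℂ = ‖⟪φ, ψ θ⟫_ℂ‖ := by
  have : Nontrivial E := ⟨φ, 0, by rintro rfl; simpa using hφ.norm_eq⟩
  choose e χ hχ using fun θ => exists_isGround (hsa θ)
  let c : ℝ → ℂ := fun θ => if ⟪φ, χ θ⟫_ℂ = 0 then 1 else
    (starRingEnd ℂ) ⟪φ, χ θ⟫_ℂ / ‖⟪φ, χ θ⟫_ℂ‖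
  have hc : ∀ θ, ‖c θ‖ = 1 := by
    intro θ
    simp only [c]
    split_ifs with h
    · simp
    · rw [norm_div, RCLike.norm_conj, Complex.norm_real, norm_norm, div_self (norm_ne_zero_iff.2 h)]
  have hci : ∀ θ, c θ * ⟪φ, χ θ⟫_ℂ = ‖⟪φ, χ θ⟫_ℂ‖ := by
    intro θ
    simp only [c]
    split_ifs with h
    · simp [h]
    · have : (‖⟪φ, χ θ⟫_ℂ‖ : ℂ) ≠ 0 := by simpa using h
      rw [div_mul_eq_mul_div, Complex.conj_mul', sq, mul_div_assoc, div_self this, mul_one]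
  refine ⟨fun θ => c θ • χ θ, e, fun θ => (hχ θ).smul (hc θ), ?_, fun θ => ?_⟩
  · obtain ⟨-, h1, h2⟩ := hφ.unique hg (hsa θ₀) (hχ θ₀)
    simp only
    rw [h2, smul_smul, hci, h1]
    simp
  · rw [inner_smul_right, hci]
    simp

end Velocity

end QuantumHall

namespace QuantumHall

open Filter

/-! ### Transport of ground states and the phase of a small loop -/

section Transport

variable {E : Type*} [NormedAddCommGroup E] [InnerProductSpace ℂ E] [CompleteSpace E]
  [FiniteDimensional ℂ E]

/-- Evolution by a self-adjoint generator that induces the velocity of ground states preserves ground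
states. -/
theorem isGround_of_transport {H A D : ℝ → E →L[ℂ] E} {χ : ℝ → E} {g r e₀ : ℝ} (hg : 0 < g)
    (hsa : ∀ s, IsSelfAdjoint (H s)) (hH : ∀ s, HasDerivAt H (A s) s)
    (hgap : ∀ s ∈ Set.Icc 0 r, ∀ e φ, IsGround (H s) e φ → IsGapped (H s) g e φ)
    (hD : ∀ s, IsSelfAdjoint (D s))
    (hvel : ∀ s ∈ Set.Icc 0 r, ∀ e φ, IsGround (H s) e φ →
      IsVelocity (H s) e φ (A s) (Complex.I • D s φ))
    (hχ : ∀ s, HasDerivAt χ (Complex.I • D s (χ s)) s) (h0 : IsGround (H 0) e₀ (χ 0)) :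
    ∀ s ∈ Set.Icc 0 r, ∃ e, IsGround (H s) e (χ s) := by
  have : Nontrivial E := ⟨χ 0, 0, by intro h; simpa [h] using h0.norm_eq⟩
  -- An arbitrary, possibly discontinuous choice of reference ground states: only |⟨ψ, χ⟩|² is used,
  -- which ignores their phases. It will be constant, hence equal to its initial value 1.
  choose e ψ hψ using fun s => exists_isGround (hsa s)
  have hinner : ∀ s, ∀ φ : E, ⟪φ, Complex.I • D s (χ s)⟫_ℂ + ⟪Complex.I • D s φ, χ s⟫_ℂ = 0 := by
    intro s φ
    rw [inner_smul_left, inner_smul_right, (hD s).isSymmetric.apply_clm]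
    simp
  have hnorm : ∀ s, ‖χ s‖ = 1 := by
    have h1 : ∀ s, HasDerivAt (fun s => ⟪χ s, χ s⟫_ℂ) 0 s := fun s => by
      simpa only [hinner s (χ s)] using (hχ s).inner ℂ (hχ s)
    intro s
    have h2 := is_const_of_deriv_eq_zero (fun s => (h1 s).differentiableAt)
      (fun s => (h1 s).deriv) s 0
    simp only [inner_self_eq_norm_sq_to_K, h0.norm_eq] at h2
    have h3 : ‖χ s‖ ^ 2 = 1 ^ 2 := by
      rw [RCLike.ofReal_eq_complex_ofReal] at h2
      exact_mod_cast h2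
    have := norm_nonneg (χ s)
    nlinarith
  -- Near `s` the reference states may be replaced by a gauge-fixed family, differentiable at `s`.
  -- There it and χ move with the same self-adjoint generator, so the overlap has derivative zero.
  have hder : ∀ s ∈ Set.Icc 0 r, HasDerivAt (fun s => ‖⟪ψ s, χ s⟫_ℂ‖ ^ 2) 0 s := by
    intro s hs
    have hgs := hgap s hs _ _ (hψ s)
    obtain ⟨η, ε, hη, hη0, hgauge⟩ := exists_gauge hsa hgs hg
    have hd := hasDerivAt_of_gauge (hsa s) (hH s) hgs hg (Eventually.of_forall hη) hη0 hgauge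
      (hvel s hs _ _ (hψ s))
    have h1 : HasDerivAt (fun s => ⟪η s, χ s⟫_ℂ) 0 s := by
      have := hd.inner ℂ (hχ s)
      rwa [hη0, hinner] at this
    have h2 := h1.norm_sq
    rw [inner_zero_right, mul_zero] at h2
    refine h2.congr_of_eventuallyEq ?_
    have hclose : ∀ᶠ t in 𝓝 s, ‖H t - H s‖ < g / 4 := by
      have h3 : Tendsto (fun t => ‖H t - H s‖) (𝓝 s) (𝓝 ‖H s - H s‖) :=
        ((hH s).continuousAt.tendsto.sub_const _).norm
      rw [sub_self, norm_zero] at h3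
      exact h3.eventually (gt_mem_nhds (by positivity))
    filter_upwards [hclose] with t ht
    have h4 := hgs.perturb hg (hsa s) (hsa t) (hψ t) ht.le (by linarith)
    obtain ⟨-, h5, h6⟩ := h4.unique (by linarith) (hsa t) (hη t)
    rw [h6, inner_smul_left, norm_mul, RCLike.norm_conj, h5, one_mul]
  intro s hs
  have hconst : ‖⟪ψ s, χ s⟫_ℂ‖ ^ 2 = ‖⟪ψ 0, χ 0⟫_ℂ‖ ^ 2 := by
    refine constant_of_has_deriv_right_zero (fun t ht => (hder t ht).continuousAt.continuousWithinAt)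
      (fun t ht => (hder t ⟨ht.1, ht.2.le⟩).hasDerivWithinAt) s hs
  have hr : (0 : ℝ) ∈ Set.Icc 0 r := ⟨le_rfl, hs.1.trans hs.2⟩
  obtain ⟨-, h1, -⟩ := (hgap 0 hr _ _ (hψ 0)).unique hg (hsa 0) h0
  rw [h1, one_pow] at hconst
  have h2 := norm_sq_eq_add_norm_sq_sub (hψ s).norm_eq (χ s)
  rw [hnorm, hconst] at h2
  have h3 : ‖χ s - ⟪ψ s, χ s⟫_ℂ • ψ s‖ = 0 := by
    have : ‖χ s - ⟪ψ s, χ s⟫_ℂ • ψ s‖ ^ 2 = 0 := by linarith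
    simpa using this
  have h4 : χ s = ⟪ψ s, χ s⟫_ℂ • ψ s := sub_eq_zero.1 (norm_eq_zero.1 h3)
  refine ⟨e s, ?_⟩
  rw [h4]
  refine (hψ s).smul ?_
  have := norm_nonneg ⟪ψ s, χ s⟫_ℂ
  nlinarith

/-- A path of unit vectors with a velocity orthogonal to the path and close to a constant. -/
structure IsNearlyStraight (r c δ : ℝ) (p : E) (χ χ' : ℝ → E) : Prop where
  deriv : ∀ s ∈ Set.Icc 0 r, HasDerivAt χ (χ' s) s
  orth : ∀ s ∈ Set.Icc 0 r, ⟪χ s, χ' s⟫_ℂ = 0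
  norm_le : ∀ s ∈ Set.Icc 0 r, ‖χ' s‖ ≤ c
  close : ∀ s ∈ Set.Icc 0 r, ‖χ' s - p‖ ≤ δ

namespace IsNearlyStraight

omit [CompleteSpace E] [FiniteDimensional ℂ E]

variable {r c δ : ℝ} {p : E} {χ χ' : ℝ → E}

theorem norm_sub_le (h : IsNearlyStraight r c δ p χ χ') {s : ℝ} (hs : s ∈ Set.Icc 0 r) :
    ‖χ s - χ 0‖ ≤ c * s := by
  have := norm_image_sub_le_of_norm_deriv_le_segment' (f := χ) (f' := χ') (a := 0) (b := r)
    (fun t ht => (h.deriv t ht).hasDerivWithinAt) (fun t ht => h.norm_le t ⟨ht.1, ht.2.le⟩) s hs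
  rwa [sub_zero] at this

theorem norm_sub_smul_le (h : IsNearlyStraight r c δ p χ χ') {s : ℝ} (hs : s ∈ Set.Icc 0 r) :
    ‖χ s - χ 0 - s • p‖ ≤ δ * s := by
  have := norm_image_sub_le_of_norm_deriv_le_segment' (f := fun s => χ s - s • p)
    (f' := fun s => χ' s - (1 : ℝ) • p) (a := 0) (b := r)
    (fun t ht => ((h.deriv t ht).sub ((hasDerivAt_id t).smul_const p)).hasDerivWithinAt)
    (fun t ht => by simpa using h.close t ⟨ht.1, ht.2.le⟩) s hs
  simpa [sub_right_comm] using this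

/-- Orthogonality of velocity and path gives ⟨χ(0), χ'(s)⟩ = -⟨χ(s) - χ(0), χ'(s)⟩, which is close
to the real number -s‖χ'(s)‖². Only the errors have an imaginary part, and integration yields the
second power of `r`. -/
theorem abs_im_inner_le (h : IsNearlyStraight r c δ p χ χ') (hr : 0 ≤ r) :
    |(⟪χ 0, χ r⟫_ℂ).im| ≤ 2 * δ * c * r ^ 2 := by
  have h0 : (0 : ℝ) ∈ Set.Icc 0 r := ⟨le_rfl, hr⟩
  have hδ : 0 ≤ δ := (norm_nonneg _).trans (h.close 0 h0)
  have hc : 0 ≤ c := (norm_nonneg _).trans (h.norm_le 0 h0)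
  have hb : ∀ s ∈ Set.Icc 0 r, |(⟪χ 0, χ' s⟫_ℂ).im| ≤ 2 * δ * c * r := by
    intro s hs
    -- Here p is replaced by χ'(s) in the main term s⟨p, χ'(s)⟩, so that this term becomes exactly
    -- real; both errors are of size δcr.
    have h1 : ⟪χ 0, χ' s⟫_ℂ = -⟪χ s - χ 0 - s • p, χ' s⟫_ℂ + s • ⟪χ' s - p, χ' s⟫_ℂ -
        s • ⟪χ' s, χ' s⟫_ℂ := by
      simp only [inner_sub_left, h.orth s hs, inner_smul_left_eq_smul, smul_sub]
      ring
    have h2 : (s • ⟪χ' s, χ' s⟫_ℂ).im = 0 := by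
      rw [Complex.smul_im, inner_self_eq_norm_sq_to_K, RCLike.ofReal_eq_complex_ofReal,
        ← Complex.ofReal_pow, Complex.ofReal_im, smul_zero]
    have h3 : ‖-⟪χ s - χ 0 - s • p, χ' s⟫_ℂ + s • ⟪χ' s - p, χ' s⟫_ℂ‖ ≤ 2 * δ * c * r := by
      refine (norm_add_le _ _).trans ?_
      have n1 : ‖-⟪χ s - χ 0 - s • p, χ' s⟫_ℂ‖ ≤ (δ * r) * c := by
        rw [norm_neg]
        refine (norm_inner_le_norm _ _).trans (mul_le_mul ?_ (h.norm_le s hs) (norm_nonneg _)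
          (by positivity))
        refine (h.norm_sub_smul_le hs).trans ?_
        gcongr
        exact hs.2
      have n2 : ‖s • ⟪χ' s - p, χ' s⟫_ℂ‖ ≤ r * (δ * c) := by
        rw [norm_smul, Real.norm_of_nonneg hs.1]
        refine mul_le_mul hs.2 ((norm_inner_le_norm _ _).trans ?_) (norm_nonneg _) hr
        exact mul_le_mul (h.close s hs) (h.norm_le s hs) (norm_nonneg _) hδ
      linarith
    rw [h1, Complex.sub_im, h2, sub_zero]
    exact (Complex.abs_im_le_norm _).trans h3
  have hd : ∀ s ∈ Set.Icc 0 r, HasDerivAt (fun s => (⟪χ 0, χ s⟫_ℂ).im) (⟪χ 0, χ' s⟫_ℂ).im s := by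
    intro s hs
    have h1 : HasDerivAt (fun s => ⟪χ 0, χ s⟫_ℂ) ⟪χ 0, χ' s⟫_ℂ s := by
      simpa using (hasDerivAt_const s (χ 0)).inner ℂ (h.deriv s hs)
    exact Complex.imCLM.hasFDerivAt.comp_hasDerivAt s h1
  have := norm_image_sub_le_of_norm_deriv_le_segment' (a := 0) (b := r)
    (fun t ht => (hd t ht).hasDerivWithinAt) (fun t ht => hb t ⟨ht.1, ht.2.le⟩) r ⟨hr, le_rfl⟩
  rw [inner_self_eq_norm_sq_to_K, RCLike.ofReal_eq_complex_ofReal, ← Complex.ofReal_pow,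
    Complex.ofReal_im, sub_zero, sub_zero, Real.norm_eq_abs] at this
  linarith

end IsNearlyStraight

omit [CompleteSpace E] [FiniteDimensional ℂ E] in
theorem abs_im_inner_sub_inner_le {x y p q : E} {ε c : ℝ} (hx : ‖x - p‖ ≤ ε) (hy : ‖y - q‖ ≤ ε)
    (hxc : ‖x‖ ≤ c) (hq : ‖q‖ ≤ c) : |(⟪x, y⟫_ℂ).im - (⟪p, q⟫_ℂ).im| ≤ 2 * ε * c := by
  have h1 : ⟪x, y⟫_ℂ - ⟪p, q⟫_ℂ = ⟪x, y - q⟫_ℂ + ⟪x - p, q⟫_ℂ := by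
    rw [inner_sub_left, inner_sub_right]; ring
  have hc : 0 ≤ c := (norm_nonneg _).trans hxc
  have hε : 0 ≤ ε := (norm_nonneg _).trans hx
  rw [← Complex.sub_im, h1]
  refine (Complex.abs_im_le_norm _).trans ((norm_add_le _ _).trans ?_)
  have n1 := (norm_inner_le_norm (𝕜 := ℂ) x (y - q)).trans
    (mul_le_mul hxc hy (norm_nonneg _) hc)
  have n2 := (norm_inner_le_norm (𝕜 := ℂ) (x - p) q).trans
    (mul_le_mul hx hq (norm_nonneg _) hε)
  linarith

/-- On the right half of the unit circle Im z = sin(arg z), so |arg z| ≤ (π/2)|Im z| ≤ 2|Im z|, and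
|x - sin x| ≤ |x|³/6. -/
theorem abs_arg_sub_im_le {z : ℂ} (hz : ‖z‖ = 1) (hre : 0 < z.re) :
    |z.arg - z.im| ≤ 2 * |z.im| ^ 3 := by
  have hs : Real.sin z.arg = z.im := by rw [Complex.sin_arg, hz, div_one]
  have harg : |z.arg| ≤ Real.pi / 2 := Complex.abs_arg_le_pi_div_two_iff.2 hre.le
  have h1 := Real.mul_abs_le_abs_sin harg
  rw [hs] at h1
  have h2 : |z.arg| ≤ 2 * |z.im| := by
    have h3 : |z.arg| ≤ Real.pi / 2 * |z.im| := by
      rw [div_mul_eq_mul_div, le_div_iff₀ (by norm_num)]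
      rw [div_mul_eq_mul_div, div_le_iff₀ Real.pi_pos] at h1
      linarith
    have h4 := Real.pi_le_four
    nlinarith [abs_nonneg z.im]
  have key : ∀ x : ℝ, |x - Real.sin x| ≤ |x| ^ 3 / 6 := by
    have pos : ∀ x : ℝ, 0 < x → |x - Real.sin x| ≤ |x| ^ 3 / 6 := by
      intro x hx
      have h5 := Real.sin_gt_sub_cube hx
      have h6 := Real.sin_lt hx
      rw [abs_of_pos (by linarith), abs_of_pos hx]
      linarith
    intro x
    rcases lt_trichotomy x 0 with h | rfl | h
    · have := pos (-x) (by linarith)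
      rwa [Real.sin_neg, ← neg_sub', abs_neg, abs_neg] at this
    · simp
    · exact pos x h
  have h7 := key z.arg
  rw [hs] at h7
  have h8 : |z.arg| ^ 3 ≤ (2 * |z.im|) ^ 3 := by gcongr
  have h9 : 0 ≤ |z.im| ^ 3 := by positivity
  nlinarith

theorem norm_exp_I_mul_sub_exp_I_mul_le (a b : ℝ) :
    ‖Complex.exp (Complex.I * a) - Complex.exp (Complex.I * b)‖ ≤ |a - b| := by
  have h1 : Complex.exp (Complex.I * a) - Complex.exp (Complex.I * b) =
      Complex.exp (Complex.I * b) * (Complex.exp (Complex.I * (a - b : ℝ)) - 1) := by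
    rw [mul_sub, ← Complex.exp_add, mul_one]
    push_cast
    ring_nf
  rw [h1, norm_mul, mul_comm Complex.I (b : ℂ), Complex.norm_exp_ofReal_mul_I, one_mul]
  exact Real.norm_exp_I_mul_ofReal_sub_one_le

omit [CompleteSpace E] [FiniteDimensional ℂ E] in
/-- The phase picked up around a small square, to second order in the side of the square. -/
theorem norm_inner_cpow_sub_exp_le {r c δ : ℝ} {p q : E} {χ₁ χ₁' χ₂ χ₂' χ₃ χ₃' χ₄ χ₄' : ℝ → E}
    (hr : 0 < r) (hcr : 4 * c * r ≤ 1)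
    (h₁ : IsNearlyStraight r c δ p χ₁ χ₁') (h₂ : IsNearlyStraight r c δ q χ₂ χ₂')
    (h₃ : IsNearlyStraight r c δ q χ₃ χ₃') (h₄ : IsNearlyStraight r c δ p χ₄ χ₄')
    (h₁₃ : χ₁ 0 = χ₃ 0) (h₁₂ : χ₂ 0 = χ₁ r) (h₃₄ : χ₄ 0 = χ₃ r)
    (hp : ‖p‖ ≤ c) (hq : ‖q‖ ≤ c) (hw1 : ‖χ₂ r‖ = 1) (hv1 : ‖χ₄ r‖ = 1)
    (hphase : ‖⟪χ₄ r, χ₂ r⟫_ℂ‖ = 1) :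
    ‖⟪χ₄ r, χ₂ r⟫_ℂ ^ (((2 * Real.pi / r) ^ 2 : ℝ) : ℂ) -
        Complex.exp (Complex.I * ((2 * Real.pi) ^ 2 * (2 * (⟪q, p⟫_ℂ).im) : ℝ))‖ ≤
      (2 * Real.pi) ^ 2 * (20 * δ * c + 128 * c ^ 3 * r) := by
  have hr' : r ∈ Set.Icc 0 r := ⟨hr.le, le_rfl⟩
  have hc : 0 ≤ c := (norm_nonneg _).trans hp
  set z := ⟪χ₄ r, χ₂ r⟫_ℂ with hz
  set Ψ := χ₁ 0
  obtain ⟨x₁, hx₁⟩ : ∃ x, x = χ₁ r - χ₁ 0 := ⟨_, rfl⟩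
  obtain ⟨x₂, hx₂⟩ : ∃ x, x = χ₂ r - χ₂ 0 := ⟨_, rfl⟩
  obtain ⟨x₃, hx₃⟩ : ∃ x, x = χ₃ r - χ₃ 0 := ⟨_, rfl⟩
  obtain ⟨x₄, hx₄⟩ : ∃ x, x = χ₄ r - χ₄ 0 := ⟨_, rfl⟩
  have a₁ := h₁.norm_sub_smul_le hr'
  have a₂ := h₂.norm_sub_smul_le hr'
  have a₃ := h₃.norm_sub_smul_le hr'
  have a₄ := h₄.norm_sub_smul_le hr'
  have b₁ := h₁.norm_sub_le hr'
  have b₂ := h₂.norm_sub_le hr'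
  have b₃ := h₃.norm_sub_le hr'
  have b₄ := h₄.norm_sub_le hr'
  have c₁ := h₁.abs_im_inner_le hr.le
  have c₂ := h₂.abs_im_inner_le hr.le
  have c₃ := h₃.abs_im_inner_le hr.le
  have c₄ := h₄.abs_im_inner_le hr.le
  rw [← hx₁] at a₁ b₁
  rw [← hx₂] at a₂ b₂
  rw [← hx₃] at a₃ b₃
  rw [← hx₄] at a₄ b₄
  have e₁ : χ₁ r = Ψ + x₁ := by rw [hx₁]; abel
  have e₂ : χ₂ r = Ψ + x₁ + x₂ := by rw [← e₁, hx₂, h₁₂]; abel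
  have e₃ : χ₃ r = Ψ + x₃ := by rw [hx₃, ← h₁₃]; abel
  have e₄ : χ₄ r = Ψ + x₃ + x₄ := by rw [← e₃, hx₄, h₃₄]; abel
  have hself : ∀ x : E, (⟪x, x⟫_ℂ).im = 0 := inner_self_im (𝕜 := ℂ)
  have hsymm : ∀ x y : E, (⟪x, y⟫_ℂ).im = -(⟪y, x⟫_ℂ).im := fun x y => by
    rw [← inner_conj_symm, Complex.conj_im]
  -- The terms linear in the displacements are traded for products of displacements by
  -- `abs_im_inner_le` on each edge: ⟨Ψ, x₂⟩ for -⟨x₁, x₂⟩ and ⟨Ψ, x₄⟩ for -⟨x₃, x₄⟩. With xᵢ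
  -- replaced by rp or rq the result is r² Im⟨q, p⟩ times 1 + 1 + 1 - 1 = 2. Four edge errors and
  -- six product errors, each 2δcr², make up the 20.
  have him : |z.im - r ^ 2 * (2 * (⟪q, p⟫_ℂ).im)| ≤ 20 * δ * c * r ^ 2 := by
    have hn : ∀ y : E, ‖y‖ ≤ c → ‖r • y‖ ≤ c * r := fun y hy => by
      rw [norm_smul, Real.norm_of_nonneg hr.le, mul_comm]
      gcongr
    have s : ∀ x y : E, (⟪r • x, r • y⟫_ℂ).im = r ^ 2 * (⟪x, y⟫_ℂ).im := fun x y => by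
      rw [inner_smul_left_eq_smul, inner_smul_right_eq_smul, smul_smul, ← sq, Complex.smul_im,
        smul_eq_mul]
    have d₁ := abs_im_inner_sub_inner_le a₁ a₂ b₁ (hn q hq)
    have d₂ := abs_im_inner_sub_inner_le a₄ a₃ b₄ (hn q hq)
    have d₃ := abs_im_inner_sub_inner_le a₃ a₁ b₃ (hn p hp)
    have d₄ := abs_im_inner_sub_inner_le a₃ a₂ b₃ (hn q hq)
    have d₅ := abs_im_inner_sub_inner_le a₄ a₁ b₄ (hn p hp)
    have d₆ := abs_im_inner_sub_inner_le a₄ a₂ b₄ (hn q hq)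
    rw [s] at d₁ d₂ d₃ d₄ d₅ d₆
    rw [hself] at d₄ d₅
    rw [hsymm p q] at d₁ d₂ d₆
    rw [e₁, inner_add_right, Complex.add_im, hself] at c₁
    rw [e₃, ← h₁₃, inner_add_right, Complex.add_im, hself] at c₃
    rw [e₂, h₁₂, e₁, inner_add_right, Complex.add_im, hself, inner_add_left, Complex.add_im] at c₂
    rw [e₄, h₃₄, e₃, inner_add_right, Complex.add_im, hself, inner_add_left, Complex.add_im] at c₄
    have hz' : z.im = (⟪Ψ, x₁⟫_ℂ).im + (⟪Ψ, x₂⟫_ℂ).im - (⟪Ψ, x₃⟫_ℂ).im - (⟪Ψ, x₄⟫_ℂ).im +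
        (⟪x₃, x₁⟫_ℂ).im + (⟪x₃, x₂⟫_ℂ).im + (⟪x₄, x₁⟫_ℂ).im + (⟪x₄, x₂⟫_ℂ).im := by
      rw [hz, e₄, e₂]
      simp only [inner_add_left, inner_add_right, Complex.add_im, hself]
      rw [hsymm x₃ Ψ, hsymm x₄ Ψ]
      ring
    have hx43 := hsymm x₄ x₃
    rw [hx43] at d₂
    rw [abs_le] at c₁ c₂ c₃ c₄ d₁ d₂ d₃ d₄ d₅ d₆ ⊢
    rw [hz']
    obtain ⟨c₁, c₁'⟩ := c₁
    obtain ⟨c₂, c₂'⟩ := c₂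
    obtain ⟨c₃, c₃'⟩ := c₃
    obtain ⟨c₄, c₄'⟩ := c₄
    obtain ⟨d₁, d₁'⟩ := d₁
    obtain ⟨d₂, d₂'⟩ := d₂
    obtain ⟨d₃, d₃'⟩ := d₃
    obtain ⟨d₄, d₄'⟩ := d₄
    obtain ⟨d₅, d₅'⟩ := d₅
    obtain ⟨d₆, d₆'⟩ := d₆
    constructor
    · linarith only [c₁, c₂, c₃', c₄', d₁', d₂', d₃, d₄, d₅, d₆]
    · linarith only [c₁', c₂', c₃, c₄, d₁, d₂, d₃', d₄', d₅', d₆']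
  -- The two end points are four edges apart, so `z` is near 1: this gives Re z ≥ 1/2, so that the
  -- principal logarithm is i times the small angle.
  have hvw : ‖χ₄ r - χ₂ r‖ ≤ 4 * c * r := by
    rw [e₄, e₂, show Ψ + x₃ + x₄ - (Ψ + x₁ + x₂) = (x₃ + x₄) - (x₁ + x₂) by abel]
    refine (norm_sub_le _ _).trans ((add_le_add (norm_add_le _ _) (norm_add_le _ _)).trans ?_)
    linarith
  have hzim : |z.im| ≤ 4 * c * r := by
    have h1 : z.im = (⟪χ₄ r - χ₂ r, χ₂ r⟫_ℂ).im := by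
      rw [inner_sub_left, Complex.sub_im, hself, sub_zero]
    rw [h1]
    refine (Complex.abs_im_le_norm _).trans ((norm_inner_le_norm _ _).trans ?_)
    rwa [hw1, mul_one]
  have hzre : 0 < z.re := by
    have h1 := norm_sub_sq (𝕜 := ℂ) (χ₄ r) (χ₂ r)
    rw [hv1, hw1, ← hz] at h1
    have h2 : ‖χ₄ r - χ₂ r‖ ≤ 1 := hvw.trans hcr
    have h3 : RCLike.re z = z.re := rfl
    rw [h3] at h1
    nlinarith [norm_nonneg (χ₄ r - χ₂ r)]
  have harg := abs_arg_sub_im_le hphase hzre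
  have hz0 : z ≠ 0 := by
    intro h
    rw [h, norm_zero] at hphase
    exact zero_ne_one hphase
  have hpow : z ^ (((2 * Real.pi / r) ^ 2 : ℝ) : ℂ) =
      Complex.exp (Complex.I * (z.arg * (2 * Real.pi / r) ^ 2 : ℝ)) := by
    rw [Complex.cpow_def_of_ne_zero hz0, Complex.log, hphase, Real.log_one]
    congr 1
    push_cast
    ring
  rw [hpow]
  refine (norm_exp_I_mul_sub_exp_I_mul_le _ _).trans ?_
  have h3 : z.arg * (2 * Real.pi / r) ^ 2 - (2 * Real.pi) ^ 2 * (2 * (⟪q, p⟫_ℂ).im) =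
      (2 * Real.pi) ^ 2 / r ^ 2 * (z.arg - r ^ 2 * (2 * (⟪q, p⟫_ℂ).im)) := by
    field_simp
  have h4 : |z.arg - r ^ 2 * (2 * (⟪q, p⟫_ℂ).im)| ≤ 20 * δ * c * r ^ 2 + 2 * (4 * c * r) ^ 3 := by
    have h5 : |z.im| ^ 3 ≤ (4 * c * r) ^ 3 := by gcongr
    calc _ ≤ |z.arg - z.im| + |z.im - r ^ 2 * (2 * (⟪q, p⟫_ℂ).im)| := abs_sub_le _ _ _
      _ ≤ _ := by linarith
  rw [h3, abs_mul, abs_of_pos (by positivity : 0 < (2 * Real.pi) ^ 2 / r ^ 2)]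
  calc _ ≤ (2 * Real.pi) ^ 2 / r ^ 2 * (20 * δ * c * r ^ 2 + 2 * (4 * c * r) ^ 3) := by gcongr
    _ = _ := by field_simp; ring

end Transport

noncomputable section

namespace Lattice

variable {L : ℕ} {Λ : Lattice L}

/-! ### Locality of the observables -/

/-- The standard basis vectors. -/
def ket (Λ : Lattice L) (b : Λ.Basis) : Λ.Hilb := EuclideanSpace.single b 1

theorem ofMatrix_ket (M : Matrix Λ.Basis Λ.Basis ℂ) (b : Λ.Basis) :
    Λ.ofMatrix M (Λ.ket b) = ∑ a, M a b • Λ.ket a := by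
  ext a
  simp [ofMatrix, ket, Matrix.ofLp_toEuclideanCLM, Pi.single_apply]

theorem op_ext {A B : Λ.Op} (h : ∀ b, A (Λ.ket b) = B (Λ.ket b)) : A = B := by
  have h1 : (A : Λ.Hilb →ₗ[ℂ] Λ.Hilb) = B := by
    refine (EuclideanSpace.basisFun Λ.Basis ℂ).toBasis.ext fun b => ?_
    simpa [ket] using h b
  exact ContinuousLinearMap.coe_injective h1

theorem star_ofMatrix (M : Matrix Λ.Basis Λ.Basis ℂ) :
    star (Λ.ofMatrix M) = Λ.ofMatrix M.conjTranspose := by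
  unfold ofMatrix
  rw [← map_star]
  rfl

/-- The sign `(-1)^{#{k ∈ S : k < j}}`. -/
def jwSign {n : ℕ} (j : Fin n) (S : Finset (Fin n)) : ℂ := (-1) ^ (S.filter (fun k => k < j)).card

theorem jwSign_erase {n : ℕ} {i j : Fin n} {S : Finset (Fin n)} (hi : i ∈ S) :
    jwSign j (S.erase i) = if i < j then -jwSign j S else jwSign j S := by
  unfold jwSign
  rw [Finset.filter_erase]
  split_ifs with h
  · have hm : i ∈ S.filter (fun k => k < j) := Finset.mem_filter.2 ⟨hi, h⟩
    rw [← Finset.card_erase_add_one hm, pow_succ]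
    ring
  · rw [Finset.erase_eq_of_notMem]
    simp [h]

theorem jwSign_insert {n : ℕ} {i j : Fin n} {S : Finset (Fin n)} (hi : i ∉ S) :
    jwSign j (insert i S) = if i < j then -jwSign j S else jwSign j S := by
  have h := jwSign_erase (j := j) (Finset.mem_insert_self i S)
  rw [Finset.erase_insert hi] at h
  rw [h]
  split_ifs <;> simp

theorem jwSign_mul_self {n : ℕ} (j : Fin n) (S : Finset (Fin n)) : jwSign j S * jwSign j S = 1 := by
  unfold jwSign
  rw [← mul_pow]
  simp

theorem annihilate_ket (j : Fin Λ.numModes) (σ : Λ.SpinConf) (S : Finset (Fin Λ.numModes)) :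
    Λ.annihilate j (Λ.ket (σ, S)) = if j ∈ S then jwSign j S • Λ.ket (σ, S.erase j) else 0 := by
  unfold annihilate
  rw [ofMatrix_ket]
  split_ifs with h
  · rw [Finset.sum_eq_single (σ, S.erase j)]
    · simp [h, jwSign]
    · intro b _ hb
      rw [Matrix.of_apply, if_neg, zero_smul]
      rintro ⟨h1, -, h2⟩
      exact hb (Prod.ext h1 h2)
    · simp
  · refine Finset.sum_eq_zero fun b _ => ?_
    simp [h]

theorem create_ket (j : Fin Λ.numModes) (σ : Λ.SpinConf) (S : Finset (Fin Λ.numModes)) :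
    star (Λ.annihilate j) (Λ.ket (σ, S)) =
      if j ∈ S then 0 else jwSign j S • Λ.ket (σ, insert j S) := by
  unfold annihilate
  rw [star_ofMatrix, ofMatrix_ket]
  split_ifs with h
  · refine Finset.sum_eq_zero fun b _ => ?_
    rw [Matrix.conjTranspose_apply, Matrix.of_apply, if_neg, star_zero, zero_smul]
    rintro ⟨-, h1, h2⟩
    simp only at h2
    rw [h2] at h
    simp at h
  · rw [Finset.sum_eq_single (σ, insert j S)]
    · have h1 := jwSign_insert (j := j) h
      rw [if_neg (lt_irrefl j)] at h1
      rw [Matrix.conjTranspose_apply, Matrix.of_apply,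
        if_pos ⟨rfl, Finset.mem_insert_self _ _, (Finset.erase_insert h).symm⟩, ← h1]
      simp [jwSign]
    · intro b _ hb
      rw [Matrix.conjTranspose_apply, Matrix.of_apply, if_neg, star_zero, zero_smul]
      rintro ⟨h1, h2, h3⟩
      refine hb (Prod.ext h1.symm ?_)
      simp only at h3
      rw [h3, Finset.insert_erase h2]
    · simp

theorem annihilate_mul_self (j : Fin Λ.numModes) : Λ.annihilate j * Λ.annihilate j = 0 := by
  refine op_ext fun ⟨σ, S⟩ => ?_
  rw [mul_apply_eq_comp, annihilate_ket]
  split_ifs with h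
  · rw [map_smul, annihilate_ket, if_neg (Finset.notMem_erase j S)]
    simp
  · simp

theorem annihilate_create (j : Fin Λ.numModes) :
    Λ.annihilate j * star (Λ.annihilate j) + star (Λ.annihilate j) * Λ.annihilate j = 1 := by
  refine op_ext fun ⟨σ, S⟩ => ?_
  rw [add_apply, mul_apply_eq_comp,
    mul_apply_eq_comp, annihilate_ket, create_ket]
  split_ifs with h
  · rw [map_zero, map_smul, create_ket, if_neg (Finset.notMem_erase j S), smul_smul,
      jwSign_erase h, if_neg (lt_irrefl j), jwSign_mul_self, Finset.insert_erase h]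
    simp
  · rw [map_zero, map_smul, annihilate_ket, if_pos (Finset.mem_insert_self j S), smul_smul,
      jwSign_insert h, if_neg (lt_irrefl j), jwSign_mul_self, Finset.erase_insert h]
    simp

/-- Removing mode `i` flips the sign factor of mode `j` exactly if i < j. Of i < j and j < i
precisely one holds, so the two orders differ by one sign. -/
theorem annihilate_anticomm {i j : Fin Λ.numModes} (hij : i ≠ j) :
    Λ.annihilate i * Λ.annihilate j = -(Λ.annihilate j * Λ.annihilate i) := by
  refine op_ext fun ⟨σ, S⟩ => ?_
  rw [neg_apply, mul_apply_eq_comp,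
    mul_apply_eq_comp, annihilate_ket, annihilate_ket]
  by_cases hi : i ∈ S <;> by_cases hj : j ∈ S
  · rw [if_pos hi, if_pos hj, map_smul, map_smul, annihilate_ket, annihilate_ket,
      if_pos (Finset.mem_erase.2 ⟨hij, hi⟩), if_pos (Finset.mem_erase.2 ⟨hij.symm, hj⟩),
      jwSign_erase hi, jwSign_erase hj, Finset.erase_right_comm]
    rcases lt_or_gt_of_ne hij with h | h
    · rw [if_pos h, if_neg h.not_gt]; module
    · rw [if_pos h, if_neg h.not_gt]; module
  · rw [if_neg hj, if_pos hi, map_smul, annihilate_ket, if_neg (by simp [hj])]; simp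
  · rw [if_neg hi, if_pos hj, map_smul, annihilate_ket, if_neg (by simp [hi])]; simp
  · rw [if_neg hi, if_neg hj]; simp

theorem annihilate_create_anticomm {i j : Fin Λ.numModes} (hij : i ≠ j) :
    Λ.annihilate i * star (Λ.annihilate j) = -(star (Λ.annihilate j) * Λ.annihilate i) := by
  refine op_ext fun ⟨σ, S⟩ => ?_
  rw [neg_apply, mul_apply_eq_comp,
    mul_apply_eq_comp, annihilate_ket, create_ket]
  by_cases hi : i ∈ S <;> by_cases hj : j ∈ S
  · rw [if_pos hi, if_pos hj, map_smul, create_ket, if_pos (by simp [hj, hij.symm])]; simp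
  · rw [if_neg hj, if_pos hi, map_smul, map_smul, annihilate_ket, create_ket,
      if_pos (by simp [hi]), if_neg (by simp [hj]), jwSign_insert hj, jwSign_erase hi,
      Finset.erase_insert_of_ne hij.symm]
    rcases lt_or_gt_of_ne hij with h | h
    · rw [if_pos h, if_neg h.not_gt]; module
    · rw [if_pos h, if_neg h.not_gt]; module
  · rw [if_neg hi, if_pos hj]; simp
  · rw [if_neg hi, if_neg hj, map_smul, annihilate_ket, if_neg (by simp [hi, hij])]; simp

theorem fermionOps_anticomm {X Y : Finset (Site L)} (h : Disjoint X Y) {c d : Λ.Op}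
    (hc : c ∈ Λ.fermionOps X) (hd : d ∈ Λ.fermionOps Y) : c * d = -(d * c) := by
  obtain ⟨i, hi, hc⟩ := hc
  obtain ⟨j, hj, hd⟩ := hd
  have hij : i ≠ j := by
    rintro rfl
    exact Finset.disjoint_left.1 h hi hj
  rcases hc with rfl | rfl <;> rcases hd with rfl | rfl
  · exact annihilate_anticomm hij
  · exact annihilate_create_anticomm hij
  · rw [annihilate_create_anticomm hij.symm, neg_neg]
  · rw [← star_mul, ← star_mul, annihilate_anticomm hij.symm]
    exact star_neg (Λ.annihilate i * Λ.annihilate j)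

theorem spinOp_ket (Z : Finset (Site L))
    (M : Matrix ((s : Z) → Fin (Λ.spinDim s)) ((s : Z) → Fin (Λ.spinDim s)) ℂ) (σ : Λ.SpinConf)
    (S : Finset (Fin Λ.numModes)) : Λ.spinOp Z M (Λ.ket (σ, S)) =
      ∑ τ : Λ.SpinConf, (open Classical in
        if ∀ s, s ∉ Z → τ s = σ s then M (fun s => τ s) (fun s => σ s) else 0) •
          Λ.ket (τ, S) := by
  unfold spinOp
  rw [ofMatrix_ket, Fintype.sum_prod_type]
  refine Finset.sum_congr rfl fun τ _ => ?_
  rw [Finset.sum_eq_single S]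
  · simp
  · intro b _ hb
    simp [hb]
  · simp

theorem commute_spinOp_fermionOps (Z Y : Finset (Site L))
    (M : Matrix ((s : Z) → Fin (Λ.spinDim s)) ((s : Z) → Fin (Λ.spinDim s)) ℂ) {c : Λ.Op}
    (hc : c ∈ Λ.fermionOps Y) : Commute (Λ.spinOp Z M) c := by
  -- A creation or annihilation operator changes the occupied set and multiplies by a number,
  -- neither of which depends on the spins.
  have key : ∀ (c : Λ.Op) (f : Finset (Fin Λ.numModes) → ℂ)
      (F : Finset (Fin Λ.numModes) → Finset (Fin Λ.numModes)),
      (∀ σ S, c (Λ.ket (σ, S)) = f S • Λ.ket (σ, F S)) → Commute (Λ.spinOp Z M) c := by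
    intro c f F hcf
    refine op_ext fun ⟨σ, S⟩ => ?_
    rw [mul_apply_eq_comp, mul_apply_eq_comp, hcf, map_smul, spinOp_ket,
      spinOp_ket, map_sum, Finset.smul_sum]
    refine Finset.sum_congr rfl fun τ _ => ?_
    rw [map_smul, hcf, smul_comm]
  obtain ⟨j, -, rfl | rfl⟩ := hc
  · refine key _ (fun S => if j ∈ S then jwSign j S else 0) (fun S => S.erase j) fun σ S => ?_
    rw [annihilate_ket]
    split_ifs <;> simp
  · refine key _ (fun S => if j ∈ S then 0 else jwSign j S) (fun S => insert j S) fun σ S => ?_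
    rw [create_ket]
    split_ifs <;> simp

end Lattice

end

noncomputable section

namespace Lattice

variable {L : ℕ} {Λ : Lattice L}

/-- The configuration that agrees with `t` on `Z` and with `σ` elsewhere. -/
def glue (Z : Finset (Site L)) (t : (s : Z) → Fin (Λ.spinDim s)) (σ : Λ.SpinConf) : Λ.SpinConf :=
  fun s => if h : s ∈ Z then t ⟨s, h⟩ else σ s

theorem glue_mem (Z : Finset (Site L)) (t : (s : Z) → Fin (Λ.spinDim s)) (σ : Λ.SpinConf) (s : Z) :
    glue Z t σ s = t s := by
  simp [glue]

theorem glue_notMem {Z : Finset (Site L)} (t : (s : Z) → Fin (Λ.spinDim s)) (σ : Λ.SpinConf)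
    {s : Site L} (hs : s ∉ Z) : glue Z t σ s = σ s := by
  simp [glue, hs]

theorem spinOp_ket_eq_sum (Z : Finset (Site L))
    (M : Matrix ((s : Z) → Fin (Λ.spinDim s)) ((s : Z) → Fin (Λ.spinDim s)) ℂ) (σ : Λ.SpinConf)
    (S : Finset (Fin Λ.numModes)) : Λ.spinOp Z M (Λ.ket (σ, S)) =
      ∑ t : (s : Z) → Fin (Λ.spinDim s), M t (fun s => σ s) • Λ.ket (glue Z t σ, S) := by
  classical
  rw [spinOp_ket]
  symm
  refine Fintype.sum_of_injective (fun t => glue Z t σ) (fun t t' h => ?_) _ _ (fun τ hτ => ?_)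
    (fun t => ?_)
  · funext s
    have := congrFun h s
    simpa only [glue_mem] using this
  · rw [if_neg, zero_smul]
    intro h
    refine hτ ⟨fun s => τ s, funext fun s => ?_⟩
    by_cases hs : s ∈ Z
    · exact glue_mem Z _ σ ⟨s, hs⟩
    · exact (glue_notMem _ σ hs).trans (h s hs).symm
  · rw [if_pos fun s hs => glue_notMem t σ hs]
    simp only [glue_mem]

theorem spinOp_mul (Z : Finset (Site L))
    (M N : Matrix ((s : Z) → Fin (Λ.spinDim s)) ((s : Z) → Fin (Λ.spinDim s)) ℂ) :
    Λ.spinOp Z M * Λ.spinOp Z N = Λ.spinOp Z (M * N) := by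
  refine op_ext fun ⟨σ, S⟩ => ?_
  have hg : ∀ t t' : (s : Z) → Fin (Λ.spinDim s), glue Z t (glue Z t' σ) = glue Z t σ := by
    intro t t'
    funext s
    by_cases hs : s ∈ Z <;> simp [glue, hs]
  rw [mul_apply_eq_comp, spinOp_ket_eq_sum, spinOp_ket_eq_sum, map_sum]
  simp_rw [map_smul, spinOp_ket_eq_sum, hg, glue_mem, Matrix.mul_apply, Finset.sum_smul,
    Finset.smul_sum, smul_smul]
  rw [Finset.sum_comm]
  refine Finset.sum_congr rfl fun t _ => Finset.sum_congr rfl fun t' _ => ?_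
  rw [mul_comm]

theorem spinOp_one (Z : Finset (Site L)) : Λ.spinOp Z 1 = 1 := by
  refine op_ext fun ⟨σ, S⟩ => ?_
  rw [spinOp_ket_eq_sum]
  refine (Finset.sum_eq_single (fun s : Z => σ s) ?_ ?_).trans ?_
  · intro t _ ht
    rw [Matrix.one_apply_ne ht, zero_smul]
  · simp
  · have : glue Z (fun s => σ s) σ = σ := by
      funext s
      by_cases hs : s ∈ Z <;> simp [glue, hs]
    simp [this]

theorem spinOp_sum {ι : Type*} (I : Finset ι) (Z : Finset (Site L))
    (M : ι → Matrix ((s : Z) → Fin (Λ.spinDim s)) ((s : Z) → Fin (Λ.spinDim s)) ℂ) :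
    ∑ i ∈ I, Λ.spinOp Z (M i) = Λ.spinOp Z (∑ i ∈ I, M i) := by
  refine op_ext fun ⟨σ, S⟩ => ?_
  rw [sum_apply]
  simp_rw [spinOp_ket_eq_sum]
  rw [Finset.sum_comm]
  simp_rw [Matrix.sum_apply, Finset.sum_smul]

theorem commute_spinOp {X Y : Finset (Site L)} (h : Disjoint X Y)
    (M : Matrix ((s : X) → Fin (Λ.spinDim s)) ((s : X) → Fin (Λ.spinDim s)) ℂ)
    (N : Matrix ((s : Y) → Fin (Λ.spinDim s)) ((s : Y) → Fin (Λ.spinDim s)) ℂ) :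
    Commute (Λ.spinOp X M) (Λ.spinOp Y N) := by
  refine op_ext fun ⟨σ, S⟩ => ?_
  have hX : ∀ (t : (s : Y) → Fin (Λ.spinDim s)), (fun s : X => glue Y t σ s) = fun s : X => σ s :=
    fun t => funext fun s => glue_notMem _ _ (Finset.disjoint_left.1 h s.2)
  have hY : ∀ (t : (s : X) → Fin (Λ.spinDim s)), (fun s : Y => glue X t σ s) = fun s : Y => σ s :=
    fun t => funext fun s => glue_notMem _ _ (Finset.disjoint_right.1 h s.2)
  have hg : ∀ (t : (s : X) → Fin (Λ.spinDim s)) (t' : (s : Y) → Fin (Λ.spinDim s)),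
      glue X t (glue Y t' σ) = glue Y t' (glue X t σ) := by
    intro t t'
    funext s
    by_cases hx : s ∈ X
    · simp [glue, hx, Finset.disjoint_left.1 h hx]
    · simp [glue, hx]
  rw [mul_apply_eq_comp, mul_apply_eq_comp, spinOp_ket_eq_sum, spinOp_ket_eq_sum, map_sum, map_sum]
  simp_rw [map_smul, spinOp_ket_eq_sum, hX, hY, hg, Finset.smul_sum, smul_smul]
  rw [Finset.sum_comm]
  refine Finset.sum_congr rfl fun t _ => Finset.sum_congr rfl fun t' _ => ?_
  rw [mul_comm]

theorem commute_of_mem_adjoin {R : Type*} [Ring R] [Algebra ℂ R] {s : Set R} {a b : R}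
    (h : ∀ c ∈ s, Commute a c) (hb : b ∈ Algebra.adjoin ℂ s) : Commute a b := by
  have h1 : Algebra.adjoin ℂ s ≤ Subalgebra.centralizer ℂ {a} := by
    refine Algebra.adjoin_le fun c hc => ?_
    rw [SetLike.mem_coe, Subalgebra.mem_centralizer_iff]
    rintro _ rfl
    exact h c hc
  exact (Subalgebra.mem_centralizer_iff ℂ).1 (h1 hb) a rfl

theorem commute_mul_of_anticomm {R : Type*} [Ring R] {a c c' : R} (h : a * c = -(c * a))
    (h' : a * c' = -(c' * a)) : Commute a (c * c') := by
  rw [Commute, SemiconjBy, ← mul_assoc, h, neg_mul, mul_assoc, h', mul_neg, neg_neg, mul_assoc]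

/-- An operator that commutes with the spin operators on `Z`, and either commutes with all fermionic
operators on `Z` or anticommutes with all of them, commutes with the even observables on `Z`. -/
theorem commute_evenAlg {Z : Finset (Site L)} {a : Λ.Op} (hs : ∀ M, Commute a (Λ.spinOp Z M))
    (hf : (∀ c ∈ Λ.fermionOps Z, Commute a c) ∨ ∀ c ∈ Λ.fermionOps Z, a * c = -(c * a))
    {b : Λ.Op} (hb : b ∈ Λ.evenAlg Z) : Commute a b := by
  refine commute_of_mem_adjoin ?_ hb
  rintro _ (⟨M, rfl⟩ | ⟨c, hc, c', hc', rfl⟩)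
  · exact hs M
  · rcases hf with hf | hf
    · exact (hf c hc).mul_right (hf c' hc')
    · exact commute_mul_of_anticomm (hf c hc) (hf c' hc')

theorem commute_fermionOps_evenAlg {X Z : Finset (Site L)} (h : Disjoint X Z) {c b : Λ.Op}
    (hc : c ∈ Λ.fermionOps X) (hb : b ∈ Λ.evenAlg Z) : Commute c b :=
  commute_evenAlg (fun M => (commute_spinOp_fermionOps Z X M hc).symm)
    (Or.inr fun _ hd => fermionOps_anticomm h hc hd) hb

theorem commute_spinOp_evenAlg {X Z : Finset (Site L)} (h : Disjoint X Z)
    (M : Matrix ((s : X) → Fin (Λ.spinDim s)) ((s : X) → Fin (Λ.spinDim s)) ℂ) {b : Λ.Op}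
    (hb : b ∈ Λ.evenAlg Z) : Commute (Λ.spinOp X M) b :=
  commute_evenAlg (fun N => commute_spinOp h M N)
    (Or.inl fun _ hd => commute_spinOp_fermionOps X Z M hd) hb

/-- Fermionic operators at different sites anticommute, so evenness is essential: the two signs from
a pair cancel. -/
theorem commute_of_disjoint {X Z : Finset (Site L)} (h : Disjoint X Z) {a b : Λ.Op}
    (ha : a ∈ Λ.evenAlg X) (hb : b ∈ Λ.evenAlg Z) : Commute a b := by
  refine (commute_of_mem_adjoin ?_ ha).symm
  rintro _ (⟨M, rfl⟩ | ⟨c, hc, c', hc', rfl⟩)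
  · exact (commute_spinOp_evenAlg h M hb).symm
  · exact ((commute_fermionOps_evenAlg h hc hb).symm).mul_right
      (commute_fermionOps_evenAlg h hc' hb).symm

end Lattice

/-! ### The gap is at most twice the strength of the interaction -/

/-- An operator that commutes with a nontrivial matrix algebra has no nondegenerate ground state. -/
theorem not_isGapped_of_commute {E : Type*} [NormedAddCommGroup E] [InnerProductSpace ℂ E]
    {ι : Type*} [Fintype ι] {K : E →L[ℂ] E} {c d : ι → E →L[ℂ] E}
    (hd : ∀ i, Commute K (d i)) (hd2 : ∀ i, d i * d i = 0) (hone : ∑ i, c i * d i = 1) {g e : ℝ} {φ : E} (hg : 0 < g) :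
    ¬ IsGapped K g e φ := by
  intro h
  -- A nondegenerate ground state is an eigenvector of every operator commuting with `K`, and a
  -- square-zero operator has only eigenvalue 0. So all `d i` annihilate `φ`, against ∑ c i d i = 1.
  have key : ∀ c : E →L[ℂ] E, Commute K c → c * c = 0 → c φ = 0 := by
    intro c hc hc2
    have h1 : K (c φ) = (e : ℂ) • c φ := by
      have := congrArg (fun A : E →L[ℂ] E => A φ) hc.eq
      simp only [mul_apply_eq_comp] at this
      rw [this, h.eigen, map_smul]
    have h2 := h.eq_smul hg h1
    have h3 : c (c φ) = 0 := by rw [← mul_apply_eq_comp, hc2]; rfl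
    obtain ⟨l, hl⟩ : ∃ l : ℂ, c φ = l • φ := ⟨_, h2⟩
    rw [hl, map_smul, hl, smul_smul, smul_eq_zero] at h3
    rcases h3 with h3 | h3
    · rw [hl, mul_self_eq_zero.1 h3, zero_smul]
    · rw [h3, map_zero]
  have h4 : φ = 0 := by
    have h5 := congrArg (fun A : E →L[ℂ] E => A φ) hone
    simp only [sum_apply, mul_apply_eq_comp] at h5
    simpa [key _ (hd _) (hd2 _)] using h5.symm
  simpa [h4] using h.norm_eq

variable {L : ℕ} {Λ : Lattice L}

theorem commute_of_subsingleton [Subsingleton Λ.Basis] (A B : Λ.Op) : Commute A B := by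
  obtain ⟨M, rfl⟩ := (Matrix.toEuclideanCLM (𝕜 := ℂ) (n := Λ.Basis)).surjective A
  obtain ⟨N, rfl⟩ := (Matrix.toEuclideanCLM (𝕜 := ℂ) (n := Λ.Basis)).surjective B
  rw [Commute, SemiconjBy, ← map_mul, ← map_mul]
  congr 1
  ext i j
  simp only [Matrix.mul_apply]
  refine Finset.sum_congr rfl fun k _ => ?_
  rw [Subsingleton.elim i k, Subsingleton.elim j k, mul_comm]

/-- Dropping the terms that touch a site changes the Hamiltonian by at most `J`. If 2J < γ, the
remainder still has a unique ground state by `IsGapped.perturb`; yet it commutes with all local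
operators at that site, which is impossible by `not_isGapped_of_commute` if the site carries a mode
or a nontrivial spin. If no site does, the basis has at most one element. -/
theorem gap_le_of_interaction {J R γ e : ℝ} {kmax : ℕ} {Φ : Finset (Site L) → Λ.Op} {Ψ : Λ.Hilb}
    (hγ : 0 < γ) (hΦ : IsInteraction Λ J R kmax Φ) (hΨ : IsGapped (hamiltonian₀ Φ) γ e Ψ) :
    γ ≤ 2 * J ∨ Subsingleton Λ.Basis := by
  classical
  by_contra! hcon
  obtain ⟨hJ, hns⟩ := hcon
  have hsa : IsSelfAdjoint (hamiltonian₀ Φ) := isSelfAdjoint_sum (R := Λ.Op) _ fun Z _ => hΦ.selfAdjoint Z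
  have key : ∀ (s : Site L) {ι : Type} [Fintype ι] (c d : ι → Λ.Op),
      (∀ i, ∀ Z, s ∉ Z → Commute (Φ Z) (d i)) → (∀ i, d i * d i = 0) → ∑ i, c i * d i = 1 → False := by
    intro s ι _ c d hd hd2 hone
    set K : Λ.Op := ∑ Z with s ∉ Z, Φ Z with hK
    have hKsa : IsSelfAdjoint K := isSelfAdjoint_sum (R := Λ.Op) _ fun Z _ => hΦ.selfAdjoint Z
    have hKn : ‖K - hamiltonian₀ Φ‖ ≤ J := by
      have h1 : hamiltonian₀ Φ = (∑ Z with s ∈ Z, Φ Z) + K :=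
        (Finset.sum_filter_add_sum_filter_not _ _ _).symm
      rw [h1, sub_add_cancel_right, norm_neg]
      exact (norm_sum_le _ _).trans (hΦ.strength s)
    have : Nontrivial Λ.Hilb := ⟨Ψ, 0, by rintro rfl; simpa using hΨ.norm_eq⟩
    obtain ⟨e', φ, hφ⟩ := exists_isGround hKsa
    refine not_isGapped_of_commute (fun i => ?_) hd2 hone (by linarith)
      (hΨ.perturb hγ hsa hKsa hφ hKn (by linarith))
    exact Commute.sum_left _ _ _ fun Z hZ => hd i Z (Finset.mem_filter.1 hZ).2
  by_cases hm : Nonempty (Fin Λ.numModes)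
  · obtain ⟨j⟩ := hm
    have hcomm : ∀ b : Bool, ∀ Z, Λ.modeSite j ∉ Z → Commute (Φ Z)
        (if b then Λ.annihilate j else star (Λ.annihilate j)) := by
      intro b Z hZ
      refine (Lattice.commute_fermionOps_evenAlg (X := {Λ.modeSite j})
        (Finset.disjoint_singleton_left.2 hZ) ⟨j, Finset.mem_singleton_self _, ?_⟩ (hΦ.mem Z)).symm
      cases b <;> simp
    have hsq : ∀ b : Bool, (if b then Λ.annihilate j else star (Λ.annihilate j)) *
        (if b then Λ.annihilate j else star (Λ.annihilate j)) = 0 := by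
      intro b
      cases b
      · simp only [Bool.false_eq_true, if_false, ← star_mul, Lattice.annihilate_mul_self]
        exact star_zero Λ.Op
      · simp [Lattice.annihilate_mul_self]
    -- The two summands are a a† and a† a, whose sum is 1 by the anticommutation relation.
    refine key (Λ.modeSite j) (fun b : Bool => if b then Λ.annihilate j else star (Λ.annihilate j))
      (fun b : Bool => if !b then Λ.annihilate j else star (Λ.annihilate j)) 
      (fun b => hcomm (!b)) (fun b => hsq (!b)) ?_
    simpa using Lattice.annihilate_create j
  · have hs : ∃ s, Nontrivial (Fin (Λ.spinDim s)) := by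
      by_contra! hs
      have h1 : Subsingleton (Fin Λ.numModes) := ⟨fun i => (hm ⟨i⟩).elim⟩
      have h2 : IsEmpty (Fin Λ.numModes) := not_nonempty_iff.1 hm
      exact (not_subsingleton_iff_nontrivial.2 hns) inferInstance
    obtain ⟨s, hs⟩ := hs
    let T := (t : ({s} : Finset (Site L))) → Fin (Λ.spinDim t)
    have hT : Nontrivial T := by
      have : Nontrivial (Fin (Λ.spinDim (⟨s, Finset.mem_singleton_self s⟩ :
        ({s} : Finset (Site L))))) := hs
      have hne : ∀ t : ({s} : Finset (Site L)), Nonempty (Fin (Λ.spinDim t)) := by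
        rintro ⟨t, ht⟩
        obtain rfl := Finset.mem_singleton.1 ht
        exact inferInstance
      exact Pi.nontrivial_at ⟨s, Finset.mem_singleton_self s⟩
    -- With f(t) ≠ t the matrix units |f(t)⟩⟨t| have square zero, and ∑ₜ |t⟩⟨f(t)| · |f(t)⟩⟨t| = 1.
    choose f hf using fun t : T => exists_ne t
    have hcomm : ∀ (M : Matrix T T ℂ) Z, s ∉ Z → Commute (Φ Z) (Λ.spinOp {s} M) := fun M Z hZ =>
      (Lattice.commute_spinOp_evenAlg (Finset.disjoint_singleton_left.2 hZ) M (hΦ.mem Z)).symm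
    have hz : Λ.spinOp {s} (0 : Matrix T T ℂ) = 0 := by
      have := Lattice.spinOp_sum (Λ := Λ) (∅ : Finset ℕ) {s} (fun _ => 0)
      simpa using this.symm
    refine key s (fun t : T => Λ.spinOp {s} (Matrix.single t (f t) 1))
      (fun t : T => Λ.spinOp {s} (Matrix.single (f t) t 1)) (fun t => hcomm _)
      (fun t => ?_) ?_
    · rw [Lattice.spinOp_mul, Matrix.single_mul_single_of_ne _ _ _ _ (hf t).symm, hz]
    · simp_rw [Lattice.spinOp_mul, Matrix.single_mul_single_same, mul_one]
      rw [Lattice.spinOp_sum, Matrix.sum_single_one, Lattice.spinOp_one]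

end

noncomputable section

/-! ### Conjugation with a unitary group -/

section Conj

variable {𝔸 : Type*} [CStarAlgebra 𝔸]

/-- `e^{itK} A e^{-itK}` in a C⋆-algebra. -/
def unitaryConj (K : 𝔸) (t : ℝ) (A : 𝔸) : 𝔸 :=
  NormedSpace.exp ((Complex.I * t) • K) * A * NormedSpace.exp (-(Complex.I * t) • K)

variable {K A B : 𝔸} {t : ℝ}

theorem exp_mem_unitary (hK : IsSelfAdjoint K) (t : ℝ) :
    NormedSpace.exp ((Complex.I * t) • K) ∈ unitary 𝔸 := by
  have h : IsSelfAdjoint (t • K) := (IsSelfAdjoint.all t).smul hK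
  have h1 := (selfAdjoint.expUnitary ⟨t • K, h⟩).2
  rw [selfAdjoint.expUnitary_coe] at h1
  simpa [mul_smul] using h1

theorem star_exp_smul (hK : IsSelfAdjoint K) (t : ℝ) :
    star (NormedSpace.exp ((Complex.I * t) • K)) = NormedSpace.exp (-(Complex.I * t) • K) := by
  rw [NormedSpace.star_exp, star_smul, hK.star_eq]
  simp

theorem star_exp_neg_smul (hK : IsSelfAdjoint K) (t : ℝ) :
    star (NormedSpace.exp (-(Complex.I * t) • K)) = NormedSpace.exp ((Complex.I * t) • K) := by
  rw [← star_exp_smul hK, star_star]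

theorem norm_unitaryConj (hK : IsSelfAdjoint K) (t : ℝ) (A : 𝔸) : ‖unitaryConj K t A‖ = ‖A‖ := by
  unfold unitaryConj
  rw [← star_exp_smul hK, CStarRing.norm_mul_mem_unitary _ (Unitary.star_mem (exp_mem_unitary hK t)),
    CStarRing.norm_mem_unitary_mul _ (exp_mem_unitary hK t)]

theorem isSelfAdjoint_unitaryConj (hK : IsSelfAdjoint K) (t : ℝ) (hA : IsSelfAdjoint A) :
    IsSelfAdjoint (unitaryConj K t A) := by
  unfold unitaryConj
  rw [IsSelfAdjoint, star_mul, star_mul, star_exp_smul hK, star_exp_neg_smul hK, hA.star_eq,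
    mul_assoc]

theorem unitaryConj_zero (K A : 𝔸) : unitaryConj K 0 A = A := by
  simp [unitaryConj]

theorem unitaryConj_sum {ι : Type*} (s : Finset ι) (A : ι → 𝔸) (K : 𝔸) (t : ℝ) :
    unitaryConj K t (∑ i ∈ s, A i) = ∑ i ∈ s, unitaryConj K t (A i) := by
  simp [unitaryConj, Finset.mul_sum, Finset.sum_mul]

theorem unitaryConj_zero_right (K : 𝔸) (t : ℝ) : unitaryConj K t 0 = 0 := by
  simp [unitaryConj]

theorem exp_mul_exp_neg (K : 𝔸) (c : ℂ) :
    NormedSpace.exp (c • K) * NormedSpace.exp (-c • K) = 1 := by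
  let _ : NormedAlgebra ℚ 𝔸 := NormedAlgebra.restrictScalars ℚ ℂ 𝔸
  rw [← NormedSpace.exp_add_of_commute
    (((Commute.refl K).smul_left c).smul_right (-c))]
  simp

theorem unitaryConj_of_commute (h : Commute A K) (t : ℝ) : unitaryConj K t A = A := by
  unfold unitaryConj
  have h1 : Commute A (NormedSpace.exp ((Complex.I * t) • K)) := (h.smul_right _).exp_right
  rw [← h1.eq, mul_assoc, exp_mul_exp_neg, mul_one]

theorem commute_unitaryConj (hK : Commute B K) (hA : Commute B A) (t : ℝ) :
    Commute B (unitaryConj K t A) :=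
  (((hK.smul_right _).exp_right).mul_right hA).mul_right (hK.smul_right _).exp_right

theorem hasDerivAt_unitaryConj (K A : 𝔸) (t : ℝ) :
    HasDerivAt (fun t => unitaryConj K t A)
      (unitaryConj K t (Complex.I • (K * A - A * K))) t := by
  have h1 : ∀ t : ℝ, (Complex.I * t) • K = t • (Complex.I • K) := fun t => by
    rw [← Complex.coe_smul, smul_smul, mul_comm]
  have h2 : ∀ t : ℝ, (-(Complex.I * t)) • K = t • (-(Complex.I • K)) := fun t => by
    rw [neg_smul, h1, smul_neg]
  have d1 := hasDerivAt_exp_smul_const (𝕂 := ℝ) (Complex.I • K) t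
  have d2 := hasDerivAt_exp_smul_const' (𝕂 := ℝ) (-(Complex.I • K)) t
  have d3 := (d1.mul_const A).mul d2
  unfold unitaryConj
  simp only [h1, h2]
  refine d3.congr_deriv ?_
  simp only [smul_sub, mul_sub, sub_mul, neg_mul, mul_neg, smul_mul_assoc, mul_smul_comm, mul_assoc]
  abel

theorem continuous_unitaryConj (K A : 𝔸) : Continuous fun t => unitaryConj K t A :=
  continuous_iff_continuousAt.2 fun t => (hasDerivAt_unitaryConj K A t).continuousAt

theorem continuous_unitaryConj_prod (t : ℝ) :
    Continuous fun p : 𝔸 × 𝔸 => unitaryConj p.1 t p.2 := by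
  let _ : NormedAlgebra ℚ 𝔸 := NormedAlgebra.restrictScalars ℚ ℂ 𝔸
  have h := NormedSpace.exp_continuous (𝔸 := 𝔸)
  unfold unitaryConj
  exact ((h.comp (by fun_prop)).mul continuous_snd).mul (h.comp (by fun_prop))

theorem norm_unitaryConj_sub_le (hK : IsSelfAdjoint K) (t : ℝ) (A : 𝔸) :
    ‖unitaryConj K t A - A‖ ≤ |t| * ‖K * A - A * K‖ := by
  have h := Convex.norm_image_sub_le_of_norm_hasDerivWithin_le (𝕜 := ℝ)
    (f := fun t => unitaryConj K t A) (s := Set.univ) (x := 0) (y := t) (C := ‖K * A - A * K‖)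
    (fun x _ => (hasDerivAt_unitaryConj K A x).hasDerivWithinAt)
    (fun x _ => by rw [norm_unitaryConj hK, norm_smul, Complex.norm_I, one_mul]) convex_univ
    (Set.mem_univ _) (Set.mem_univ _)
  simp only [unitaryConj_zero, sub_zero, Real.norm_eq_abs] at h
  rwa [mul_comm]

theorem isSelfAdjoint_I_smul_commutator (hA : IsSelfAdjoint A) (hB : IsSelfAdjoint B) :
    IsSelfAdjoint (Complex.I • (A * B - B * A)) := by
  rw [IsSelfAdjoint, star_smul, star_sub, star_mul, star_mul, hA.star_eq, hB.star_eq]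
  simp only [Complex.star_def, Complex.conj_I, neg_smul, ← smul_neg, neg_sub]

/-- The commutator with an operator with spectrum in `[0, n]`. -/
theorem norm_commutator_le {q : 𝔸} (hq : IsSelfAdjoint q) {n : ℝ}
    (hspec : ∀ z ∈ spectrum ℂ q, ∃ k : ℝ, 0 ≤ k ∧ k ≤ n ∧ z = k) (hn : 0 ≤ n) (A : 𝔸) :
    ‖q * A - A * q‖ ≤ n * ‖A‖ := by
  -- Subtracting the scalar n/2 does not change the commutator and centres the spectrum, so the norm
  -- of the shifted operator is at most n/2. This yields the factor `n` instead of 2n.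
  have h1 : IsSelfAdjoint (q - algebraMap ℂ 𝔸 ((n / 2 : ℝ) : ℂ)) := by
    refine hq.sub ?_
    rw [IsSelfAdjoint, ← algebraMap_star_comm]
    simp
  have h2 : ‖q - algebraMap ℂ 𝔸 ((n / 2 : ℝ) : ℂ)‖ ≤ n / 2 := by
    have h3 := h1.spectralRadius_eq_nnnorm
    have h4 : spectralRadius ℂ (q - algebraMap ℂ 𝔸 ((n / 2 : ℝ) : ℂ)) ≤
        ((n / 2).toNNReal : ENNReal) := by
      refine iSup₂_le fun z hz => ?_
      rw [← spectrum.sub_singleton_eq] at hz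
      obtain ⟨w, hw, _, rfl, rfl⟩ := hz
      obtain ⟨k, hk0, hkn, rfl⟩ := hspec w hw
      rw [ENNReal.coe_le_coe, ← NNReal.coe_le_coe, coe_nnnorm, Real.coe_toNNReal _ (by positivity)]
      simp only
      rw [← Complex.ofReal_sub, Complex.norm_real, Real.norm_eq_abs, abs_le]
      constructor <;> linarith
    rw [h3, ENNReal.coe_le_coe, ← NNReal.coe_le_coe, coe_nnnorm,
      Real.coe_toNNReal _ (by positivity)] at h4
    exact h4
  have h5 : q * A - A * q = (q - algebraMap ℂ 𝔸 ((n / 2 : ℝ) : ℂ)) * A -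
      A * (q - algebraMap ℂ 𝔸 ((n / 2 : ℝ) : ℂ)) := by
    rw [sub_mul, mul_sub, Algebra.commutes]
    abel
  rw [h5]
  refine (norm_sub_le _ _).trans ?_
  have h6 := norm_mul_le (q - algebraMap ℂ 𝔸 ((n / 2 : ℝ) : ℂ)) A
  have h7 := norm_mul_le A (q - algebraMap ℂ 𝔸 ((n / 2 : ℝ) : ℂ))
  nlinarith [norm_nonneg A]

end Conj

/-- The exponential acts on eigenvectors. -/
theorem exp_smul_apply_of_eigen {E : Type*} [NormedAddCommGroup E] [InnerProductSpace ℂ E]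
    [CompleteSpace E] {K : E →L[ℂ] E} {v : E} {μ : ℂ} (h : K v = μ • v) (c : ℂ) :
    NormedSpace.exp (c • K) v = Complex.exp (c * μ) • v := by
  let _ : NormedAlgebra ℚ (E →L[ℂ] E) := NormedAlgebra.restrictScalars ℚ ℂ _
  have hpow : ∀ n : ℕ, ((c • K) ^ n) v = (c * μ) ^ n • v := by
    intro n
    induction n with
    | zero => simp
    | succ n ih =>
      rw [pow_succ, mul_apply_eq_comp, smul_apply, h, map_smul, map_smul, ih, smul_smul, smul_smul,
        pow_succ]
      congr 1
      ring
  have h1 := NormedSpace.exp_series_hasSum_exp' (𝕂 := ℂ) (c • K)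
  have h2 := (ContinuousLinearMap.apply ℂ E v).hasSum h1
  have h3 := (NormedSpace.exp_series_hasSum_exp' (𝕂 := ℂ) (c * μ)).smul_const v
  rw [← Complex.exp_eq_exp_ℂ] at h3
  refine h2.unique (h3.congr_fun fun n => ?_)
  simp [hpow, smul_smul]

end

noncomputable section

/-! ### Charges and charge averages -/

variable {L : ℕ} {Λ : Lattice L} {q : Site L → Λ.Op} {qmax : ℕ}

/-- `A` commutes with the charges outside of `Z` and with the total charge. -/
structure IsLocalSymmetric (q : Site L → Λ.Op) (Z : Finset (Site L)) (A : Λ.Op) : Prop where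
  comm : ∀ s, s ∉ Z → Commute (q s) A
  symm : Commute (totalCharge q) A

namespace IsCharge

variable (hq : IsCharge Λ qmax q)

include hq

theorem commute (s t : Site L) : Commute (q s) (q t) := by
  by_cases h : s = t
  · rw [h]
  · exact Lattice.commute_of_disjoint (by simpa using h) (hq.mem s) (hq.mem t)

theorem commute_sum (s : Site L) (W : Finset (Site L)) : Commute (q s) (∑ t ∈ W, q t) :=
  Commute.sum_right _ _ _ fun t _ => hq.commute s t

theorem commute_sum_sum (V W : Finset (Site L)) : Commute (∑ s ∈ V, q s) (∑ t ∈ W, q t) :=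
  Commute.sum_left _ _ _ fun s _ => hq.commute_sum s W

theorem isSelfAdjoint_sum (W : Finset (Site L)) : IsSelfAdjoint (∑ t ∈ W, q t) :=
  _root_.isSelfAdjoint_sum (R := Λ.Op) _ fun t _ => hq.selfAdjoint t

theorem norm_commutator_le (s : Site L) (A : Λ.Op) : ‖q s * A - A * q s‖ ≤ qmax * ‖A‖ := by
  refine QuantumHall.norm_commutator_le (hq.selfAdjoint s) (fun z hz => ?_) (by positivity) A
  obtain ⟨k, hk, rfl⟩ := hq.spec s hz
  exact ⟨k, by positivity, by exact_mod_cast hk, by simp⟩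

/-- The eigenvalues of a charge are integers, so the exponential is 1 on an eigenbasis. This makes
averaging over one period of 2π a projection onto symmetric operators. -/
theorem exp_two_pi_charge (s : Site L) :
    NormedSpace.exp ((Complex.I * (2 * Real.pi : ℝ)) • q s) = 1 := by
  have hsym : (q s : Λ.Hilb →ₗ[ℂ] Λ.Hilb).IsSymmetric := (hq.selfAdjoint s).isSymmetric
  have h1 : ((NormedSpace.exp ((Complex.I * (2 * Real.pi : ℝ)) • q s) : Λ.Op) :
      Λ.Hilb →ₗ[ℂ] Λ.Hilb) = (1 : Λ.Op) := by
    refine (hsym.eigenvectorBasis rfl).toBasis.ext fun i => ?_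
    have h2 : q s (hsym.eigenvectorBasis rfl i) =
        ((hsym.eigenvalues rfl i : ℝ) : ℂ) • hsym.eigenvectorBasis rfl i :=
      hsym.apply_eigenvectorBasis rfl i
    have h3 : ((hsym.eigenvalues rfl i : ℝ) : ℂ) ∈ spectrum ℂ (q s) := by
      have h4 := (hsym.hasEigenvalue_eigenvalues rfl i).mem_spectrum
      rwa [← ContinuousLinearMap.spectrum_eq] at h4
    obtain ⟨k, -, hk⟩ := hq.spec s h3
    rw [OrthonormalBasis.coe_toBasis]
    change NormedSpace.exp ((Complex.I * (2 * Real.pi : ℝ)) • q s) _ = _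
    rw [exp_smul_apply_of_eigen h2, hk, show Complex.I * ((2 * Real.pi : ℝ) : ℂ) * k =
      k * (2 * Real.pi * Complex.I) by push_cast; ring, Complex.exp_nat_mul_two_pi_mul_I, one_smul]
    rfl
  exact ContinuousLinearMap.coe_injective h1

theorem exp_two_pi_sum (W : Finset (Site L)) :
    NormedSpace.exp ((Complex.I * (2 * Real.pi : ℝ)) • ∑ s ∈ W, q s) = 1 := by
  classical
  let _ : NormedAlgebra ℚ Λ.Op := NormedAlgebra.restrictScalars ℚ ℂ _
  induction W using Finset.induction_on with
  | empty => simp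
  | insert s W hs ih =>
    rw [Finset.sum_insert hs, smul_add, NormedSpace.exp_add_of_commute
      (((hq.commute_sum s W).smul_left _).smul_right _), ih, hq.exp_two_pi_charge, one_mul]

end IsCharge

end

noncomputable section

/-! ### Averages over the unitary group of a charge -/

section Average

variable {𝔸 : Type*} [CStarAlgebra 𝔸] {K A B : 𝔸}

/-- The average of `e^{iθK} A e^{-iθK}` over `0 ≤ θ ≤ 2π`. -/
def unitaryAverage (K A : 𝔸) : 𝔸 :=
  ((2 * Real.pi)⁻¹ : ℂ) • ∫ θ in (0 : ℝ)..(2 * Real.pi), unitaryConj K θ A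

theorem intervalIntegrable_unitaryConj (K A : 𝔸) (a b : ℝ) :
    IntervalIntegrable (fun θ => unitaryConj K θ A) MeasureTheory.volume a b :=
  (continuous_unitaryConj K A).intervalIntegrable a b

theorem isSelfAdjoint_unitaryAverage (hK : IsSelfAdjoint K) (hA : IsSelfAdjoint A) :
    IsSelfAdjoint (unitaryAverage K A) := by
  have h := (starL' ℝ : 𝔸 ≃L[ℝ] 𝔸).toContinuousLinearMap.intervalIntegral_comp_comm
    (intervalIntegrable_unitaryConj K A 0 (2 * Real.pi))
  have h1 : ∀ θ, (starL' ℝ : 𝔸 ≃L[ℝ] 𝔸).toContinuousLinearMap (unitaryConj K θ A) =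
      unitaryConj K θ A := fun θ => isSelfAdjoint_unitaryConj hK θ hA
  simp_rw [h1] at h
  have h2 : star (∫ θ in (0 : ℝ)..(2 * Real.pi), unitaryConj K θ A) =
      ∫ θ in (0 : ℝ)..(2 * Real.pi), unitaryConj K θ A := h.symm
  rw [IsSelfAdjoint, unitaryAverage, star_smul, h2]
  simp

theorem norm_unitaryAverage_le (hK : IsSelfAdjoint K) (A : 𝔸) : ‖unitaryAverage K A‖ ≤ ‖A‖ := by
  have h := intervalIntegral.norm_integral_le_of_norm_le_const (a := 0) (b := 2 * Real.pi)
    (f := fun θ => unitaryConj K θ A) (C := ‖A‖) fun θ _ => (norm_unitaryConj hK θ A).le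
  have hpi := Real.pi_pos
  rw [sub_zero, abs_of_pos (by positivity)] at h
  rw [unitaryAverage, norm_smul]
  have h2 : ‖((2 * Real.pi)⁻¹ : ℂ)‖ = (2 * Real.pi)⁻¹ := by
    rw [norm_inv, norm_mul, Complex.norm_real, Real.norm_of_nonneg hpi.le]
    simp
  rw [h2, inv_mul_le_iff₀ (by positivity)]
  linarith

theorem commute_integral {f : ℝ → 𝔸} {a b : ℝ} (hf : IntervalIntegrable f MeasureTheory.volume a b)
    (h : ∀ θ, Commute B (f θ)) : Commute B (∫ θ in a..b, f θ) := by
  have h1 := (ContinuousLinearMap.mul ℝ 𝔸 B).intervalIntegral_comp_comm hf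
  have h2 := ((ContinuousLinearMap.mul ℝ 𝔸).flip B).intervalIntegral_comp_comm hf
  simp only [ContinuousLinearMap.mul_apply', ContinuousLinearMap.flip_apply] at h1 h2
  rw [Commute, SemiconjBy, ← h1, ← h2]
  exact intervalIntegral.integral_congr fun θ _ => h θ

theorem commute_unitaryAverage (hK : Commute B K) (hA : Commute B A) :
    Commute B (unitaryAverage K A) :=
  (commute_integral (intervalIntegrable_unitaryConj K A _ _)
    fun θ => commute_unitaryConj hK hA θ).smul_right _

theorem unitaryConj_commutator (K A : 𝔸) (t : ℝ) :
    unitaryConj K t (Complex.I • (K * A - A * K)) =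
      Complex.I • (K * unitaryConj K t A - unitaryConj K t A * K) := by
  have h1 : Commute K (NormedSpace.exp ((Complex.I * t) • K)) :=
    ((Commute.refl K).smul_right _).exp_right
  have h2 : Commute K (NormedSpace.exp (-(Complex.I * t) • K)) :=
    ((Commute.refl K).smul_right _).exp_right
  unfold unitaryConj
  rw [mul_smul_comm, smul_mul_assoc, mul_sub, sub_mul, ← mul_assoc, ← mul_assoc, ← mul_assoc,
    ← mul_assoc, h1.eq]
  congr 2
  rw [mul_assoc _ K, mul_assoc _ _ K, h2.eq]

/-- The commutator with the average is, up to a factor, the integral over a full period of the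
derivative of the conjugated operator, hence zero. -/
theorem commute_unitaryAverage_self (hK : NormedSpace.exp ((Complex.I * (2 * Real.pi : ℝ)) • K) = 1)
    (A : 𝔸) : Commute K (unitaryAverage K A) := by
  have hK' : NormedSpace.exp (-(Complex.I * (2 * Real.pi : ℝ)) • K) = 1 := by
    have := exp_mul_exp_neg K (Complex.I * (2 * Real.pi : ℝ))
    rwa [hK, one_mul] at this
  have hint := intervalIntegrable_unitaryConj K A 0 (2 * Real.pi)
  have h1 := intervalIntegral.integral_eq_sub_of_hasDerivAt (a := 0) (b := 2 * Real.pi)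
    (fun t _ => hasDerivAt_unitaryConj K A t) ((continuous_unitaryConj K _).intervalIntegrable _ _)
  have h2 : unitaryConj K (2 * Real.pi) A = A := by
    rw [unitaryConj, hK, hK', one_mul, mul_one]
  rw [h2, unitaryConj_zero, sub_self] at h1
  have h3 := ((ContinuousLinearMap.mul ℝ 𝔸 K -
    (ContinuousLinearMap.mul ℝ 𝔸).flip K)).intervalIntegral_comp_comm hint
  simp only [sub_apply, ContinuousLinearMap.mul_apply',
    ContinuousLinearMap.flip_apply] at h3
  simp_rw [unitaryConj_commutator] at h1
  rw [intervalIntegral.integral_smul, h3, smul_eq_zero] at h1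
  have h4 := h1.resolve_left Complex.I_ne_zero
  refine Commute.smul_right ?_ _
  exact sub_eq_zero.1 h4

theorem unitaryAverage_sum {ι : Type*} (s : Finset ι) (A : ι → 𝔸) (K : 𝔸) :
    ∑ i ∈ s, unitaryAverage K (A i) = unitaryAverage K (∑ i ∈ s, A i) := by
  unfold unitaryAverage
  rw [← Finset.smul_sum, ← intervalIntegral.integral_finsetSum
    fun i _ => intervalIntegrable_unitaryConj K (A i) _ _]
  simp_rw [unitaryConj_sum]

theorem unitaryAverage_of_commute (h : Commute A K) : unitaryAverage K A = A := by
  unfold unitaryAverage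
  simp_rw [unitaryConj_of_commute h]
  rw [intervalIntegral.integral_const, sub_zero, ← Complex.coe_smul, smul_smul]
  have : (Real.pi : ℂ) ≠ 0 := by exact_mod_cast Real.pi_ne_zero
  push_cast
  rw [inv_mul_cancel₀ (by simp [this]), one_smul]

end Average

/-! ### Twists and their derivatives -/

section Twist

variable {𝔸 : Type*} [CStarAlgebra 𝔸] {K A B : 𝔸}

/-- Conjugation with `e^{ixK}` if `n` holds. -/
def twist (n : Prop) (K : 𝔸) (x : ℝ) (A : 𝔸) : 𝔸 := open Classical in if n then unitaryConj K x A else A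

/-- The derivative of `twist` in the angle. -/
def twistDeriv (n : Prop) (K : 𝔸) (x : ℝ) (A : 𝔸) : 𝔸 :=
  open Classical in if n then unitaryConj K x (Complex.I • (K * A - A * K)) else 0

theorem hasDerivAt_twist (n : Prop) (K A : 𝔸) (x : ℝ) :
    HasDerivAt (fun x => twist n K x A) (twistDeriv n K x A) x := by
  unfold twist twistDeriv
  split_ifs
  · exact hasDerivAt_unitaryConj K A x
  · exact hasDerivAt_const _ _

theorem hasDerivAt_twist_comp (n : Prop) (K : 𝔸) (x : ℝ) {f : ℝ → 𝔸} {f' : 𝔸} {y : ℝ}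
    (hf : HasDerivAt f f' y) : HasDerivAt (fun y => twist n K x (f y)) (twist n K x f') y := by
  unfold twist
  split_ifs
  · exact (hf.const_mul _).mul_const _
  · exact hf

theorem norm_twist (hK : IsSelfAdjoint K) (n : Prop) (x : ℝ) (A : 𝔸) : ‖twist n K x A‖ = ‖A‖ := by
  unfold twist
  split_ifs
  · exact norm_unitaryConj hK x A
  · rfl

theorem twist_zero (n : Prop) (K A : 𝔸) : twist n K 0 A = A := by
  unfold twist
  split_ifs
  · exact unitaryConj_zero K A
  · rfl

theorem norm_twist_sub_le (hK : IsSelfAdjoint K) (n : Prop) (x : ℝ) (A : 𝔸) :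
    ‖twist n K x A - A‖ ≤ |x| * ‖K * A - A * K‖ := by
  unfold twist
  split_ifs
  · exact norm_unitaryConj_sub_le hK x A
  · rw [sub_self, norm_zero]; positivity

theorem norm_twistDeriv_le (hK : IsSelfAdjoint K) (n : Prop) (x : ℝ) (A : 𝔸) :
    ‖twistDeriv n K x A‖ ≤ ‖K * A - A * K‖ := by
  unfold twistDeriv
  split_ifs
  · rw [norm_unitaryConj hK, norm_smul, Complex.norm_I, one_mul]
  · rw [norm_zero]; positivity

theorem isSelfAdjoint_twist (hK : IsSelfAdjoint K) (n : Prop) (x : ℝ) (hA : IsSelfAdjoint A) :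
    IsSelfAdjoint (twist n K x A) := by
  unfold twist
  split_ifs
  · exact isSelfAdjoint_unitaryConj hK x hA
  · exact hA

theorem isSelfAdjoint_twistDeriv (hK : IsSelfAdjoint K) (n : Prop) (x : ℝ) (hA : IsSelfAdjoint A) :
    IsSelfAdjoint (twistDeriv n K x A) := by
  unfold twistDeriv
  split_ifs
  · exact isSelfAdjoint_unitaryConj hK x (isSelfAdjoint_I_smul_commutator hK hA)
  · exact IsSelfAdjoint.zero _

theorem continuous_twistDeriv (n : Prop) (K A : 𝔸) : Continuous fun x => twistDeriv n K x A := by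
  unfold twistDeriv
  split_ifs
  · exact continuous_unitaryConj K _
  · exact continuous_const

theorem continuous_twist_comp (n : Prop) (K : 𝔸) (x : ℝ) {f : ℝ → 𝔸} (hf : Continuous f) :
    Continuous fun y => twist n K x (f y) := by
  unfold twist
  split_ifs
  · exact (continuous_const.mul hf).mul continuous_const
  · exact hf

theorem twistDeriv_of_commute (n : Prop) (x : ℝ) (h : Commute K A) : twistDeriv n K x A = 0 := by
  unfold twistDeriv
  split_ifs
  · rw [h.eq, sub_self, smul_zero, unitaryConj_zero_right]
  · rfl

theorem twist_zero_right (n : Prop) (K : 𝔸) (x : ℝ) : twist n K x 0 = 0 := by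
  unfold twist
  split_ifs
  · exact unitaryConj_zero_right K x
  · rfl

end Twist

end

noncomputable section

/-! ### Local symmetric operators -/

variable {L : ℕ} {Λ : Lattice L} {q : Site L → Λ.Op} {qmax : ℕ} {Z W : Finset (Site L)} {A B : Λ.Op}

theorem commute_I_smul_commutator {𝔸 : Type*} [CStarAlgebra 𝔸] {B K A : 𝔸} (hK : Commute B K)
    (hA : Commute B A) : Commute B (Complex.I • (K * A - A * K)) :=
  ((hK.mul_right hA).sub_right (hA.mul_right hK)).smul_right _

theorem norm_I_smul_commutator_sub {𝔸 : Type*} [CStarAlgebra 𝔸] (K A B : 𝔸) :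
    ‖Complex.I • (K * A - A * K) - Complex.I • (K * B - B * K)‖ =
      ‖K * (A - B) - (A - B) * K‖ := by
  rw [← smul_sub, norm_smul, Complex.norm_I, one_mul]
  congr 1
  noncomm_ring

/-- The support `Z` meets both `W` and its complement. -/
def Crosses (W Z : Finset (Site L)) : Prop := (∃ s ∈ Z, s ∈ W) ∧ ∃ t ∈ Z, t ∉ W

namespace IsLocalSymmetric

theorem sub (hA : IsLocalSymmetric q Z A) (hB : IsLocalSymmetric q Z B) :
    IsLocalSymmetric q Z (A - B) :=
  ⟨fun s hs => (hA.comm s hs).sub_right (hB.comm s hs), hA.symm.sub_right hB.symm⟩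

theorem commutator (hA : IsLocalSymmetric q Z A) (hq : IsCharge Λ qmax q) (W : Finset (Site L)) :
    IsLocalSymmetric q Z (Complex.I • ((∑ s ∈ W, q s) * A - A * ∑ s ∈ W, q s)) :=
  ⟨fun s hs => commute_I_smul_commutator (hq.commute_sum s W) (hA.comm s hs),
    commute_I_smul_commutator (hq.commute_sum_sum _ W) hA.symm⟩

theorem unitaryConj (hA : IsLocalSymmetric q Z A) (hq : IsCharge Λ qmax q) (W : Finset (Site L))
    (x : ℝ) : IsLocalSymmetric q Z (unitaryConj (∑ s ∈ W, q s) x A) :=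
  ⟨fun s hs => commute_unitaryConj (hq.commute_sum s W) (hA.comm s hs) x,
    commute_unitaryConj (hq.commute_sum_sum _ W) hA.symm x⟩

theorem twist (hA : IsLocalSymmetric q Z A) (hq : IsCharge Λ qmax q) (n : Prop)
    (W : Finset (Site L)) (x : ℝ) : IsLocalSymmetric q Z (twist n (∑ s ∈ W, q s) x A) := by
  unfold QuantumHall.twist
  split_ifs
  · exact hA.unitaryConj hq W x
  · exact hA

theorem zero : IsLocalSymmetric q Z (0 : Λ.Op) :=
  ⟨fun _ _ => Commute.zero_right _, Commute.zero_right _⟩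

theorem twistDeriv (hA : IsLocalSymmetric q Z A) (hq : IsCharge Λ qmax q) (n : Prop)
    (W : Finset (Site L)) (x : ℝ) : IsLocalSymmetric q Z (twistDeriv n (∑ s ∈ W, q s) x A) := by
  unfold QuantumHall.twistDeriv
  split_ifs
  · exact (hA.commutator hq W).unitaryConj hq W x
  · exact zero

/-- If the support misses `W`, all charges in `W` commute with `A`. If it lies inside `W`, the
charge of `W` is the conserved total charge minus charges outside the support. -/
theorem commute_of_not_crosses (hA : IsLocalSymmetric q Z A) (h : ¬Crosses W Z) :
    Commute (∑ s ∈ W, q s) A := by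
  classical
  by_cases hW : ∃ s ∈ Z, s ∈ W
  · have hZ : ∀ t ∈ Z, t ∈ W := by
      intro t ht
      by_contra hne
      exact h ⟨hW, t, ht, hne⟩
    have h1 : ∑ s ∈ W, q s = totalCharge q - ∑ s ∈ Wᶜ, q s := by
      rw [totalCharge, ← Finset.sum_add_sum_compl W, add_sub_cancel_right]
    rw [h1]
    refine hA.symm.sub_left (Commute.sum_left _ _ _ fun s hs => hA.comm s fun hsZ => ?_)
    exact (Finset.mem_compl.1 hs) (hZ s hsZ)
  · push Not at hW
    exact Commute.sum_left _ _ _ fun s hs => hA.comm s fun hsZ => hW s hsZ hs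

/-- Only the charges inside the support contribute, at most `kmax` of them. -/
theorem norm_commutator_le (hA : IsLocalSymmetric q Z A) (hq : IsCharge Λ qmax q) {kmax : ℕ}
    (hZ : Z.card ≤ kmax) (W : Finset (Site L)) :
    ‖(∑ s ∈ W, q s) * A - A * ∑ s ∈ W, q s‖ ≤ kmax * qmax * ‖A‖ := by
  classical
  have h1 : (∑ s ∈ W, q s) * A - A * ∑ s ∈ W, q s = ∑ s ∈ W ∩ Z, (q s * A - A * q s) := by
    rw [Finset.sum_mul, Finset.mul_sum, ← Finset.sum_sub_distrib]
    symm
    refine Finset.sum_subset Finset.inter_subset_left fun s hs hs' => ?_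
    exact sub_eq_zero.2 (hA.comm s fun hsZ => hs' (Finset.mem_inter.2 ⟨hs, hsZ⟩))
  rw [h1]
  refine (norm_sum_le_of_le _ fun s _ => hq.norm_commutator_le s A).trans ?_
  rw [Finset.sum_const, nsmul_eq_mul]
  have h2 : (W ∩ Z).card ≤ kmax := (Finset.card_le_card Finset.inter_subset_right).trans hZ
  have h3 : ((W ∩ Z).card : ℝ) ≤ kmax := by exact_mod_cast h2
  rw [mul_assoc]
  gcongr

end IsLocalSymmetric

/-! ### The terms of the twisted Hamiltonian -/

section Terms

variable {X Y : Finset (Site L)} {nX nY : Prop} {kmax : ℕ}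

theorem norm_twistDeriv_twist_le (hq : IsCharge Λ qmax q) (hA : IsLocalSymmetric q Z A)
    (hZ : Z.card ≤ kmax) (x y : ℝ) :
    ‖twistDeriv nX (∑ s ∈ X, q s) x (twist nY (∑ s ∈ Y, q s) y A)‖ ≤ kmax * qmax * ‖A‖ := by
  refine (norm_twistDeriv_le (hq.isSelfAdjoint_sum X) _ _ _).trans ?_
  refine ((hA.twist hq nY Y y).norm_commutator_le hq hZ X).trans ?_
  rw [norm_twist (hq.isSelfAdjoint_sum Y)]

theorem norm_twist_twistDeriv_le (hq : IsCharge Λ qmax q) (hA : IsLocalSymmetric q Z A)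
    (hZ : Z.card ≤ kmax) (x y : ℝ) :
    ‖twist nX (∑ s ∈ X, q s) x (twistDeriv nY (∑ s ∈ Y, q s) y A)‖ ≤ kmax * qmax * ‖A‖ := by
  rw [norm_twist (hq.isSelfAdjoint_sum X)]
  exact (norm_twistDeriv_le (hq.isSelfAdjoint_sum Y) _ _ _).trans (hA.norm_commutator_le hq hZ Y)

theorem norm_twistDeriv_sub_zero_le (hq : IsCharge Λ qmax q) (hA : IsLocalSymmetric q Z A)
    (hZ : Z.card ≤ kmax) (x : ℝ) :
    ‖twistDeriv nX (∑ s ∈ X, q s) x A - twistDeriv nX (∑ s ∈ X, q s) 0 A‖ ≤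
      (kmax * qmax) ^ 2 * |x| * ‖A‖ := by
  unfold twistDeriv
  split_ifs
  · rw [unitaryConj_zero]
    refine (norm_unitaryConj_sub_le (hq.isSelfAdjoint_sum X) _ _).trans ?_
    have h1 := (hA.commutator hq X).norm_commutator_le hq hZ X
    have h2 := hA.norm_commutator_le hq hZ X
    rw [norm_smul, Complex.norm_I, one_mul] at h1
    calc |x| * _ ≤ |x| * (kmax * qmax * (kmax * qmax * ‖A‖)) := by
          gcongr
          exact h1.trans (by gcongr)
      _ = _ := by ring
  · rw [sub_self, norm_zero]; positivity

/-- The two angles are changed one after the other. Each change costs one more commutator with a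
charge, hence a second factor kmax·qmax. -/
theorem norm_twistDeriv_twist_sub_le (hq : IsCharge Λ qmax q) (hA : IsLocalSymmetric q Z A)
    (hZ : Z.card ≤ kmax) (x y : ℝ) :
    ‖twistDeriv nX (∑ s ∈ X, q s) x (twist nY (∑ s ∈ Y, q s) y A) -
      twistDeriv nX (∑ s ∈ X, q s) 0 (twist nY (∑ s ∈ Y, q s) 0 A)‖ ≤
      (kmax * qmax) ^ 2 * (|x| + |y|) * ‖A‖ := by
  have hB := hA.twist hq nY Y y
  have h1 := norm_twistDeriv_sub_zero_le (nX := nX) (X := X) hq hB hZ x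
  rw [norm_twist (hq.isSelfAdjoint_sum Y)] at h1
  have h2 : ‖twistDeriv nX (∑ s ∈ X, q s) 0 (twist nY (∑ s ∈ Y, q s) y A) -
      twistDeriv nX (∑ s ∈ X, q s) 0 (twist nY (∑ s ∈ Y, q s) 0 A)‖ ≤
      (kmax * qmax) ^ 2 * |y| * ‖A‖ := by
    have h3 := norm_twist_sub_le (hq.isSelfAdjoint_sum Y) nY y A
    have h4 := hA.norm_commutator_le hq hZ Y
    have h5 := (hB.sub hA).norm_commutator_le hq hZ X
    rw [twist_zero]
    unfold twistDeriv
    split_ifs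
    · rw [unitaryConj_zero, unitaryConj_zero, norm_I_smul_commutator_sub]
      calc _ ≤ kmax * qmax * (|y| * (kmax * qmax * ‖A‖)) := by
            refine h5.trans ?_
            gcongr
            exact h3.trans (by gcongr)
        _ = _ := by ring
    · rw [sub_self, norm_zero]; positivity
  calc _ ≤ _ := norm_sub_le_norm_sub_add_norm_sub _
          (twistDeriv nX (∑ s ∈ X, q s) 0 (twist nY (∑ s ∈ Y, q s) y A)) _
    _ ≤ _ := add_le_add h1 h2
    _ = _ := by ring

theorem norm_twist_twistDeriv_sub_le (hq : IsCharge Λ qmax q) (hA : IsLocalSymmetric q Z A)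
    (hZ : Z.card ≤ kmax) (x y : ℝ) :
    ‖twist nX (∑ s ∈ X, q s) x (twistDeriv nY (∑ s ∈ Y, q s) y A) -
      twist nX (∑ s ∈ X, q s) 0 (twistDeriv nY (∑ s ∈ Y, q s) 0 A)‖ ≤
      (kmax * qmax) ^ 2 * (|x| + |y|) * ‖A‖ := by
  have h1 := norm_twistDeriv_sub_zero_le (nX := nY) (X := Y) hq hA hZ y
  have h2 : ‖twist nX (∑ s ∈ X, q s) x (twistDeriv nY (∑ s ∈ Y, q s) y A) -
      twistDeriv nY (∑ s ∈ Y, q s) y A‖ ≤ (kmax * qmax) ^ 2 * |x| * ‖A‖ := by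
    refine (norm_twist_sub_le (hq.isSelfAdjoint_sum X) nX x _).trans ?_
    have h3 := (hA.twistDeriv hq nY Y y).norm_commutator_le hq hZ X
    have h4 := (norm_twistDeriv_le (hq.isSelfAdjoint_sum Y) nY y A).trans
      (hA.norm_commutator_le hq hZ Y)
    calc |x| * _ ≤ |x| * (kmax * qmax * (kmax * qmax * ‖A‖)) := by
          gcongr
          exact h3.trans (by gcongr)
      _ = _ := by ring
  rw [twist_zero]
  calc _ ≤ _ := norm_sub_le_norm_sub_add_norm_sub _ (twistDeriv nY (∑ s ∈ Y, q s) y A) _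
    _ ≤ _ := add_le_add h2 h1
    _ = _ := by ring

end Terms

/-! ### Counting the terms at the boundary of a half torus -/

/-- The half torus on which the coordinate `c` is at most `L / 2`. -/
def halfTorus (c : Site L → Fin L) : Finset (Site L) :=
  open Classical in Finset.univ.filter fun s => ((c s : ℕ) : ℝ) + 1 ≤ (L : ℝ) / 2

/-- A half torus has two boundary lines. A nonzero term that crosses one of them has range at most
`R`, so it contains a site of the half torus within ⌊R⌋ rows of a boundary. There are at most 2⌊R⌋L
such sites, and the terms through each have total norm at most `J`. -/
theorem sum_norm_crosses_le {J R : ℝ} {kmax : ℕ} {Φ : Finset (Site L) → Λ.Op}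
    (hΦ : IsInteraction Λ J R kmax Φ) (hJ : 0 ≤ J) (hR : 0 ≤ R) (c : Site L → Fin L)
    (hc : ∀ i, (Finset.univ.filter fun s => c s = i).card = L)
    (hd : ∀ s t, circDist L ((c s : ℕ) + 1) ((c t : ℕ) + 1) ≤ torusDist s t) :
    (open Classical in ∑ Z with Crosses (halfTorus c) Z, ‖Φ Z‖) ≤ 2 * R * L * J := by
  classical
  set m := ⌊R⌋₊ with hm
  -- The rows of the half torus next to its two boundaries, with indices counted from 0.
  set S : Finset (Fin L) := Finset.univ.filter fun i =>
    (i : ℕ) < m ∨ ((i : ℕ) < L / 2 ∧ L / 2 ≤ (i : ℕ) + m) with hS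
  have hScard : S.card ≤ 2 * m := by
    have h1 : S.map Fin.valEmbedding ⊆ Finset.range m ∪ Finset.Ico (L / 2 - m) (L / 2) := by
      intro i hi
      obtain ⟨j, hj, rfl⟩ := Finset.mem_map.1 hi
      have := (Finset.mem_filter.1 hj).2
      simp only [Fin.valEmbedding_apply, Finset.mem_union, Finset.mem_range, Finset.mem_Ico]
      omega
    calc S.card = (S.map Fin.valEmbedding).card := (Finset.card_map _).symm
      _ ≤ _ := Finset.card_le_card h1
      _ ≤ _ := Finset.card_union_le _ _
      _ ≤ 2 * m := by rw [Finset.card_range, Nat.card_Ico]; omega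
  -- For the index i from 0, the real condition i + 1 ≤ L/2 is i < ⌊L/2⌋, also for odd `L`.
  have hmem : ∀ s, s ∈ halfTorus c ↔ (c s : ℕ) < L / 2 := by
    intro s
    simp only [halfTorus, Finset.mem_filter, Finset.mem_univ, true_and]
    rw [le_div_iff₀ (by norm_num)]
    have : (((c s : ℕ) : ℝ) + 1) * 2 ≤ L ↔ ((c s : ℕ) + 1) * 2 ≤ L := by exact_mod_cast Iff.rfl
    rw [this]
    omega
  have hstrip : ∀ Z, Crosses (halfTorus c) Z → Φ Z ≠ 0 → ∃ s ∈ Z, c s ∈ S := by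
    rintro Z ⟨⟨s, hsZ, hs⟩, t, htZ, ht⟩ hne
    refine ⟨s, hsZ, ?_⟩
    rw [hmem] at hs ht
    have h1 : torusDist s t ≤ R := by
      by_contra hlt
      exact hne (hΦ.range Z ⟨s, hsZ, t, htZ, not_le.1 hlt⟩)
    have h2 := (hd s t).trans h1
    have hlt : (c s : ℕ) < c t := by omega
    have hlt' : ((c s : ℕ) : ℝ) < (c t : ℕ) := by exact_mod_cast hlt
    have ht2 := (c t).2
    rw [circDist, abs_of_nonpos (by linarith), min_le_iff] at h2
    simp only [hS, Finset.mem_filter, Finset.mem_univ, true_and]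
    rcases h2 with h2 | h2
    · have h3 : (((c t : ℕ) - (c s : ℕ) : ℕ) : ℝ) ≤ R := by
        rw [Nat.cast_sub hlt.le]; linarith
      have h4 := Nat.le_floor h3
      omega
    · have h3 : ((L + (c s : ℕ) - (c t : ℕ) : ℕ) : ℝ) ≤ R := by
        rw [Nat.cast_sub (by omega), Nat.cast_add]; linarith
      have h4 := Nat.le_floor h3
      omega
  calc ∑ Z with Crosses (halfTorus c) Z, ‖Φ Z‖
      ≤ ∑ Z with Crosses (halfTorus c) Z, ∑ s with c s ∈ S, if s ∈ Z then ‖Φ Z‖ else 0 := by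
        refine Finset.sum_le_sum fun Z hZ => ?_
        by_cases h0 : Φ Z = 0
        · rw [h0, norm_zero]; exact Finset.sum_nonneg fun s _ => by split_ifs <;> simp
        obtain ⟨s, hsZ, hs⟩ := hstrip Z (Finset.mem_filter.1 hZ).2 h0
        have h1 := Finset.single_le_sum (s := Finset.univ.filter fun s => c s ∈ S)
          (f := fun s => if s ∈ Z then ‖Φ Z‖ else 0) (fun s _ => by split_ifs <;> simp)
          (Finset.mem_filter.2 ⟨Finset.mem_univ s, hs⟩)
        simpa only [if_pos hsZ] using h1
    _ ≤ ∑ Z, ∑ s with c s ∈ S, if s ∈ Z then ‖Φ Z‖ else 0 :=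
        Finset.sum_le_sum_of_subset_of_nonneg (Finset.filter_subset _ _) fun Z _ _ =>
          Finset.sum_nonneg fun s _ => by split_ifs <;> simp
    _ = ∑ s with c s ∈ S, ∑ Z with s ∈ Z, ‖Φ Z‖ := by
        rw [Finset.sum_comm]
        exact Finset.sum_congr rfl fun s _ => (Finset.sum_filter _ _).symm
    _ ≤ ∑ s with c s ∈ S, J := Finset.sum_le_sum fun s _ => by convert hΦ.strength s
    _ = ((Finset.univ.filter fun s => c s ∈ S).card : ℝ) * J := by
        rw [Finset.sum_const, nsmul_eq_mul]
    _ ≤ (2 * m * L : ℕ) * J := by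
        gcongr
        rw [Finset.card_eq_sum_card_fiberwise (f := c) (t := S)
          (fun s hs => by simpa using hs)]
        calc _ ≤ ∑ _i ∈ S, L := Finset.sum_le_sum fun i _ => by
                refine (Finset.card_le_card fun s hs => ?_).trans (hc i).le
                simp only [Finset.mem_filter] at hs ⊢
                exact ⟨Finset.mem_univ _, hs.2⟩
          _ = S.card * L := by rw [Finset.sum_const, smul_eq_mul]
          _ ≤ 2 * m * L := by gcongr
    _ ≤ 2 * R * L * J := by
        push_cast
        have := Nat.floor_le hR
        gcongr

theorem card_filter_fst (i : Fin L) :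
    (Finset.univ.filter fun s : Site L => s.1 = i).card = L := by
  have : (Finset.univ.filter fun s : Site L => s.1 = i) = {i} ×ˢ Finset.univ := by
    ext s; simp only [Finset.mem_filter, Finset.mem_product, Finset.mem_univ, Finset.mem_singleton,
      true_and, and_true]
  rw [this]; simp

theorem card_filter_snd (i : Fin L) :
    (Finset.univ.filter fun s : Site L => s.2 = i).card = L := by
  have : (Finset.univ.filter fun s : Site L => s.2 = i) = Finset.univ ×ˢ {i} := by
    ext s; simp only [Finset.mem_filter, Finset.mem_product, Finset.mem_univ, Finset.mem_singleton,
      true_and]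
  rw [this]; simp

theorem circDist_nonneg (i j : Fin L) : 0 ≤ circDist L ((i : ℕ) + 1) ((j : ℕ) + 1) := by
  have h1 : ((i : ℕ) : ℝ) < L := by exact_mod_cast i.2
  have h2 : ((j : ℕ) : ℝ) < L := by exact_mod_cast j.2
  have h3 : (0 : ℝ) ≤ (i : ℕ) := by positivity
  have h4 : (0 : ℝ) ≤ (j : ℕ) := by positivity
  refine le_min (abs_nonneg _) (sub_nonneg.2 (abs_le.2 ⟨?_, ?_⟩)) <;> linarith

end

noncomputable section

/-! ### The two-parameter family of twisted Hamiltonians -/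

/-- A two-parameter family of self-adjoint elements, with partial derivatives of norm at most `K`
that vary at the origin at a rate of at most `κ`. -/
structure IsFluxFamily {𝔸 : Type*} [CStarAlgebra 𝔸] (H HX HY : ℝ → ℝ → 𝔸) (K κ : ℝ) : Prop where
  selfAdjoint : ∀ x y, IsSelfAdjoint (H x y)
  selfAdjointX : ∀ x y, IsSelfAdjoint (HX x y)
  selfAdjointY : ∀ x y, IsSelfAdjoint (HY x y)
  derivX : ∀ x y, HasDerivAt (fun x => H x y) (HX x y) x
  derivY : ∀ x y, HasDerivAt (fun y => H x y) (HY x y) y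
  contX : ∀ y, Continuous fun x => HX x y
  contY : ∀ x, Continuous fun y => HY x y
  normX : ∀ x y, ‖HX x y‖ ≤ K
  normY : ∀ x y, ‖HY x y‖ ≤ K
  lipX : ∀ x y, ‖HX x y - HX 0 0‖ ≤ κ * (|x| + |y|)
  lipY : ∀ x y, ‖HY x y - HY 0 0‖ ≤ κ * (|x| + |y|)

variable {L : ℕ} {Λ : Lattice L} {q : Site L → Λ.Op} {qmax kmax : ℕ} {J R : ℝ}
  {Φ : Finset (Site L) → Λ.Op}

theorem isLocalSymmetric_symmetrized (hq : IsCharge Λ qmax q) (hΦ : IsInteraction Λ J R kmax Φ)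
    (Z : Finset (Site L)) : IsLocalSymmetric q Z (symmetrized q Φ Z) := by
  refine ⟨fun s hs => ?_, commute_unitaryAverage_self (hq.exp_two_pi_sum _) (Φ Z)⟩
  exact commute_unitaryAverage (hq.commute_sum s Finset.univ)
    (Lattice.commute_of_disjoint (by simpa using hs) (hq.mem s) (hΦ.mem Z))

theorem isSelfAdjoint_symmetrized (hq : IsCharge Λ qmax q) (hΦ : IsInteraction Λ J R kmax Φ)
    (Z : Finset (Site L)) : IsSelfAdjoint (symmetrized q Φ Z) :=
  isSelfAdjoint_unitaryAverage (hq.isSelfAdjoint_sum _) (hΦ.selfAdjoint Z)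

theorem norm_symmetrized_le (hq : IsCharge Λ qmax q) (Φ : Finset (Site L) → Λ.Op)
    (Z : Finset (Site L)) : ‖symmetrized q Φ Z‖ ≤ ‖Φ Z‖ :=
  norm_unitaryAverage_le (hq.isSelfAdjoint_sum _) (Φ Z)

theorem sum_symmetrized (h : Commute (totalCharge q) (hamiltonian₀ Φ)) :
    ∑ Z, symmetrized q Φ Z = hamiltonian₀ Φ :=
  (unitaryAverage_sum Finset.univ Φ (totalCharge q)).trans (unitaryAverage_of_commute h.symm)

/-- The branches for the second boundary conjugate by the exponential of 0 and thus disappear. -/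
theorem twisted_zero_eq (R : ℝ) (q : Site L → Λ.Op) (Φ : Finset (Site L) → Λ.Op) (x y : ℝ)
    (Z : Finset (Site L)) :
    twisted R q Φ x 0 y 0 Z =
      twist (∃ s ∈ Z, circDist L (xCoord s) 1 < R) (∑ s ∈ halfTorus Prod.fst, q s) x
        (twist (∃ s ∈ Z, circDist L (yCoord s) 1 < R) (∑ s ∈ halfTorus Prod.snd, q s) y
          (symmetrized q Φ Z)) := by
  have h0 : ∀ K A : Λ.Op, conjExp K (-0) A = A := fun K A => by
    rw [neg_zero]; exact unitaryConj_zero K A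
  have hy : twistedY R q Φ y 0 Z =
      twist (∃ s ∈ Z, circDist L (yCoord s) 1 < R) (∑ s ∈ halfTorus Prod.snd, q s) y
          (symmetrized q Φ Z) := by
    unfold twistedY twist
    simp only [h0, ite_self]
    split_ifs <;> rfl
  unfold twisted
  simp only [h0, ite_self, hy]
  generalize twist (𝔸 := Λ.Op) (∃ s ∈ Z, circDist L (yCoord s) 1 < R) _ y _ = B
  unfold twist
  split_ifs <;> rfl

/-- The terms that do not commute with the charge of a half torus contribute at most `2RLJ`. -/
theorem norm_sum_le_of_norm_le_crosses (hΦ : IsInteraction Λ J R kmax Φ) (hJ : 0 ≤ J) (hR : 0 ≤ R)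
    (c : Site L → Fin L) (hc : ∀ i, (Finset.univ.filter fun s => c s = i).card = L)
    (hd : ∀ s t, circDist L ((c s : ℕ) + 1) ((c t : ℕ) + 1) ≤ torusDist s t)
    {A : Finset (Site L) → Λ.Op} {b : ℝ} (hb : 0 ≤ b)
    (h0 : ∀ Z, ¬Crosses (halfTorus c) Z → A Z = 0) (hA : ∀ Z, ‖A Z‖ ≤ b * ‖Φ Z‖) :
    ‖∑ Z, A Z‖ ≤ b * (2 * R * L * J) := by
  classical
  calc ‖∑ Z, A Z‖ = ‖∑ Z with Crosses (halfTorus c) Z, A Z‖ := by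
        congr 1
        symm
        refine Finset.sum_subset (Finset.filter_subset _ _) fun Z _ hZ => h0 Z fun h => ?_
        exact hZ (Finset.mem_filter.2 ⟨Finset.mem_univ _, h⟩)
    _ ≤ ∑ Z with Crosses (halfTorus c) Z, b * ‖Φ Z‖ := norm_sum_le_of_le _ fun Z _ => hA Z
    _ = b * ∑ Z with Crosses (halfTorus c) Z, ‖Φ Z‖ := (Finset.mul_sum _ _ _).symm
    _ ≤ _ := mul_le_mul_of_nonneg_left (by convert sum_norm_crosses_le hΦ hJ hR c hc hd) hb

theorem circDist_fst_le (s t : Site L) :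
    circDist L ((s.1 : ℕ) + 1) ((t.1 : ℕ) + 1) ≤ torusDist s t :=
  le_add_of_nonneg_right (circDist_nonneg s.2 t.2)

theorem circDist_snd_le (s t : Site L) :
    circDist L ((s.2 : ℕ) + 1) ((t.2 : ℕ) + 1) ≤ torusDist s t :=
  le_add_of_nonneg_left (circDist_nonneg s.1 t.1)

/-- A derivative of a term is a commutator with the charge of a half torus; it vanishes unless the
support crosses the boundary, and otherwise costs a factor kmax·qmax. The crossing terms have total
norm at most 2RLJ. The last clause records that nothing varies if all operators commute. -/
theorem exists_isFluxFamily (hJ : 0 ≤ J) (hR : 0 ≤ R) (hq : IsCharge Λ qmax q)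
    (hΦ : IsInteraction Λ J R kmax Φ) :
    ∃ HX HY, IsFluxFamily (fluxHamiltonian R q Φ) HX HY (kmax * qmax * (2 * R * L * J))
        ((kmax * qmax) ^ 2 * (2 * R * L * J)) ∧
      (Subsingleton Λ.Basis → ∀ x y, HX x y = 0 ∧ HY x y = 0) := by
  have hsymm := isLocalSymmetric_symmetrized hq hΦ
  have hsa := isSelfAdjoint_symmetrized hq hΦ
  have hX := hq.isSelfAdjoint_sum (halfTorus Prod.fst)
  have hY := hq.isSelfAdjoint_sum (halfTorus Prod.snd)
  have hzero : ∀ Z, Φ Z = 0 → symmetrized q Φ Z = 0 := fun Z hZ => by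
    have := norm_symmetrized_le hq Φ Z
    rw [hZ, norm_zero] at this
    exact norm_le_zero_iff.1 this
  have hcard : ∀ Z, Φ Z ≠ 0 → Z.card ≤ kmax := fun Z hZ => by
    by_contra h
    exact hZ (hΦ.body Z (not_le.1 h))
  set nX : Finset (Site L) → Prop := fun Z => ∃ s ∈ Z, circDist L (xCoord s) 1 < R
  set nY : Finset (Site L) → Prop := fun Z => ∃ s ∈ Z, circDist L (yCoord s) 1 < R
  set QX := ∑ s ∈ halfTorus Prod.fst, q s with hQX
  set QY := ∑ s ∈ halfTorus Prod.snd, q s with hQY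
  have hH : ∀ x y, fluxHamiltonian R q Φ x y =
      ∑ Z, twist (nX Z) QX x (twist (nY Z) QY y (symmetrized q Φ Z)) := fun x y =>
    Finset.sum_congr rfl fun Z _ => twisted_zero_eq R q Φ x y Z
  have hX0 : ∀ Z x y, ¬Crosses (halfTorus Prod.fst) Z →
      twistDeriv (nX Z) QX x (twist (nY Z) QY y (symmetrized q Φ Z)) = 0 := fun Z x y hZ =>
    twistDeriv_of_commute _ _ (((hsymm Z).twist hq _ _ y).commute_of_not_crosses hZ)
  have hY0 : ∀ Z x y, ¬Crosses (halfTorus Prod.snd) Z →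
      twist (nX Z) QX x (twistDeriv (nY Z) QY y (symmetrized q Φ Z)) = 0 := fun Z x y hZ => by
    rw [twistDeriv_of_commute _ _ ((hsymm Z).commute_of_not_crosses hZ), twist_zero_right]
  have hΦ0 : ∀ Z x y, Φ Z = 0 →
      twistDeriv (nX Z) QX x (twist (nY Z) QY y (symmetrized q Φ Z)) = 0 ∧
      twist (nX Z) QX x (twistDeriv (nY Z) QY y (symmetrized q Φ Z)) = 0 := fun Z x y hZ => by
    rw [hzero Z hZ, twist_zero_right, twistDeriv_of_commute _ _ (Commute.zero_right _),
      twistDeriv_of_commute _ _ (Commute.zero_right _), twist_zero_right]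
    exact ⟨rfl, rfl⟩
  refine ⟨fun x y => ∑ Z, twistDeriv (nX Z) QX x (twist (nY Z) QY y (symmetrized q Φ Z)),
    fun x y => ∑ Z, twist (nX Z) QX x (twistDeriv (nY Z) QY y (symmetrized q Φ Z)), ?_, ?_⟩
  · constructor
    · intro x y
      rw [hH]
      exact isSelfAdjoint_sum (R := Λ.Op) _ fun Z _ =>
        isSelfAdjoint_twist hX _ _ (isSelfAdjoint_twist hY _ _ (hsa Z))
    · intro x y
      exact isSelfAdjoint_sum (R := Λ.Op) _ fun Z _ =>
        isSelfAdjoint_twistDeriv hX _ _ (isSelfAdjoint_twist hY _ _ (hsa Z))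
    · intro x y
      exact isSelfAdjoint_sum (R := Λ.Op) _ fun Z _ =>
        isSelfAdjoint_twist hX _ _ (isSelfAdjoint_twistDeriv hY _ _ (hsa Z))
    · intro x y
      simp_rw [hH]
      exact HasDerivAt.fun_sum fun Z _ => hasDerivAt_twist _ _ _ _
    · intro x y
      simp_rw [hH]
      exact HasDerivAt.fun_sum fun Z _ => hasDerivAt_twist_comp _ _ _ (hasDerivAt_twist _ _ _ _)
    · intro y
      exact continuous_finsetSum _ fun Z _ => continuous_twistDeriv _ _ _
    · intro x
      exact continuous_finsetSum _ fun Z _ =>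
        continuous_twist_comp _ _ _ (continuous_twistDeriv _ _ _)
    · intro x y
      refine norm_sum_le_of_norm_le_crosses hΦ hJ hR Prod.fst card_filter_fst circDist_fst_le
        (by positivity) (fun Z => hX0 Z x y) fun Z => ?_
      by_cases hZ : Φ Z = 0
      · rw [(hΦ0 Z x y hZ).1, norm_zero]; positivity
      · refine (norm_twistDeriv_twist_le hq (hsymm Z) (hcard Z hZ) x y).trans ?_
        have := norm_symmetrized_le hq Φ Z
        gcongr
    · intro x y
      refine norm_sum_le_of_norm_le_crosses hΦ hJ hR Prod.snd card_filter_snd circDist_snd_le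
        (by positivity) (fun Z => hY0 Z x y) fun Z => ?_
      by_cases hZ : Φ Z = 0
      · rw [(hΦ0 Z x y hZ).2, norm_zero]; positivity
      · refine (norm_twist_twistDeriv_le hq (hsymm Z) (hcard Z hZ) x y).trans ?_
        have := norm_symmetrized_le hq Φ Z
        gcongr
    · intro x y
      rw [← Finset.sum_sub_distrib, mul_right_comm]
      refine norm_sum_le_of_norm_le_crosses hΦ hJ hR Prod.fst card_filter_fst circDist_fst_le
        (by positivity) (fun Z hZ => by rw [hX0 Z x y hZ, hX0 Z 0 0 hZ, sub_zero]) fun Z => ?_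
      by_cases hZ : Φ Z = 0
      · rw [(hΦ0 Z x y hZ).1, (hΦ0 Z 0 0 hZ).1, sub_zero, norm_zero]; positivity
      · refine (norm_twistDeriv_twist_sub_le hq (hsymm Z) (hcard Z hZ) x y).trans ?_
        have := norm_symmetrized_le hq Φ Z
        gcongr
    · intro x y
      rw [← Finset.sum_sub_distrib, mul_right_comm]
      refine norm_sum_le_of_norm_le_crosses hΦ hJ hR Prod.snd card_filter_snd circDist_snd_le
        (by positivity) (fun Z hZ => by rw [hY0 Z x y hZ, hY0 Z 0 0 hZ, sub_zero]) fun Z => ?_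
      by_cases hZ : Φ Z = 0
      · rw [(hΦ0 Z x y hZ).2, (hΦ0 Z 0 0 hZ).2, sub_zero, norm_zero]; positivity
      · refine (norm_twist_twistDeriv_sub_le hq (hsymm Z) (hcard Z hZ) x y).trans ?_
        have := norm_symmetrized_le hq Φ Z
        gcongr
  · intro hsub x y
    constructor
    · exact Finset.sum_eq_zero fun Z _ => twistDeriv_of_commute _ _ (commute_of_subsingleton _ _)
    · refine Finset.sum_eq_zero fun Z _ => ?_
      rw [twistDeriv_of_commute _ _ (commute_of_subsingleton _ _), twist_zero_right]

theorem fluxHamiltonian_zero (h : Commute (totalCharge q) (hamiltonian₀ Φ)) :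
    fluxHamiltonian R q Φ 0 0 = hamiltonian₀ Φ := by
  rw [← sum_symmetrized h]
  refine Finset.sum_congr rfl fun Z _ => ?_
  rw [twisted_zero_eq, twist_zero, twist_zero]

end

noncomputable section

/-! ### Linear differential equations with bounded continuous coefficients -/

section Dyson

variable {𝔸 : Type*} [NormedRing 𝔸] [NormedAlgebra ℝ 𝔸] [CompleteSpace 𝔸] {B : ℝ → 𝔸} {C : ℝ}

/-- The terms of the Dyson series of `U' = B U`, `U(0) = 1`. -/
def dyson (B : ℝ → 𝔸) : ℕ → ℝ → 𝔸
  | 0 => fun _ => 1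
  | n + 1 => fun t => ∫ s in (0 : ℝ)..t, B s * dyson B n s

theorem hasDerivAt_dyson_succ_of_continuous (hB : Continuous B) {n : ℕ}
    (h : Continuous (dyson B n)) (t : ℝ) :
    HasDerivAt (dyson B (n + 1)) (B t * dyson B n t) t :=
  ((hB.mul h).integral_hasStrictDerivAt 0 t).hasDerivAt

theorem continuous_dyson (hB : Continuous B) : ∀ n, Continuous (dyson B n)
  | 0 => continuous_const
  | n + 1 => continuous_iff_continuousAt.2 fun t =>
      (hasDerivAt_dyson_succ_of_continuous hB (continuous_dyson hB n) t).continuousAt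

theorem hasDerivAt_dyson_succ (hB : Continuous B) (n : ℕ) (t : ℝ) :
    HasDerivAt (dyson B (n + 1)) (B t * dyson B n t) t :=
  hasDerivAt_dyson_succ_of_continuous hB (continuous_dyson hB n) t

theorem norm_dyson_le (hB : Continuous B) (hC : ∀ t, ‖B t‖ ≤ C) (n : ℕ) (t : ℝ) :
    ‖dyson B n t‖ ≤ ‖(1 : 𝔸)‖ * ((C * |t|) ^ n / n.factorial) := by
  have hC0 : 0 ≤ C := (norm_nonneg _).trans (hC 0)
  induction n generalizing t with
  | zero => simp [dyson]
  | succ n ih =>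
    have h1 : ∀ s, ‖B s * dyson B n s‖ ≤ ‖(1 : 𝔸)‖ * (C ^ (n + 1) / n.factorial) * |s - 0| ^ n :=
      fun s => by
        refine (norm_mul_le _ _).trans ((mul_le_mul (hC s) (ih s) (norm_nonneg _) hC0).trans ?_)
        rw [sub_zero, mul_pow, pow_succ]
        exact le_of_eq (by ring)
    calc ‖dyson B (n + 1) t‖ ≤ ∫ s in Set.uIoc 0 t, ‖B s * dyson B n s‖ :=
          intervalIntegral.norm_integral_le_integral_norm_uIoc
      _ ≤ ∫ s in Set.uIoc 0 t, ‖(1 : 𝔸)‖ * (C ^ (n + 1) / n.factorial) * |s - 0| ^ n := by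
          refine MeasureTheory.setIntegral_mono ?_ ?_ h1
          · exact ((hB.mul (continuous_dyson hB n)).norm.integrableOn_uIcc (a := 0) (b := t)).mono_set
              Set.uIoc_subset_uIcc
          · exact (Continuous.integrableOn_uIcc (by fun_prop) (a := 0) (b := t)).mono_set
              Set.uIoc_subset_uIcc
      _ = _ := by
          rw [MeasureTheory.integral_const_mul, integral_pow_abs_sub_uIoc, sub_zero, mul_pow,
            Nat.factorial_succ]
          push_cast
          field_simp

/-- The Dyson series converges like an exponential series and may be differentiated term by term on
balls. -/
theorem exists_linear_ode_solution (hB : Continuous B) (hC : ∀ t, ‖B t‖ ≤ C) :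
    ∃ U : ℝ → 𝔸, U 0 = 1 ∧ ∀ t, HasDerivAt U (B t * U t) t := by
  have hC0 : 0 ≤ C := (norm_nonneg _).trans (hC 0)
  have hsum : ∀ t, Summable fun n => dyson B n t := fun t =>
    Summable.of_norm_bounded ((Real.summable_pow_div_factorial (C * |t|)).mul_left ‖(1 : 𝔸)‖)
      fun n => norm_dyson_le hB hC n t
  have h0 : ∀ n, n ≠ 0 → dyson B n 0 = 0 := fun n hn => by
    obtain ⟨m, rfl⟩ := Nat.exists_eq_succ_of_ne_zero hn
    exact intervalIntegral.integral_same
  refine ⟨fun t => ∑' n, dyson B n t, (tsum_eq_single 0 h0).trans rfl, fun t => ?_⟩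
  -- The derivative of term n + 1 is `B` times term n and the zeroth term is constant, so the
  -- differentiated series sums to B U.
  set g' : ℕ → ℝ → 𝔸 := fun n t => n.casesOn 0 fun m => B t * dyson B m t
  set u : ℕ → ℝ := fun n =>
    n.casesOn 0 fun m => C * (‖(1 : 𝔸)‖ * ((C * (|t| + 1)) ^ m / m.factorial))
  have hu : Summable u := (summable_nat_add_iff 1).1
    (((Real.summable_pow_div_factorial (C * (|t| + 1))).mul_left ‖(1 : 𝔸)‖).mul_left C)
  have hg : ∀ n y, HasDerivAt (dyson B n) (g' n y) y := by
    rintro (_ | n) y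
    · exact hasDerivAt_const _ _
    · exact hasDerivAt_dyson_succ hB n y
  have key := hasDerivAt_tsum_of_isPreconnected (t := Metric.ball (0 : ℝ) (|t| + 1)) hu
    Metric.isOpen_ball (convex_ball _ _).isPreconnected (fun n y _ => hg n y)
    (fun n y hy => ?_) (Metric.mem_ball_self (by positivity)) (hsum 0)
    (show t ∈ Metric.ball (0 : ℝ) (|t| + 1) by simp)
  · have hg's : Summable fun n => g' n t :=
      (summable_nat_add_iff 1).1 ((hsum t).mul_left (B t))
    rw [hg's.tsum_eq_zero_add] at key
    rw [← (hsum t).tsum_mul_left]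
    exact (zero_add (∑' n, B t * dyson B n t)) ▸ key
  · rw [Metric.mem_ball, dist_zero_right, Real.norm_eq_abs] at hy
    rcases n with _ | n
    · exact (norm_zero).le
    · refine (norm_mul_le _ _).trans (mul_le_mul (hC y) ?_ (norm_nonneg _) hC0)
      exact (norm_dyson_le hB hC n y).trans (by gcongr)

end Dyson

/-- The `epsilon` in the definition is meaningful once some solution exists; uniqueness plays no
role. -/
theorem isPropagator_propagator {L : ℕ} {Λ : Lattice L} {D : ℝ → Λ.Op} {C : ℝ} (hD : Continuous D)
    (hC : ∀ t, ‖D t‖ ≤ C) : IsPropagator D (propagator D) := by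
  apply Classical.epsilon_spec (p := IsPropagator D)
  let _ : NormedAlgebra ℝ Λ.Op := NormedAlgebra.restrictScalars ℝ ℂ _
  obtain ⟨U, hU0, hU⟩ := exists_linear_ode_solution (B := fun t => Complex.I • D t) (C := C)
    (hD.const_smul Complex.I) (fun t => by rw [norm_smul, Complex.norm_I, one_mul]; exact hC t)
  refine ⟨U, hU0, fun t => ?_⟩
  have := hU t
  rwa [smul_mul_assoc] at this

end

noncomputable section

/-! ### The quasi-adiabatic generator -/

section Generator

open MeasureTheory

variable {𝔸 : Type*} [CStarAlgebra 𝔸] {W : ℝ → ℝ} {K A : 𝔸}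

/-- The integral `∫ W(t) e^{itK} A e^{-itK} dt`. -/
def filterConj (W : ℝ → ℝ) (K A : 𝔸) : 𝔸 := ∫ t : ℝ, (W t : ℂ) • unitaryConj K t A

theorem aestronglyMeasurable_filterConj (hW : Integrable W) (K A : 𝔸) :
    AEStronglyMeasurable fun t : ℝ => (W t : ℂ) • unitaryConj K t A :=
  hW.ofReal.aestronglyMeasurable.smul (continuous_unitaryConj K A).aestronglyMeasurable

theorem norm_smul_unitaryConj (hK : IsSelfAdjoint K) (A : 𝔸) (t : ℝ) :
    ‖(W t : ℂ) • unitaryConj K t A‖ = |W t| * ‖A‖ := by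
  rw [norm_smul, norm_unitaryConj hK, Complex.norm_real, Real.norm_eq_abs]

theorem integrable_filterConj (hW : Integrable W) (hK : IsSelfAdjoint K) (A : 𝔸) :
    Integrable fun t : ℝ => (W t : ℂ) • unitaryConj K t A :=
  (hW.abs.mul_const ‖A‖).mono' (aestronglyMeasurable_filterConj hW K A)
    (Filter.Eventually.of_forall fun t => (norm_smul_unitaryConj hK A t).le)

theorem isSelfAdjoint_filterConj (hW : Integrable W) (hK : IsSelfAdjoint K)
    (hA : IsSelfAdjoint A) : IsSelfAdjoint (filterConj W K A) := by
  have h := (starL' ℝ : 𝔸 ≃L[ℝ] 𝔸).toContinuousLinearMap.integral_comp_comm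
    (integrable_filterConj hW hK A)
  have h1 : ∀ t, (starL' ℝ : 𝔸 ≃L[ℝ] 𝔸).toContinuousLinearMap ((W t : ℂ) • unitaryConj K t A) =
      (W t : ℂ) • unitaryConj K t A := fun t => by
    change star ((W t : ℂ) • unitaryConj K t A) = _
    rw [star_smul, (isSelfAdjoint_unitaryConj hK t hA).star_eq]
    simp
  simp_rw [h1] at h
  exact h.symm

theorem norm_filterConj_le (hK : IsSelfAdjoint K) (A : 𝔸) :
    ‖filterConj W K A‖ ≤ (∫ t, |W t|) * ‖A‖ := by
  refine (norm_integral_le_integral_norm _).trans (le_of_eq ?_)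
  simp_rw [norm_smul_unitaryConj hK]
  exact integral_mul_const _ _

theorem continuous_filterConj {X : Type*} [TopologicalSpace X] [FirstCountableTopology X]
    (hW : Integrable W) {K A : X → 𝔸} (hK : Continuous K) (hA : Continuous A)
    (hsa : ∀ x, IsSelfAdjoint (K x)) {C : ℝ} (hC : ∀ x, ‖A x‖ ≤ C) :
    Continuous fun x => filterConj W (K x) (A x) := by
  refine continuous_of_dominated (bound := fun t => |W t| * C)
    (fun x => aestronglyMeasurable_filterConj hW _ _)
    (fun x => Filter.Eventually.of_forall fun t => ?_) (hW.abs.mul_const C)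
    (Filter.Eventually.of_forall fun t => ?_)
  · rw [norm_smul_unitaryConj (hsa x)]
    exact mul_le_mul_of_nonneg_left (hC x) (abs_nonneg _)
  · exact ((continuous_unitaryConj_prod t).comp (hK.prodMk hA)).const_smul _

end Generator

/-- The value of `W` at 0 is irrelevant for the integral. The vanishing at frequency 0 is what makes
the quasi-adiabatic velocity orthogonal to the ground state. -/
theorem IsFilter.integral_eq_zero {Δ : ℝ} {W : ℝ → ℝ} (hW : IsFilter Δ W) : ∫ t, W t = 0 := by
  have h1 : ∫ t, W (-t) = ∫ t, W t := MeasureTheory.integral_neg_eq_self W _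
  have h2 : ∫ t, W (-t) = ∫ t, -W t := by
    refine MeasureTheory.integral_congr_ae ?_
    have : ∀ᵐ t : ℝ, t ≠ 0 := MeasureTheory.Measure.ae_ne _ 0
    filter_upwards [this] with t ht using hW.odd t ht
  rw [MeasureTheory.integral_neg] at h2
  linarith

/-! ### The quasi-adiabatic generator induces the velocity of ground states -/

section Velocity

variable {E : Type*} [NormedAddCommGroup E] [InnerProductSpace ℂ E]
  [CompleteSpace E] {H A : E →L[ℂ] E} {e g Δ : ℝ} {φ : E} {W : ℝ → ℝ}

theorem inner_unitaryConj_apply (hH : IsSelfAdjoint H) {lam : ℝ} {v : E}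
    (hv : H v = (lam : ℂ) • v) (hφ : H φ = (e : ℂ) • φ) (t : ℝ) :
    ⟪v, unitaryConj H t A φ⟫_ℂ =
      Complex.exp (Complex.I * ((lam - e : ℝ) : ℂ) * t) * ⟪v, A φ⟫_ℂ := by
  have h1 : ⟪v, NormedSpace.exp ((Complex.I * t) • H) (A φ)⟫_ℂ =
      Complex.exp (Complex.I * lam * t) * ⟪v, A φ⟫_ℂ := by
    rw [← ContinuousLinearMap.adjoint_inner_left, ← ContinuousLinearMap.star_eq_adjoint,
      star_exp_smul hH, exp_smul_apply_of_eigen hv, inner_smul_left, ← Complex.exp_conj]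
    congr 2
    simp
    ring
  have h2 : unitaryConj H t A φ = NormedSpace.exp ((Complex.I * t) • H)
      (A (NormedSpace.exp (-(Complex.I * t) • H) φ)) := rfl
  rw [h2, exp_smul_apply_of_eigen hφ, map_smul, map_smul, inner_smul_right, h1, ← mul_assoc,
    ← Complex.exp_add]
  congr 2
  push_cast
  ring

/-- In an eigenbasis of `H` conjugation multiplies matrix elements by phases, so the filter acts
through its Fourier transform at the energy difference. -/
theorem inner_filterConj_apply (hW : MeasureTheory.Integrable W) (hH : IsSelfAdjoint H) {lam : ℝ}
    {v : E} (hv : H v = (lam : ℂ) • v) (hφ : H φ = (e : ℂ) • φ) :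
    ⟪v, filterConj W H A φ⟫_ℂ =
      (∫ t : ℝ, (W t : ℂ) * Complex.exp (Complex.I * ((lam - e : ℝ) : ℂ) * t)) * ⟪v, A φ⟫_ℂ := by
  have h := ((innerSL ℂ v).comp (ContinuousLinearMap.apply ℂ E φ)).integral_comp_comm
    (integrable_filterConj hW hH A)
  have h1 : ∀ t, ((innerSL ℂ v).comp (ContinuousLinearMap.apply ℂ E φ))
      ((W t : ℂ) • unitaryConj H t A) =
      (W t : ℂ) * Complex.exp (Complex.I * ((lam - e : ℝ) : ℂ) * t) * ⟪v, A φ⟫_ℂ := fun t => by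
    rw [map_smul, smul_eq_mul, mul_assoc, ← inner_unitaryConj_apply hH hv hφ t]
    rfl
  simp_rw [h1] at h
  rw [← MeasureTheory.integral_mul_const, h]
  rfl

/-- The coefficient of the excited state at energy λ is i · i/(λ - e) = -1/(λ - e) times the matrix
element of `A`, as in first order perturbation theory. The gap guarantees λ - e ≥ Δ, where the
Fourier property holds. -/
theorem isVelocity_filterConj [FiniteDimensional ℂ E] (hW : IsFilter Δ W) (hΔ : Δ ≤ g) (hg : 0 < g)
    (hH : IsSelfAdjoint H) (hφ : IsGapped H g e φ) :
    IsVelocity H e φ A (Complex.I • filterConj W H A φ) := by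
  have hzero : ∀ v, H v = (e : ℂ) • v → ⟪v, filterConj W H A φ⟫_ℂ = 0 := fun v hv => by
    rw [inner_filterConj_apply hW.integrable hH hv hφ.eigen, sub_self]
    simp only [Complex.ofReal_zero, mul_zero, zero_mul, Complex.exp_zero, mul_one]
    rw [integral_complex_ofReal, hW.integral_eq_zero, Complex.ofReal_zero, zero_mul]
  refine ⟨by rw [inner_smul_right, hzero φ hφ.eigen, mul_zero], ?_⟩
  have hsym : (H : E →ₗ[ℂ] E).IsSymmetric := hH.isSymmetric
  refine (hsym.eigenvectorBasis rfl).repr.injective (PiLp.ext fun i => ?_)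
  rw [OrthonormalBasis.repr_apply_apply, OrthonormalBasis.repr_apply_apply]
  set v := hsym.eigenvectorBasis rfl i
  set lam := hsym.eigenvalues rfl i with hlam
  have hv : H v = (lam : ℂ) • v := hsym.apply_eigenvectorBasis rfl i
  have hmove : ∀ w, ⟪v, H w⟫_ℂ = lam * ⟪v, w⟫_ℂ := fun w => by
    rw [show ⟪v, H w⟫_ℂ = ⟪H v, w⟫_ℂ from (hsym v w).symm, hv, inner_smul_left, Complex.conj_ofReal]
  rw [inner_sub_right, hmove, inner_smul_right, inner_smul_right, inner_smul_right, inner_neg_right, inner_sub_right,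
    inner_smul_right _ φ]
  have hnorm : ‖v‖ = 1 := (hsym.eigenvectorBasis rfl).orthonormal.1 i
  -- Eigenvectors at the ground state energy are multiples of `φ`; for these both sides vanish.
  by_cases he : lam = e
  · have h1 := hφ.eq_smul hg (he ▸ hv)
    rw [he, hzero v (he ▸ hv)]
    have h2 : ⟪v, A φ⟫_ℂ = ⟪v, φ⟫_ℂ * ⟪φ, A φ⟫_ℂ := by
      conv_lhs => rw [h1]
      rw [inner_smul_left, inner_conj_symm]
    rw [h2]; ring
  · have horth : ⟪v, φ⟫_ℂ = 0 := by
      have h1 := hmove φ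
      rw [hφ.eigen, inner_smul_right] at h1
      have h2 : ((lam : ℂ) - e) * ⟪v, φ⟫_ℂ = 0 := by rw [sub_mul, h1, sub_self]
      refine (mul_eq_zero.1 h2).resolve_left (sub_ne_zero.2 ?_)
      exact_mod_cast he
    have hgap := hφ.gap v (inner_eq_zero_symm.1 horth)
    rw [hmove, inner_self_eq_norm_sq_to_K, hnorm] at hgap
    simp at hgap
    have habs : Δ ≤ |lam - e| := by rw [abs_of_pos (by linarith)]; linarith
    rw [inner_filterConj_apply hW.integrable hH hv hφ.eigen, hW.fourier _ habs, horth]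
    have hne : ((lam : ℂ) - e) ≠ 0 := sub_ne_zero.2 (by exact_mod_cast he)
    push_cast
    field_simp
    rw [Complex.I_sq]
    ring

end Velocity

end

noncomputable section

/-! ### Short transport paths are nearly straight -/

section Transport

variable {E : Type*} [NormedAddCommGroup E] [InnerProductSpace ℂ E] [CompleteSpace E]
  [FiniteDimensional ℂ E]

/-- Evolution along a short path by a generator that induces the velocity of ground states yields
ground states, and the resulting path is nearly straight. -/
theorem isNearlyStraight_of_transport {H₀ A₀ : E →L[ℂ] E} {H A D : ℝ → E →L[ℂ] E} {χ : ℝ → E}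
    {Ψ p : E} {γ e₀ e₁ M r : ℝ} (hγ : 0 < γ) (hr : 0 ≤ r) (hMr : 16 * M * r ≤ 1)
    (hsa₀ : IsSelfAdjoint H₀) (hΨ : IsGapped H₀ γ e₀ Ψ) (hp : IsVelocity H₀ e₀ Ψ A₀ p)
    (hA₀ : ‖A₀‖ ≤ 2 * M * γ)
    (hsa : ∀ s, IsSelfAdjoint (H s)) (hH : ∀ s, HasDerivAt H (A s) s)
    (hHs : ∀ s ∈ Set.Icc 0 r, ‖H s - H₀‖ ≤ 4 * M * γ * r) (hA : ∀ s, ‖A s‖ ≤ 2 * M * γ)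
    (hAs : ∀ s ∈ Set.Icc 0 r, ‖A s - A₀‖ ≤ 8 * M ^ 2 * γ * r)
    (hD : ∀ s, IsSelfAdjoint (D s))
    (hvel : ∀ s e φ, IsGapped (H s) (γ / 2) e φ →
      IsVelocity (H s) e φ (A s) (Complex.I • D s φ))
    (hχ : ∀ s, HasDerivAt χ (Complex.I • D s (χ s)) s) (h0 : IsGround (H 0) e₁ (χ 0))
    (hclose : ‖χ 0 - Ψ‖ ≤ 4 * M * r) :
    (∃ e, IsGapped (H r) (γ / 2) e (χ r)) ∧ ‖χ r - χ 0‖ ≤ 4 * M * r ∧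
      IsNearlyStraight r (4 * M) (144 * M ^ 2 * r) p χ (fun s => Complex.I • D s (χ s)) := by
  have hM : 0 ≤ M := by
    have := (norm_nonneg _).trans hA₀
    by_contra! h
    nlinarith [mul_pos_of_neg_of_neg h (neg_neg_of_pos hγ)]
  -- Since 16Mr ≤ 1, the Hamiltonian moves by at most 4Mγr ≤ γ/4, which costs at most half of the
  -- gap.
  have hgap : ∀ s ∈ Set.Icc 0 r, ∀ e φ, IsGround (H s) e φ → IsGapped (H s) (γ / 2) e φ := by
    intro s hs e φ hφ
    have h1 : ‖H s - H₀‖ ≤ γ / 4 := by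
      refine (hHs s hs).trans ?_
      nlinarith
    have := hΨ.perturb hγ hsa₀ (hsa s) hφ h1 (by linarith)
    rwa [show γ - 2 * (γ / 4) = γ / 2 by ring] at this
  have hground := isGround_of_transport (half_pos hγ) hsa hH hgap hD
    (fun s hs e φ hφ => hvel s e φ (hgap s hs e φ hφ)) hχ h0
  have hnorm : ∀ s ∈ Set.Icc 0 r, ‖Complex.I • D s (χ s)‖ ≤ 4 * M := by
    intro s hs
    obtain ⟨e, he⟩ := hground s hs
    have h1 := hgap s hs _ _ he
    have h2 := ((hvel s e _ h1).norm_le h1).trans (hA s)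
    have h3 : γ / 2 * ‖Complex.I • D s (χ s)‖ ≤ γ / 2 * (4 * M) := by linarith
    exact le_of_mul_le_mul_left h3 (half_pos hγ)
  have hdist : ∀ s ∈ Set.Icc 0 r, ‖χ s - χ 0‖ ≤ 4 * M * r := by
    intro s hs
    have h1 := norm_image_sub_le_of_norm_deriv_le_segment' (f := χ) (a := 0) (b := r)
      (fun t _ => (hχ t).hasDerivWithinAt) (fun t ht => hnorm t ⟨ht.1, ht.2.le⟩) s hs
    rw [sub_zero] at h1
    exact h1.trans (mul_le_mul_of_nonneg_left hs.2 (by positivity))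
  have hr' : r ∈ Set.Icc 0 r := ⟨hr, le_rfl⟩
  obtain ⟨e, he⟩ := hground r hr'
  refine ⟨⟨e, hgap r hr' e _ he⟩, hdist r hr', fun s _ => hχ s, fun s hs => ?_, hnorm,
    fun s hs => ?_⟩
  · obtain ⟨e, he⟩ := hground s hs
    exact (hvel s e _ (hgap s hs _ _ he)).orth
  · obtain ⟨e, he⟩ := hground s hs
    have h1 := hp.norm_velocity_sub_le hΨ hγ (hvel s e _ (hgap s hs _ _ he)) he.norm_eq
      ((hΨ.isGround hγ.le hsa₀).abs_energy_sub_le he)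
    have h2 : ‖χ s - Ψ‖ ≤ 8 * M * r := by
      calc _ ≤ ‖χ s - χ 0‖ + ‖χ 0 - Ψ‖ := norm_sub_le_norm_sub_add_norm_sub _ _ _
        _ ≤ 4 * M * r + 4 * M * r := add_le_add (hdist s hs) hclose
        _ = _ := by ring
    have h3 := hnorm s hs
    have h4 := hHs s hs
    have h5 := hAs s hs
    -- The contributions in units of M²r are 32 + 16 + 64 + 32 = 144, in the order of the terms of
    -- `norm_velocity_sub_le`.
    calc _ ≤ _ := h1
      _ ≤ 8 * M * r * (4 * M) + (8 * M ^ 2 * γ * r * 2 + 4 * (2 * M * γ) * (8 * M * r) +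
          2 * (4 * M * γ * r) * (4 * M)) / γ := by gcongr
      _ = _ := by field_simp; ring

end Transport

/-! ### Evolution around the square and the Hall conductance -/

section Loop

variable {L : ℕ} {Λ : Lattice L} {H HX HY : ℝ → ℝ → Λ.Op} {M K κ γ e₀ : ℝ} {Ψ : Λ.Hilb}
  {W : ℝ → ℝ}

namespace IsFluxFamily

theorem continuous_left (hF : IsFluxFamily H HX HY K κ) (y : ℝ) : Continuous fun x => H x y :=
  continuous_iff_continuousAt.2 fun x => (hF.derivX x y).continuousAt

/-- Exchanging the two fluxes turns evolution in x into evolution in y, so transport has to be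
proved in one direction only. -/
theorem swap (hF : IsFluxFamily H HX HY K κ) :
    IsFluxFamily (fun x y => H y x) (fun x y => HY y x) (fun x y => HX y x) K κ where
  selfAdjoint x y := hF.selfAdjoint y x
  selfAdjointX x y := hF.selfAdjointY y x
  selfAdjointY x y := hF.selfAdjointX y x
  derivX x y := hF.derivY y x
  derivY x y := hF.derivX y x
  contX y := hF.contY y
  contY x := hF.contX x
  normX x y := hF.normY y x
  normY x y := hF.normX y x
  lipX x y := by rw [add_comm]; exact hF.lipY y x
  lipY x y := by rw [add_comm]; exact hF.lipX y x

theorem norm_sub_le (hF : IsFluxFamily H HX HY K κ) (x y : ℝ) :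
    ‖H x y - H 0 0‖ ≤ K * (|x| + |y|) := by
  let _ : NormedSpace ℝ Λ.Op := NormedSpace.restrictScalars ℝ ℂ _
  have h1 := convex_univ.norm_image_sub_le_of_norm_hasDerivWithin_le (f := fun x => H x y)
    (fun t _ => (hF.derivX t y).hasDerivWithinAt) (fun t _ => hF.normX t y)
    (Set.mem_univ 0) (Set.mem_univ x)
  have h2 := convex_univ.norm_image_sub_le_of_norm_hasDerivWithin_le (f := fun y => H 0 y)
    (fun t _ => (hF.derivY 0 t).hasDerivWithinAt) (fun t _ => hF.normY 0 t)
    (Set.mem_univ 0) (Set.mem_univ y)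
  rw [sub_zero, Real.norm_eq_abs] at h1 h2
  calc _ ≤ ‖H x y - H 0 y‖ + ‖H 0 y - H 0 0‖ := norm_sub_le_norm_sub_add_norm_sub _ _ _
    _ ≤ K * |x| + K * |y| := add_le_add h1 h2
    _ = _ := by ring

theorem genX_eq (hF : IsFluxFamily H HX HY K κ) (W : ℝ → ℝ) (x y : ℝ) :
    genX W H x y = filterConj W (H x y) (HX x y) := by
  rw [genX, (hF.derivX x y).deriv]; rfl

theorem isPropagator_evolX (hF : IsFluxFamily H HX HY K κ) (hW : MeasureTheory.Integrable W)
    (x y : ℝ) : IsPropagator (fun s => genX W H (x + s) y) (evolX W H x y) := by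
  refine isPropagator_propagator (C := (∫ t, |W t|) * K) ?_ fun s => ?_
  · simp_rw [hF.genX_eq]
    exact continuous_filterConj hW ((hF.continuous_left y).comp (continuous_const_add x))
      ((hF.contX y).comp (continuous_const_add x)) (fun s => hF.selfAdjoint _ _)
      (fun s => hF.normX _ _)
  · rw [hF.genX_eq]
    exact (norm_filterConj_le (hF.selfAdjoint _ _) _).trans
      (mul_le_mul_of_nonneg_left (hF.normX _ _) (MeasureTheory.integral_nonneg fun t => abs_nonneg _))

theorem norm_mul_add_le {r x y a : ℝ} (ha : 0 ≤ a) (hx : x ∈ Set.Icc 0 r) (hy : y ∈ Set.Icc 0 r) :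
    a * (|x| + |y|) ≤ a * (2 * r) := by
  rw [abs_of_nonneg hx.1, abs_of_nonneg hy.1]
  have := hx.2
  have := hy.2
  gcongr
  linarith

variable {r e₁ : ℝ} {p φ : Λ.Hilb}

theorem transportX (hF : IsFluxFamily H HX HY (2 * M * γ) (4 * M ^ 2 * γ)) (hγ : 0 < γ)
    (hΨ : IsGapped (H 0 0) γ e₀ Ψ) (hp : IsVelocity (H 0 0) e₀ Ψ (HX 0 0) p)
    (hW : IsFilter (γ / 2) W) (hr : 0 ≤ r) (hMr : 16 * M * r ≤ 1) {y : ℝ} (hy : y ∈ Set.Icc 0 r)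
    (h0 : IsGround (H 0 y) e₁ φ) (hclose : ‖φ - Ψ‖ ≤ 4 * M * r) :
    (∃ e, IsGapped (H r y) (γ / 2) e (evolX W H 0 y r φ)) ∧
      ‖evolX W H 0 y r φ - φ‖ ≤ 4 * M * r ∧ evolX W H 0 y 0 φ = φ ∧
      IsNearlyStraight r (4 * M) (144 * M ^ 2 * r) p (fun s => evolX W H 0 y s φ)
        (fun s => Complex.I • genX W H s y (evolX W H 0 y s φ)) := by
  obtain ⟨hU0, hU⟩ := hF.isPropagator_evolX hW.integrable 0 y
  simp only [zero_add] at hU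
  have hφ0 : evolX W H 0 y 0 φ = φ := by rw [hU0]; rfl
  have hK : 0 ≤ 2 * M * γ := (norm_nonneg _).trans (hF.normX 0 0)
  have h := isNearlyStraight_of_transport (H₀ := H 0 0) (H := fun s => H s y)
    (A := fun s => HX s y) (D := fun s => genX W H s y) (χ := fun s => evolX W H 0 y s φ) (e₁ := e₁)
    hγ hr hMr (hF.selfAdjoint 0 0) hΨ hp (hF.normX 0 0)
    (fun s => hF.selfAdjoint s y) (fun s => hF.derivX s y)
    (fun s hs => (hF.norm_sub_le s y).trans
      ((norm_mul_add_le hK hs hy).trans (le_of_eq (by ring))))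
    (fun s => hF.normX s y)
    (fun s hs => (hF.lipX s y).trans
      ((norm_mul_add_le (by positivity) hs hy).trans (le_of_eq (by ring))))
    (fun s => by
      rw [hF.genX_eq]
      exact isSelfAdjoint_filterConj hW.integrable (hF.selfAdjoint _ _) (hF.selfAdjointX _ _))
    (fun s e φ hφ => by
      rw [hF.genX_eq]
      exact isVelocity_filterConj hW le_rfl (half_pos hγ) (hF.selfAdjoint _ _) hφ)
    (fun s => ((ContinuousLinearMap.apply ℂ Λ.Hilb φ).restrictScalars ℝ).hasFDerivAt.comp_hasDerivAt s
      (hU s)) (by simpa only [hφ0] using h0)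
    (by simpa only [hφ0] using hclose)
  simp only [hφ0] at h
  exact ⟨h.1, h.2.1, hφ0, h.2.2⟩

theorem transportY (hF : IsFluxFamily H HX HY (2 * M * γ) (4 * M ^ 2 * γ)) (hγ : 0 < γ)
    (hΨ : IsGapped (H 0 0) γ e₀ Ψ) (hp : IsVelocity (H 0 0) e₀ Ψ (HY 0 0) p)
    (hW : IsFilter (γ / 2) W) (hr : 0 ≤ r) (hMr : 16 * M * r ≤ 1) {x : ℝ} (hx : x ∈ Set.Icc 0 r)
    (h0 : IsGround (H x 0) e₁ φ) (hclose : ‖φ - Ψ‖ ≤ 4 * M * r) :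
    (∃ e, IsGapped (H x r) (γ / 2) e (evolY W H x 0 r φ)) ∧
      ‖evolY W H x 0 r φ - φ‖ ≤ 4 * M * r ∧ evolY W H x 0 0 φ = φ ∧
      IsNearlyStraight r (4 * M) (144 * M ^ 2 * r) p (fun s => evolY W H x 0 s φ)
        (fun s => Complex.I • genY W H x s (evolY W H x 0 s φ)) :=
  hF.swap.transportX hγ hΨ hp hW hr hMr hx h0 hclose

theorem inner_loopState (W : ℝ → ℝ) (H : ℝ → ℝ → Λ.Op) (Ψ : Λ.Hilb) (r : ℝ) :
    ⟪Ψ, loopState W H Ψ r⟫_ℂ =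
      ⟪evolX W H 0 r r (evolY W H 0 0 r Ψ), evolY W H r 0 r (evolX W H 0 0 r Ψ)⟫_ℂ := by
  simp only [loopState, evolLoop, evolV, evolW, zero_add, sub_zero]
  generalize evolX W H 0 r r = A, evolY W H 0 0 r = B, evolY W H r 0 r = C, evolX W H 0 0 r = D
  rw [ContinuousLinearMap.star_eq_adjoint]
  exact ContinuousLinearMap.adjoint_inner_right (A * B) Ψ ((C * D) Ψ)

/-- The edges starting at the origin are transported first; their end points are ground states
within one edge length of Ψ, which is what the other two edges need. Both routes end in ground
states of the gapped H(r, r), so their overlap has modulus 1. -/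
theorem norm_inner_loopState_cpow_sub_le (hF : IsFluxFamily H HX HY (2 * M * γ) (4 * M ^ 2 * γ))
    (hγ : 0 < γ) (hΨ : IsGapped (H 0 0) γ e₀ Ψ) {p q : Λ.Hilb}
    (hp : IsVelocity (H 0 0) e₀ Ψ (HX 0 0) p) (hq : IsVelocity (H 0 0) e₀ Ψ (HY 0 0) q)
    (hW : IsFilter (γ / 2) W) (hr : 0 < r) (hMr : 16 * M * r ≤ 1) :
    ‖⟪Ψ, loopState W H Ψ r⟫_ℂ ^ (((2 * Real.pi / r) ^ 2 : ℝ) : ℂ) -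
        Complex.exp (Complex.I * ((2 * Real.pi) ^ 2 * (2 * (⟪q, p⟫_ℂ).im) : ℝ))‖ ≤
      19712 * (2 * Real.pi) ^ 2 * M ^ 3 * r := by
  have h0 : (0 : ℝ) ∈ Set.Icc 0 r := ⟨le_rfl, hr.le⟩
  have hr' : r ∈ Set.Icc 0 r := ⟨hr.le, le_rfl⟩
  have hgr := hΨ.isGround hγ.le (hF.selfAdjoint 0 0)
  have hM : 0 ≤ M := by
    have := (norm_nonneg _).trans (hF.normX 0 0)
    by_contra! h
    nlinarith [mul_pos_of_neg_of_neg h (neg_neg_of_pos hγ)]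
  have hvel : ∀ {A : Λ.Op} {u : Λ.Hilb}, IsVelocity (H 0 0) e₀ Ψ A u → ‖A‖ ≤ 2 * M * γ →
      ‖u‖ ≤ 4 * M := fun hu hA => by
    have h1 := (hu.norm_le hΨ).trans hA
    have h2 : γ * _ ≤ γ * (2 * M) := h1.trans (le_of_eq (by ring))
    exact (le_of_mul_le_mul_left h2 hγ).trans (by linarith)
  have hΨΨ : ‖Ψ - Ψ‖ ≤ 4 * M * r := by rw [sub_self, norm_zero]; positivity
  obtain ⟨⟨e₁, g₁⟩, d₁, z₁, s₁⟩ := hF.transportX hγ hΨ hp hW hr.le hMr h0 hgr hΨΨ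
  obtain ⟨⟨e₃, g₃⟩, d₃, z₃, s₃⟩ := hF.transportY hγ hΨ hq hW hr.le hMr h0 hgr hΨΨ
  obtain ⟨⟨e₂, g₂⟩, -, z₂, s₂⟩ := hF.transportY hγ hΨ hq hW hr.le hMr hr'
    (g₁.isGround (half_pos hγ).le (hF.selfAdjoint _ _)) d₁
  obtain ⟨⟨e₄, g₄⟩, -, z₄, s₄⟩ := hF.transportX hγ hΨ hp hW hr.le hMr hr'
    (g₃.isGround (half_pos hγ).le (hF.selfAdjoint _ _)) d₃
  have hphase := (g₄.unique (half_pos hγ) (hF.selfAdjoint r r)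
    (g₂.isGround (half_pos hγ).le (hF.selfAdjoint r r))).2.1
  rw [inner_loopState]
  have key := norm_inner_cpow_sub_exp_le hr (by linarith) s₁ s₂ s₃ s₄ (z₁.trans z₃.symm) z₂ z₄
    (hvel hp (hF.normX 0 0)) (hvel hq (hF.normY 0 0)) g₂.norm_eq g₄.norm_eq hphase
  -- With c = 4M and δ = 144M²r: 20 · 144 · 4 + 128 · 4³ = 19712.
  refine key.trans (le_of_eq ?_)
  ring

/-- The Hall conductance is determined by the velocities of the ground states. -/
theorem isHallConductance_iff (hF : IsFluxFamily H HX HY K κ) (hγ : 0 < γ)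
    (hΨ : IsGapped (H 0 0) γ e₀ Ψ) {p q : Λ.Hilb}
    (hp : IsVelocity (H 0 0) e₀ Ψ (HX 0 0) p) (hq : IsVelocity (H 0 0) e₀ Ψ (HY 0 0) q)
    (e h σ : ℝ) :
    IsHallConductance e h H Ψ σ ↔ σ = 2 * (⟪q, p⟫_ℂ).im * (2 * Real.pi * (e ^ 2 / h)) := by
  constructor
  · rintro ⟨ψX, ψY, vX, vY, hX, hY, hX0, hY0, hvX, hvY, rfl⟩
    have hX' : ∀ᶠ θ in 𝓝 0, ∃ e, IsGround (H θ 0) e (ψX θ) := by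
      filter_upwards [hX] with θ hθ using (isGroundState_iff (hF.selfAdjoint θ 0)).1 hθ
    have hY' : ∀ᶠ θ in 𝓝 0, ∃ e, IsGround (H 0 θ) e (ψY θ) := by
      filter_upwards [hY] with θ hθ using (isGroundState_iff (hF.selfAdjoint 0 θ)).1 hθ
    obtain ⟨eX, hX'⟩ := hX'.choice
    obtain ⟨eY, hY'⟩ := hY'.choice
    obtain ⟨c, hc⟩ := eq_add_smul_of_hasDerivAt (H := fun θ => H θ 0) (hF.selfAdjoint 0 0)
      (hF.derivX 0 0) hΨ hγ hX' hX0 hvX hp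
    obtain ⟨d, hd⟩ := eq_add_smul_of_hasDerivAt (H := fun θ => H 0 θ) (hF.selfAdjoint 0 0)
      (hF.derivY 0 0) hΨ hγ hY' hY0 hvY hq
    -- The gauge components icΨ and idΨ are orthogonal to the velocities and pair with each other to
    -- the real number dc.
    have h1 : ⟪vY, vX⟫_ℂ = ⟪q, p⟫_ℂ + (d * c : ℝ) := by
      rw [hc, hd, inner_add_left, inner_add_right, inner_add_right, inner_smul_left,
        inner_smul_right, inner_smul_left, inner_smul_right, hp.orth, inner_eq_zero_symm.1 hq.orth,
        inner_self_eq_norm_sq_to_K, hΨ.norm_eq]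
      simp
      linear_combination (-(d : ℂ) * c) * Complex.I_mul_I
    rw [h1, Complex.add_im, Complex.ofReal_im, add_zero]
  · rintro rfl
    obtain ⟨ψX, eX, hX, hX0, hXg⟩ := exists_gauge (H := fun θ => H θ 0)
      (fun θ => hF.selfAdjoint θ 0) hΨ hγ
    obtain ⟨ψY, eY, hY, hY0, hYg⟩ := exists_gauge (H := fun θ => H 0 θ)
      (fun θ => hF.selfAdjoint 0 θ) hΨ hγ
    refine ⟨ψX, ψY, p, q, Filter.Eventually.of_forall fun θ =>
      (isGroundState_iff (hF.selfAdjoint θ 0)).2 ⟨_, hX θ⟩, Filter.Eventually.of_forall fun θ =>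
      (isGroundState_iff (hF.selfAdjoint 0 θ)).2 ⟨_, hY θ⟩, hX0, hY0, ?_, ?_, rfl⟩
    · exact hasDerivAt_of_gauge (H := fun θ => H θ 0) (hF.selfAdjoint 0 0) (hF.derivX 0 0) hΨ hγ
        (Filter.Eventually.of_forall hX) hX0 hXg hp
    · exact hasDerivAt_of_gauge (H := fun θ => H 0 θ) (hF.selfAdjoint 0 0) (hF.derivY 0 0) hΨ hγ
        (Filter.Eventually.of_forall hY) hY0 hYg hq

end IsFluxFamily

end Loop

/-- The flux Hamiltonians of a gapped system, with bounds in units of the gap. -/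
theorem exists_isFluxFamily_of_gapped {L : ℕ} {Λ : Lattice L} {qmax kmax : ℕ} {J R γ e : ℝ}
    {q : Site L → Λ.Op} {Φ : Finset (Site L) → Λ.Op} {Ψ : Λ.Hilb} (hJ : 0 < J) (hR : 1 ≤ R)
    (hL : 2 * R < L) (hγ : 0 < γ) (hq : IsCharge Λ qmax q) (hΦ : IsInteraction Λ J R kmax Φ)
    (hΨ : IsGapped (hamiltonian₀ Φ) γ e Ψ) {M : ℝ} (hM : M = R * kmax * qmax * (J / γ) * L) :
    ∃ HX HY, IsFluxFamily (fluxHamiltonian R q Φ) HX HY (2 * M * γ) (4 * M ^ 2 * γ) := by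
  obtain ⟨HX, HY, hF, hsub⟩ := exists_isFluxFamily hJ.le (by linarith) hq hΦ
  refine ⟨HX, HY, ?_⟩
  have hK : kmax * qmax * (2 * R * L * J) = 2 * M * γ := by
    rw [hM]
    field_simp
  have hκ : (kmax * qmax) ^ 2 * (2 * R * L * J) = (kmax * qmax) * (2 * M * γ) := by
    rw [← hK]; ring
  have hM0 : 0 ≤ M := by rw [hM]; positivity
  rw [hK, hκ] at hF
  rcases gap_le_of_interaction hγ hΦ hΨ with h | h
  -- J/γ ≥ 1/2, R ≥ 1 and L ≥ 1 absorb one factor kmax·qmax of the variation rate into 2M.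
  · have h1 : (kmax * qmax : ℝ) ≤ 2 * M := by
      have h2 : 1 / 2 ≤ J / γ := by rw [div_le_div_iff₀ two_pos hγ]; linarith
      have h3 : (1 : ℝ) ≤ L := by linarith
      calc (kmax * qmax : ℝ) = 2 * (1 * kmax * qmax * (1 / 2) * 1) := by ring
        _ ≤ 2 * M := by rw [hM]; gcongr
    have h4 : (kmax * qmax) * (2 * M * γ) ≤ 4 * M ^ 2 * γ := by
      calc _ ≤ 2 * M * (2 * M * γ) := by gcongr
        _ = _ := by ring
    exact { hF with
      lipX := fun x y => (hF.lipX x y).trans (by gcongr)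
      lipY := fun x y => (hF.lipY x y).trans (by gcongr) }
  · have hX : ∀ x y, HX x y = 0 := fun x y => (hsub h x y).1
    have hY : ∀ x y, HY x y = 0 := fun x y => (hsub h x y).2
    exact { hF with
      lipX := fun x y => by rw [hX, hX, sub_zero, norm_zero]; positivity
      lipY := fun x y => by rw [hY, hY, sub_zero, norm_zero]; positivity }

end

end QuantumHall

/-! ### The main theorem -/

open QuantumHall in
theorem mainTheorem2 :
    (∀ Δ : ℝ, 0 < Δ → IsFilter Δ (standardFilter Δ)) ∧
    ∃ C : ℝ, 0 < C ∧
      ∀ (L : ℕ) (Λ : Lattice L) (qmax kmax : ℕ) (J R γ e h : ℝ)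
        (q : Site L → Λ.Op) (Φ : Finset (Site L) → Λ.Op) (Ψ₀ : Λ.Hilb),
        0 < J → 1 ≤ R → 1 ≤ kmax → 2 * R < L → 0 < γ → e ≠ 0 → 0 < h →
        IsCharge Λ qmax q →
        IsInteraction Λ J R kmax Φ →
        Commute (totalCharge q) (hamiltonian₀ Φ) →
        IsGappedGroundState (hamiltonian₀ Φ) γ Ψ₀ →
        ∃ σ : ℝ,
          IsHallConductance e h (fluxHamiltonian R q Φ) Ψ₀ σ ∧
          (∀ σ' : ℝ, IsHallConductance e h (fluxHamiltonian R q Φ) Ψ₀ σ' → σ' = σ) ∧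
          ∀ W : ℝ → ℝ, IsFilter (γ / 2) W →
            ∀ r : ℝ, 0 < r → 16 * (R * kmax * qmax) * (J / γ) * L * r ≤ 1 →
              ‖(inner ℂ Ψ₀ (loopState W (fluxHamiltonian R q Φ) Ψ₀ r)) ^
                    (((2 * Real.pi / r) ^ 2 : ℝ) : ℂ)
                  - Complex.exp (2 * Real.pi * Complex.I * (σ * (e ^ 2 / h)⁻¹ : ℝ))‖
                ≤ C * ((R * kmax * qmax) * (J / γ) * L) ^ 3 * r := by
  refine ⟨fun Δ hΔ => isFilter_standardFilter hΔ, 19712 * (2 * Real.pi) ^ 2, by positivity, ?_⟩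
  intro L Λ qmax kmax J R γ e h q Φ Ψ₀ hJ hR _ hL hγ he hh hq hΦ hcomm hgap
  obtain ⟨hnorm, e₀, hspan, hlow⟩ := hgap
  have hΨ₀ := isGapped_of_eigenspace
    (isSelfAdjoint_sum (R := Λ.Op) _ fun Z _ => hΦ.selfAdjoint Z) hnorm hspan hlow
  set M := R * kmax * qmax * (J / γ) * L with hM
  obtain ⟨HX, HY, hF⟩ := exists_isFluxFamily_of_gapped hJ hR hL hγ hq hΦ hΨ₀ hM
  have hΨ : IsGapped (fluxHamiltonian R q Φ 0 0) γ e₀ Ψ₀ := by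
    rw [fluxHamiltonian_zero hcomm]; exact hΨ₀
  -- The standard filter serves only to exhibit velocities at the origin. Velocities are unique, so
  -- σ is compared with the loop phase for any other filter as well.
  have hW₀ := isFilter_standardFilter (half_pos hγ)
  have hp := isVelocity_filterConj (A := HX 0 0) hW₀ (half_le_self hγ.le) hγ (hF.selfAdjoint 0 0) hΨ
  have hq := isVelocity_filterConj (A := HY 0 0) hW₀ (half_le_self hγ.le) hγ (hF.selfAdjoint 0 0) hΨ
  have hHall := hF.isHallConductance_iff hγ hΨ hp hq e h
  refine ⟨_, (hHall _).2 rfl, fun σ' hσ' => (hHall σ').1 hσ', fun W hW r hr hMr => ?_⟩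
  have key := hF.norm_inner_loopState_cpow_sub_le hγ hΨ hp hq hW hr
    (by rw [hM]; linarith)
  -- What remains is that 2πσ(e²/h)⁻¹ equals (2π)² · 2 Im⟨q, p⟩.
  convert key using 4
  push_cast
  have : (e : ℂ) ≠ 0 := by exact_mod_cast he
  have : (h : ℂ) ≠ 0 := by exact_mod_cast hh.ne'
  field_simp
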